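/- **Theorem.** Let $a_1,a_2,a_3\ge 1$ be integers, $w=a_1+a_2+a_3$, and for $\tau=\tau_1+i\tau_2$ with $\tau_2>0$ let $$C_{a_1,a_2,a_3}(\tau)=\sum\ \prod_{r=1}^3\left(\frac{\tau_2}{\pi|m_r+n_r\tau|^2}\right)^{a_r},$$ where the sum runs over all triples of pairs $(m_r,n_r)\in\mathbb Z^2\setminus\{(0,0)\}$, $r=1,2,3$, with $m_1+m_2+m_3=0$ and $n_1+n_2+n_3=0$; this series converges absolutely. Its constant Fourier mode $C^{(0)}_{a_1,a_2,a_3}(\tau_2)=\int_0^1 C_{a_1,a_2,a_3}(\tau_1+i\tau_2)\,d\tau_1$ satisfies, for all $\tau_2>0$, $$C^{(0)}_{a_1,a_2,a_3}(\tau_2)=\mathcal L(\tau_2)+\mathcal E(\tau_2),$$ where $\mathcal E(\tau_2)=O(e^{-\delta\tau_2})$ as $\tau_2\to\infty$ for some $\delta>0$, and $\mathcal L$ is a Laurent polynomial in $\tau_2$ of degree $(w,1-w)$ (the highest power of $\tau_2$ that occurs is $w$, the lowest is $1-w$), given by $$\mathcal L(\tau_2)=c_w(-4\pi\tau_2)^w+\sum_{k=1}^{w-1}c_{w-2k-1}\,\zeta(2k+1)\,(4\pi\tau_2)^{w-2k-1}+c_{2-w}(4\pi\tau_2)^{2-w}.$$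 Here $B_n$ are the Bernoulli numbers, $\theta(x)=1$ for $x\ge0$ and $\theta(x)=0$ for $x<0$, $[x]$ is the integer part, a term containing $\theta(x)$ with $x<0$ is $0$, $\mathfrak S_3$ is the group of permutations of $\{1,2,3\}$, and $$g_{a_1,a_2}(\alpha,\beta)=(-1)^{a_1}\binom{2a_1-2-\alpha-\beta}{a_1-1}\binom{a_2+\alpha-1}{a_2-1}\binom{a_2+\beta-1}{a_2-1}\in\mathbb Z .$$ (a) The coefficient $c_w$ is the rational number $$c_w=\sum_{k=0}^{a_2}\frac{B_{2k}B_{2w-2k}}{(2k)!\,(2w-2k)!}\,\frac{\Gamma(2a_2+2a_3-2k)}{\Gamma(2a_3)\,\Gamma(2a_2-2k+1)}+(a_2\leftrightarrow a_3).$$ (b) For $1\le k\le w-1$ the coefficient $c_{w-2k-1}$ is the rational number $c_{w-2k-1}=\frac{2B_{2w-2k-2}}{(2w-2k-2)!}\sum_{\sigma\in\mathfrak S_3}s_k(a_{\sigma(1)},a_{\sigma(2)},a_{\sigma(3)})$, where $$s_k(a_1,a_2,a_3)=\sum_{\alpha=0}^{a_1-1}\sum_{\beta=0}^{a_1-1-\alpha}(-1)^{a_1+a_3+\beta+1}\,\theta\!\left(a_3+\left[\tfrac{a_2+\beta}{2}\right]-w+k+1\right)g_{a_1,a_2}(\alpha,\beta)\binom{2k-2a_1+\alpha+\beta+1}{a_2+\alpha-1}.$$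 (c) The coefficient $c_{2-w}$ is $$c_{2-w}=c^0_{2-w}\,(-1)^w\zeta(2w-2)+2\sum_{\sigma\in\mathfrak S_3}Z(a_{\sigma(1)},a_{\sigma(2)},a_{\sigma(3)}),$$ where $c^0_{2-w}$ is the integer $c^0_{2-w}=\sum_{\sigma\in\mathfrak S_3}t(a_{\sigma(1)},a_{\sigma(2)},a_{\sigma(3)})$ with $$t(a_1,a_2,a_3)=\sum_{\alpha=0}^{a_1-1}\sum_{\beta=0}^{a_1-1-\alpha}(-1)^{a_2+\beta}g_{a_1,a_2}(\alpha,\beta)\binom{2a_2+2a_3+\alpha+\beta-2}{a_2+\alpha-1},$$ and $Z$ is the following linear combination, with integer coefficients, of double zeta values $\zeta(a,b)=\sum_{m,n\ge1}(m+n)^{-a}n^{-b}$ of weight $a+b=2w-2$: $$Z(a_1,a_2,a_3)=\sum_{k=1}^{a_1}\sum_{\ell=1}^{a_1}\binom{a_1+a_2-k-1}{a_2-1}\binom{a_1+a_2-\ell-1}{a_2-1}\binom{k+\ell-2}{k-1}\binom{2w-k-\ell-2}{w-k-1}\,\zeta(2w-k-\ell-1,\,k+\ell-1).$$ -/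

import Mathlib

open Filter Topology Finset MeasureTheory
open scoped LaurentPolynomial

noncomputable section

namespace ModularGraph

/-- The `ℓ`-tuples of pairs `(m_r, n_r) ≠ (0, 0)` of integers with
`∑ m_r = 0` and `∑ n_r = 0`. -/
abbrev Momenta (ℓ : ℕ) : Type :=
  {p : Fin ℓ → ℤ × ℤ // (∀ r, p r ≠ 0) ∧ ∑ r, p r = 0}

/-- The summand `∏_r (τ₂ / (π |m_r + n_r τ|²)) ^ a_r`. -/
def summand {ℓ : ℕ} (a : Fin ℓ → ℕ) (τ : ℂ) (p : Momenta ℓ) : ℝ :=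
  ∏ r, (τ.im / (Real.pi * ‖((p.1 r).1 : ℂ) + ((p.1 r).2 : ℂ) * τ‖ ^ 2)) ^ a r

/-- The modular graph function `C_{a_1, …, a_ℓ}(τ)`; only values with `0 < τ.im` matter. -/
def modularGraphFunction {ℓ : ℕ} (a : Fin ℓ → ℕ) (τ : ℂ) : ℝ :=
  ∑' p : Momenta ℓ, summand a τ p

/-- The constant Fourier mode `∫₀¹ C_a(x + i y) dx` in the real part of `τ = x + i y`. -/
def constantMode {ℓ : ℕ} (a : Fin ℓ → ℕ) (y : ℝ) : ℝ :=
  ∫ x in (0 : ℝ)..1, modularGraphFunction a ((x : ℂ) + (y : ℂ) * Complex.I)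

/-- The weight `w = a_1 + a_2 + a_3`. -/
def weight (a : Fin 3 → ℕ) : ℕ := ∑ r, a r

/-- Half of the coefficient `c_w`; the ratio of Gamma values
`Γ(2a₂+2a₃-2k) / (Γ(2a₃) Γ(2a₂-2k+1))` is written with factorials. -/
def topTerm (w a₂ a₃ : ℕ) : ℚ :=
  ∑ k ∈ range (a₂ + 1),
    bernoulli (2 * k) * bernoulli (2 * w - 2 * k)
        / (((2 * k).factorial : ℚ) * ((2 * w - 2 * k).factorial : ℚ))
      * (((2 * a₂ + 2 * a₃ - 2 * k - 1).factorial : ℚ)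
          / (((2 * a₃ - 1).factorial : ℚ) * ((2 * a₂ - 2 * k).factorial : ℚ)))

/-- The coefficient `c_w`. -/
def topCoeff (a : Fin 3 → ℕ) : ℚ :=
  topTerm (weight a) (a 1) (a 2) + topTerm (weight a) (a 2) (a 1)

/-- The integer `g_{a₁,a₂}(α, β)`. -/
def g (a₁ a₂ α β : ℕ) : ℤ :=
  (-1) ^ a₁ * ((2 * a₁ - 2 - α - β).choose (a₁ - 1) : ℤ)
    * ((a₂ + α - 1).choose (a₂ - 1) : ℤ) * ((a₂ + β - 1).choose (a₂ - 1) : ℤ)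

/-- The step function, equal to `1` for `x ≥ 0` and to `0` otherwise. -/
def step (x : ℤ) : ℤ := if 0 ≤ x then 1 else 0

/-- The double sum over `α, β` in `c_{w-2k-1}`, for one ordering of the exponents.
Where the step function is `1` one has `2k + 1 + α + β - 2a₁ ≥ a₂ + α - 1`, so that the
truncated subtraction in the binomial coefficient is the true one. -/
def oddZetaTerm (a₁ a₂ a₃ k : ℕ) : ℤ :=
  ∑ α ∈ range a₁, ∑ β ∈ range (a₁ - α),
    (-1) ^ (a₁ + a₃ + β + 1)
      * step ((a₃ : ℤ) + (((a₂ + β) / 2 : ℕ) : ℤ) - ((a₁ + a₂ + a₃ : ℕ) : ℤ) + (k : ℤ) + 1)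
      * g a₁ a₂ α β * ((2 * k + 1 + α + β - 2 * a₁).choose (a₂ + α - 1) : ℤ)

/-- The coefficient `c_{w-2k-1}`, for `1 ≤ k ≤ w - 1`. -/
def oddZetaCoeff (a : Fin 3 → ℕ) (k : ℕ) : ℚ :=
  2 * bernoulli (2 * weight a - 2 * k - 2) / ((2 * weight a - 2 * k - 2).factorial : ℚ)
    * ((∑ σ : Equiv.Perm (Fin 3), oddZetaTerm (a (σ 0)) (a (σ 1)) (a (σ 2)) k : ℤ) : ℚ)

/-- The double sum over `α, β` in `c⁰_{2-w}`, for one ordering of the exponents. -/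
def evenZetaTerm (a₁ a₂ a₃ : ℕ) : ℤ :=
  ∑ α ∈ range a₁, ∑ β ∈ range (a₁ - α),
    (-1) ^ (a₂ + β) * g a₁ a₂ α β
      * ((2 * a₂ + 2 * a₃ + α + β - 2).choose (a₂ + α - 1) : ℤ)

/-- The integer `c⁰_{2-w}`. -/
def evenZetaCoeff (a : Fin 3 → ℕ) : ℤ :=
  ∑ σ : Equiv.Perm (Fin 3), evenZetaTerm (a (σ 0)) (a (σ 1)) (a (σ 2))

/-- The value `ζ(s)` of the Riemann zeta function at a natural number, as a real number. -/
def zeta (s : ℕ) : ℝ := (riemannZeta (s : ℂ)).re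

/-- The double zeta value `ζ(s, t) = ∑_{m, n ≥ 1} 1 / ((m + n)^s n^t)`. -/
def doubleZeta (s t : ℕ) : ℝ :=
  ∑' p : ℕ+ × ℕ+, 1 / (((p.1 : ℝ) + (p.2 : ℝ)) ^ s * (p.2 : ℝ) ^ t)

/-- The combination `Z(a₁, a₂, a₃)` of double zeta values of weight `2w - 2`. -/
def Z (a₁ a₂ a₃ : ℕ) : ℝ :=
  ∑ k ∈ Icc 1 a₁, ∑ l ∈ Icc 1 a₁,
    (((a₁ + a₂ - k - 1).choose (a₂ - 1) * (a₁ + a₂ - l - 1).choose (a₂ - 1)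
        * (k + l - 2).choose (k - 1)
        * (2 * (a₁ + a₂ + a₃) - k - l - 2).choose (a₁ + a₂ + a₃ - k - 1) : ℕ) : ℝ)
      * doubleZeta (2 * (a₁ + a₂ + a₃) - k - l - 1) (k + l - 1)

/-- The coefficient `c_{2-w}`. -/
def bottomCoeff (a : Fin 3 → ℕ) : ℝ :=
  (evenZetaCoeff a : ℝ) * (-1) ^ weight a * zeta (2 * weight a - 2)
    + 2 * ∑ σ : Equiv.Perm (Fin 3), Z (a (σ 0)) (a (σ 1)) (a (σ 2))

end ModularGraph

end

namespace ModularGraph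

/-! Group the lattice sum by the coefficients n = (n₁, n₂) of τ = x + iy, with n₃ = -n₁ - n₂. For
fixed n the remaining sum runs over m₁ + m₂ + m₃ = 0 of a product of Lorentzians (ξ² + c²)⁻ᵃ with c
= nᵣ y, ξ = mᵣ + nᵣ x. By orthogonality of characters it is the integral over [0, 1] of a product of
three trigonometric series (`ofReal_latticeRow_eq_integral`). If nᵣ ≠ 0, Poisson summation
(`trigSeries_lorentz`) turns the series into a sum of integer translates of a kernel, a polynomial
in |t| times exp(-2π|nᵣ|y|t|), each with a phase. Up to an exponentially small error only products
of equal translates survive; their phases cancel because the nᵣ add up to zero, and on [0, 1] only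
the translates by 0 and -1 matter. These two fold into one half-line integral, in which x no longer
appears. So the modular graph function itself, uniformly in x, is a Laurent polynomial plus
O(e^(-y/2)) (`exists_abs_modularGraphFunction_sub_le`), and its constant mode inherits this.

The half-line integrals give the coefficients. For n = 0 the row is summed exactly by partial
fractions and the even zeta values (`hasSum_lorentz_zero_triple`): this is the power w. If exactly
one nᵣ vanishes, its series is a Bernoulli polynomial, and moments of a product of two kernels
appear (`hasSum_pair`): even moments produce the odd zeta values, and the lone nonzero odd-index
Bernoulli number B₁ produces ζ(2w-2). If no nᵣ vanishes, symmetry reduces to n₁, n₂ > 0, so that the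
three kernel parameters satisfy z = x + y; the integral is evaluated on the Fourier side by
convolving Lorentzians (`integral_besselKernel_triple`), and summation gives double zeta values
(`hasSum_triple`).

The double sums over α and β in the statement agree with these moments only after symmetrization in
the first two exponents. A Vandermonde convolution turns them into `poleCoeff`, which is a moment at
p ≥ 0 and antisymmetric at negative even p, so the unwanted part cancels (`oddZetaTerm_add_comm`).

For the degree, the coefficient of the power w is a nonzero multiple of a sum of nonnegative terms,
one of them positive. That of 1 - w comes from k = w - 1 and is a nonzero multiple of an alternating
sum of three even moments. The even moments have a product formula (`momentCoeff_even`), derived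
from the three-term recursion of reverse Bessel polynomials, and a size comparison excludes
cancellation. -/

/-! ### Binomial convolutions and partial fractions -/

/-- Coefficient of xⁿ in (1 - x)^(-r-1) (1 - x)^(-q-1) = (1 - x)^(-r-q-2); the induction uses
Pascal's rule in both r and n. -/
theorem sum_choose_mul_choose (r q n : ℕ) :
    ∑ j ∈ range (n + 1), (r + n - j).choose r * (q + j).choose j = (r + q + n + 1).choose n := by
  induction r generalizing n with
  | zero =>
    simp only [Nat.choose_zero_right, one_mul, zero_add]
    induction n with
    | zero => simp
    | succ n ih =>
      rw [sum_range_succ, ih, show q + (n + 1) + 1 = (q + n + 1) + 1 by ring, Nat.choose_succ_succ]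
      rfl
  | succ r ih =>
    induction n with
    | zero => simp
    | succ n ihn =>
      have h1 : ∑ j ∈ range (n + 1 + 1), (r + 1 + (n + 1) - j).choose (r + 1) * (q + j).choose j
          = ∑ j ∈ range (n + 1), (r + 1 + n - j).choose (r + 1) * (q + j).choose j
            + ∑ j ∈ range (n + 1 + 1), (r + (n + 1) - j).choose r * (q + j).choose j := by
        rw [sum_range_succ, sum_range_succ (n := n + 1), ← add_assoc (Finset.sum _ _), ← sum_add_distrib]
        congr 1
        · refine sum_congr rfl fun j hj => ?_
          have hj' : j ≤ n := by simpa [Nat.lt_succ_iff] using hj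
          rw [show r + 1 + (n + 1) - j = (r + 1 + n - j) + 1 by omega, Nat.choose_succ_succ,
            show r + (n + 1) - j = r + 1 + n - j by omega]
          ring
        · simp
      rw [h1, ihn, ih, show r + 1 + q + (n + 1) + 1 = (r + 1 + q + n + 1) + 1 by ring,
        show r + q + (n + 1) + 1 = r + 1 + q + n + 1 by ring,
        Nat.choose_succ_succ (r + 1 + q + n + 1) n]

theorem sum_choose_mul_choose_pred {b : ℕ} (hb : 1 ≤ b) (q : ℕ) :
    ∑ j ∈ range b, (2 * b - 2 - j).choose (b - 1) * (q + j).choose j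
      = (2 * b - 1 + q).choose (b - 1) := by
  obtain ⟨n, rfl⟩ : ∃ n, b = n + 1 := ⟨b - 1, by omega⟩
  have := sum_choose_mul_choose n q n
  rw [show 2 * (n + 1) - 1 + q = n + q + n + 1 by omega, Nat.add_sub_cancel, ← this]
  refine sum_congr rfl fun j _ => ?_
  rw [show 2 * (n + 1) - 2 - j = n + n - j by omega]

/-- If `1/u + 1/w = 1/v`, the partial fraction decomposition of `u ^ (a + 1) * w ^ (b + 1)`. -/
theorem pow_mul_pow_eq_partialFractions {R : Type*} [CommRing R] {u w v : R}
    (h : u * w = v * (u + w)) (a b : ℕ) :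
    u ^ (a + 1) * w ^ (b + 1)
      = ∑ i ∈ range (a + 1), ((a + b - i).choose b : R) * (u ^ (i + 1) * v ^ (a + b + 1 - i))
        + ∑ i ∈ range (b + 1),
            ((a + b - i).choose a : R) * (w ^ (i + 1) * v ^ (a + b + 1 - i)) := by
  -- The case where one of the two exponents is 1. Applied with u and w exchanged, it also starts
  -- the induction on a.
  have base : ∀ {u w : R}, u * w = v * (u + w) → ∀ a, u ^ (a + 1) * w
      = ∑ i ∈ range (a + 1), u ^ (i + 1) * v ^ (a + 1 - i) + w * v ^ (a + 1) := by
    intro u w h a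
    induction a with
    | zero => simp; linear_combination h
    | succ a ih =>
      have e : u ^ (a + 1 + 1) * w = v * u ^ (a + 1 + 1) + v * (u ^ (a + 1) * w) := by
        linear_combination u ^ (a + 1) * h
      rw [e, ih, sum_range_succ (n := a + 1), mul_add, mul_sum]
      have : ∑ i ∈ range (a + 1), v * (u ^ (i + 1) * v ^ (a + 1 - i))
          = ∑ i ∈ range (a + 1), u ^ (i + 1) * v ^ (a + 1 + 1 - i) := by
        refine sum_congr rfl fun i hi => ?_
        have : i ≤ a := by simpa [Nat.lt_succ_iff] using hi
        rw [show a + 1 + 1 - i = (a + 1 - i) + 1 by omega]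
        ring
      rw [this, show a + 1 + 1 - (a + 1) = 1 by omega]
      ring
  induction a generalizing b with
  | zero =>
    have := base (u := w) (w := u) (by linear_combination h) b
    simp only [zero_add, pow_one, Nat.choose_zero_right, range_one, sum_singleton, Nat.cast_one,
      one_mul, Nat.sub_zero, Nat.choose_self]
    rw [mul_comm, this]; ring
  | succ a iha =>
    induction b with
    | zero =>
      have := base h (a + 1)
      simp only [zero_add, pow_one, Nat.choose_zero_right, range_one, sum_singleton, Nat.cast_one,
        one_mul, Nat.sub_zero, add_zero, Nat.choose_self]
      rw [this]
    | succ b ihb =>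
      -- One use of the relation lowers either exponent by one. Pascal's rule in `key` then
      -- recombines the coefficients of each half, used once for (u, a, b) and once for (w, b, a).
      have e : u ^ (a + 1 + 1) * w ^ (b + 1 + 1)
          = v * (u ^ (a + 1) * w ^ (b + 1 + 1)) + v * (u ^ (a + 1 + 1) * w ^ (b + 1)) := by
        linear_combination u ^ (a + 1) * w ^ (b + 1) * h
      have key : ∀ (x : R) (a b : ℕ),
          ∑ i ∈ range (a + 1 + 1), ((a + 1 + (b + 1) - i).choose (b + 1) : R)
              * (x ^ (i + 1) * v ^ (a + 1 + (b + 1) + 1 - i))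
          = v * (∑ i ∈ range (a + 1), ((a + (b + 1) - i).choose (b + 1) : R)
              * (x ^ (i + 1) * v ^ (a + (b + 1) + 1 - i)))
            + v * (∑ i ∈ range (a + 1 + 1), ((a + 1 + b - i).choose b : R)
              * (x ^ (i + 1) * v ^ (a + 1 + b + 1 - i))) := by
        intro x a b
        rw [sum_range_succ, sum_range_succ (n := a + 1), mul_add, ← add_assoc (v * Finset.sum _ _), mul_sum, mul_sum,
          ← sum_add_distrib]
        congr 1
        · refine sum_congr rfl fun i hi => ?_
          have : i ≤ a := by simpa [Nat.lt_succ_iff] using hi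
          rw [show a + 1 + (b + 1) - i = (a + 1 + b - i) + 1 by omega, Nat.choose_succ_succ,
            show a + (b + 1) - i = a + 1 + b - i by omega,
            show a + 1 + (b + 1) + 1 - i = (a + 1 + b + 1 - i) + 1 by omega,
            show a + (b + 1) + 1 - i = a + 1 + b + 1 - i by omega]
          push_cast
          ring
        · rw [show a + 1 + (b + 1) - (a + 1) = b + 1 by omega,
            show a + 1 + b - (a + 1) = b by omega,
            show a + 1 + (b + 1) + 1 - (a + 1) = (a + 1 + b + 1 - (a + 1)) + 1 by omega]
          simp only [Nat.choose_self]
          ring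
      rw [e, iha (b + 1), ihb, key u a b]
      have k2 := key w b a
      simp only [show b + 1 + (a + 1) = a + 1 + (b + 1) by ring, show b + (a + 1) = a + 1 + b by ring,
        show b + 1 + a = a + (b + 1) by ring] at k2
      rw [k2]
      ring

/-! ### Moment coefficients and the double sums over α and β -/

/-- `∑_{i,j} C(2a-2-i, a-1) C(2b-2-j, b-1) (i+j+p)! / (i! j! p!)`. -/
def momentCoeff (a b p : ℕ) : ℕ :=
  ∑ i ∈ range a, ∑ j ∈ range b, (2 * a - 2 - i).choose (a - 1) * (2 * b - 2 - j).choose (b - 1)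
    * ((i + p).choose i * (i + p + j).choose j)

/-- Both sides are the multinomial coefficient (i + j + p)! / (i! j! p!). -/
theorem choose_mul_choose_comm (i j p : ℕ) :
    (i + p).choose i * (i + p + j).choose j = (j + p).choose j * (j + p + i).choose i := by
  have h1 := Nat.add_choose_mul_factorial_mul_factorial i p
  have h2 := Nat.add_choose_mul_factorial_mul_factorial (i + p) j
  have h3 := Nat.add_choose_mul_factorial_mul_factorial j p
  have h4 := Nat.add_choose_mul_factorial_mul_factorial (j + p) i
  rw [← Nat.choose_symm_add] at h1 h3
  have : 0 < i.factorial * j.factorial * p.factorial := by positivity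
  apply Nat.eq_of_mul_eq_mul_right this
  rw [show j + p + i = i + p + j by ring] at h4 ⊢
  calc _ = ((i + p + j).choose j) * ((i + p).choose i * i.factorial * p.factorial) * j.factorial := by
        ring
    _ = (i + p + j).choose i * ((j + p).choose j * j.factorial * p.factorial) * i.factorial := by
        rw [h1, h3]; linarith [h2, h4]
    _ = _ := by ring

theorem momentCoeff_comm (a b p : ℕ) : momentCoeff a b p = momentCoeff b a p := by
  unfold momentCoeff
  rw [sum_comm]
  refine sum_congr rfl fun i _ => sum_congr rfl fun j _ => ?_
  rw [choose_mul_choose_comm]; ring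

theorem momentCoeff_eq_sum {a b : ℕ} (hb : 1 ≤ b) (p : ℕ) :
    momentCoeff a b p = ∑ i ∈ range a, (2 * a - 2 - i).choose (a - 1) * (i + p).choose i
      * (2 * b - 1 + (i + p)).choose (b - 1) := by
  refine sum_congr rfl fun i _ => ?_
  rw [← sum_choose_mul_choose_pred hb, mul_sum]
  exact sum_congr rfl fun j _ => by ring

/-- A Vandermonde convolution. -/
theorem sum_antidiagonal_choose (b N i : ℕ) :
    ∑ x ∈ antidiagonal i, (-1 : ℤ) ^ x.2 * (b + x.1).choose b * (b + x.2).choose b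
        * N.choose (b + x.1)
      = Ring.choose ((N : ℤ) - 2 * b - 1) i * N.choose b := by
  rcases lt_or_ge N b with h | h
  · rw [Nat.choose_eq_zero_of_lt h]
    simp only [Nat.cast_zero, mul_zero]
    refine sum_eq_zero fun x _ => ?_
    rw [Nat.choose_eq_zero_of_lt (show N < b + x.1 by omega)]; simp
  -- Chu–Vandermonde for the upper indices N - b and -(b + 1); the negative index is what produces
  -- the signs (-1)^x.2, and `Ring.choose` is needed because the total may be negative.
  · have e : (N : ℤ) - 2 * b - 1 = ((N - b : ℕ) : ℤ) + (-(b + 1 : ℕ) : ℤ) := by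
      push_cast [Nat.cast_sub h]; ring
    rw [e, Ring.add_choose_eq i (Commute.all _ _), sum_mul]
    refine sum_congr rfl fun x _ => ?_
    rw [Ring.choose_natCast, Ring.choose_neg]
    have h1 : N.choose (b + x.1) * (b + x.1).choose b = N.choose b * (N - b).choose x.1 := by
      rw [Nat.choose_mul (by omega)]; simp
    have h2 : Ring.choose (((b + 1 : ℕ) : ℤ) + x.2 - 1) x.2 = ((b + x.2).choose b : ℤ) := by
      rw [show (((b + 1 : ℕ) : ℤ) + x.2 - 1) = ((b + x.2 : ℕ) : ℤ) by push_cast; ring,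
        Ring.choose_natCast, ← Nat.choose_symm_add]
    rw [h2]
    have h1' : (N.choose (b + x.1) : ℤ) * (b + x.1).choose b = N.choose b * (N - b).choose x.1 := by
      exact_mod_cast h1
    simp only [Int.negOnePow_def, Units.smul_def, smul_eq_mul]
    simp
    linear_combination (-1 : ℤ) ^ x.2 * (b + x.2).choose b * h1'

/-- The coefficient of `h ^ p` in the residue at one of the poles. -/
def poleCoeff (a b : ℕ) (p : ℤ) : ℤ :=
  ∑ i ∈ range a, ((2 * a - 2 - i).choose (a - 1) : ℤ) *
    if 0 ≤ p + 2 * b - 1 + i then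
      Ring.choose (p + i) i * ((p + 2 * b - 1 + i).toNat.choose (b - 1) : ℤ) else 0

/-- Collecting the terms with α + β = i leaves a Vandermonde convolution with N = p + 2b - 1 + i,
whose value has upper index N - 2(b - 1) - 1 = p + i. -/
theorem sum_choose_eq_poleCoeff {a b : ℕ} (hb : 1 ≤ b) (p : ℤ) :
    ∑ α ∈ range a, ∑ β ∈ range (a - α), (if 0 ≤ p + 2 * b - 1 + α + β then
      (-1) ^ β * ((2 * a - 2 - α - β).choose (a - 1) : ℤ) * (b + α - 1).choose (b - 1)
        * (b + β - 1).choose (b - 1) * (p + 2 * b - 1 + α + β).toNat.choose (b + α - 1) else 0)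
    = poleCoeff a b p := by
  obtain ⟨b, rfl⟩ : ∃ n, b = n + 1 := ⟨b - 1, by omega⟩
  rw [← sum_range_diag_flip a (fun α β => (if 0 ≤ p + 2 * ((b + 1 : ℕ) : ℤ) - 1 + α + β then
      (-1) ^ β * ((2 * a - 2 - α - β).choose (a - 1) : ℤ) * (b + 1 + α - 1).choose (b + 1 - 1)
        * (b + 1 + β - 1).choose (b + 1 - 1)
        * (p + 2 * ((b + 1 : ℕ) : ℤ) - 1 + α + β).toNat.choose (b + 1 + α - 1) else 0))]
  unfold poleCoeff
  refine sum_congr rfl fun i _ => ?_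
  rw [← Nat.sum_antidiagonal_eq_sum_range_succ (fun α β =>
    (if 0 ≤ p + 2 * ((b + 1 : ℕ) : ℤ) - 1 + α + β then
      (-1) ^ β * ((2 * a - 2 - α - β).choose (a - 1) : ℤ) * (b + 1 + α - 1).choose (b + 1 - 1)
        * (b + 1 + β - 1).choose (b + 1 - 1)
        * (p + 2 * ((b + 1 : ℕ) : ℤ) - 1 + α + β).toNat.choose (b + 1 + α - 1) else 0))]
  split_ifs with h
  · obtain ⟨N, hN⟩ := Int.eq_ofNat_of_zero_le h
    rw [hN, show p + (i : ℤ) = (N : ℤ) - 2 * b - 1 by push_cast at hN; linarith]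
    have := sum_antidiagonal_choose b N i
    simp only [Nat.add_sub_cancel, Int.toNat_natCast]
    rw [← this, mul_sum]
    refine sum_congr rfl fun x hx => ?_
    have hx : x.1 + x.2 = i := by simpa using hx
    have hx' : (x.1 : ℤ) + x.2 = i := by exact_mod_cast hx
    rw [add_assoc, hx', if_pos h, hN, Int.toNat_natCast, Nat.sub_sub, hx,
      show b + 1 + x.1 - 1 = b + x.1 by omega, show b + 1 + x.2 - 1 = b + x.2 by omega]
    ring
  · rw [mul_zero]
    refine sum_eq_zero fun x hx => ?_
    have hx : x.1 + x.2 = i := by simpa using hx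
    have hx' : (x.1 : ℤ) + x.2 = i := by exact_mod_cast hx
    rw [add_assoc, hx', if_neg h]

/-- The floor in the step function encodes exactly the inequality 2k + 1 + α + β - 2a ≥ b + α - 1.
When it fails, the binomial coefficient vanishes anyway, unless its true upper index is negative;
those terms are the ones removed by the condition in `poleCoeff`. -/
theorem oddZetaTerm_eq {a b : ℕ} (hb : 1 ≤ b) (c k : ℕ) :
    oddZetaTerm a b c k = (-1) ^ (c + 1) * poleCoeff a b (2 * k + 2 - 2 * a - 2 * b) := by
  rw [← sum_choose_eq_poleCoeff hb, mul_sum]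
  refine sum_congr rfl fun α _ => ?_
  rw [mul_sum]
  refine sum_congr rfl fun β _ => ?_
  unfold step g
  have hs : ∀ n : ℕ, ((-1 : ℤ) ^ n) * (-1) ^ n = 1 := fun n => by rw [← mul_pow]; simp
  have e1 : (-1 : ℤ) ^ (a + c + β + 1) = (-1) ^ a * (-1) ^ β * (-1) ^ (c + 1) := by
    rw [← pow_add, ← pow_add]; congr 1; ring
  by_cases h : (0 : ℤ) ≤ 2 * k + 2 - 2 * a - 2 * b + 2 * b - 1 + α + β
  · rw [if_pos h, show (2 * (k : ℤ) + 2 - 2 * a - 2 * b + 2 * b - 1 + α + β).toNat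
      = 2 * k + 1 + α + β - 2 * a by omega]
    split_ifs with h2
    · rw [e1]
      linear_combination (-1) ^ β * (-1 : ℤ) ^ (c + 1) * ((2 * a - 2 - α - β).choose (a - 1) : ℤ)
        * (b + α - 1).choose (b - 1) * (b + β - 1).choose (b - 1)
        * (2 * k + 1 + α + β - 2 * a).choose (b + α - 1) * hs a
    · rw [Nat.choose_eq_zero_of_lt (show 2 * k + 1 + α + β - 2 * a < b + α - 1 by omega)]
      simp
  · rw [if_neg h, if_neg (by omega)]
    simp

theorem evenZetaTerm_eq {a b c : ℕ} (hb : 1 ≤ b) (hc : 1 ≤ c) :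
    evenZetaTerm a b c = (-1) ^ (a + b) * poleCoeff a b (2 * c - 1) := by
  rw [← sum_choose_eq_poleCoeff hb, mul_sum]
  refine sum_congr rfl fun α _ => ?_
  rw [mul_sum]
  refine sum_congr rfl fun β _ => ?_
  unfold g
  rw [if_pos (by omega), show (2 * (c : ℤ) - 1 + 2 * b - 1 + α + β).toNat
      = 2 * b + 2 * c + α + β - 2 by omega]
  ring

theorem poleCoeff_natCast {a b : ℕ} (hb : 1 ≤ b) (p : ℕ) :
    poleCoeff a b p = momentCoeff a b p := by
  rw [momentCoeff_eq_sum hb]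
  push_cast
  refine sum_congr rfl fun i _ => ?_
  rw [if_pos (by omega), show (p : ℤ) + i = ((i + p : ℕ) : ℤ) by push_cast; ring,
    Ring.choose_natCast, show ((p : ℤ) + 2 * b - 1 + i).toNat = 2 * b - 1 + (i + p) by omega]
  ring

/-- At a negative order, `Ring.choose` becomes (-1)^i C(q, i) for i ≤ q and vanishes for i > q. The
double sum displays the near-symmetry under exchange of a and b, which only the sign (-1)^i
violates. -/
theorem poleCoeff_neg {a b : ℕ} (hb : 1 ≤ b) (q : ℕ) :
    poleCoeff a b (-(q + 1)) = ∑ i ∈ range a, ∑ j ∈ range b, if i + j = q then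
      (-1) ^ i * ((2 * a - 2 - i).choose (a - 1) : ℤ) * (2 * b - 2 - j).choose (b - 1)
        * q.choose i else 0 := by
  refine sum_congr rfl fun i _ => ?_
  rcases lt_or_ge q i with h | h
  · rw [if_pos (by omega), show -((q : ℤ) + 1) + i = ((i - q - 1 : ℕ) : ℤ) by omega,
      Ring.choose_natCast, Nat.choose_eq_zero_of_lt (show i - q - 1 < i by omega)]
    rw [sum_eq_zero fun j _ => if_neg (by omega)]
    simp
  · have e : ∀ j, (i + j = q) = (j = q - i) := fun j => propext (by omega)
    simp only [e, sum_ite_eq']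
    have hc : Ring.choose (-((q : ℤ) + 1) + i) i = (-1) ^ i * q.choose i := by
      rw [show -((q : ℤ) + 1) + i = -((q - i + 1 : ℕ) : ℤ) by omega, Ring.choose_neg,
        show (((q - i + 1 : ℕ) : ℤ) + i - 1) = ((q : ℕ) : ℤ) by omega, Ring.choose_natCast]
      simp [Int.negOnePow_def, Units.smul_def]
    rw [hc]
    by_cases hj : q - i < b
    · rw [if_pos (by omega), if_pos (by simpa using hj),
        show (-((q : ℤ) + 1) + 2 * b - 1 + i).toNat = 2 * b - 2 - (q - i) by omega]
      ring
    · rw [if_neg (show ¬ (q - i) ∈ range b by simpa using hj)]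
      split_ifs with h2
      · rw [Nat.choose_eq_zero_of_lt (show (-((q : ℤ) + 1) + 2 * b - 1 + i).toNat < b - 1 by omega)]
        simp
      · simp

/-- Exchanging a and b exchanges i and j. As i + j = q is odd, (-1)^j = -(-1)^i while C(q, i) = C(q,
j), so the sums cancel term by term. -/
theorem poleCoeff_add_poleCoeff_comm {a b : ℕ} (ha : 1 ≤ a) (hb : 1 ≤ b) {q : ℕ} (hq : Odd q) :
    poleCoeff a b (-(q + 1)) + poleCoeff b a (-(q + 1)) = 0 := by
  rw [poleCoeff_neg hb, poleCoeff_neg ha, sum_comm (s := range b), ← sum_add_distrib]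
  refine sum_eq_zero fun i _ => ?_
  rw [← sum_add_distrib]
  refine sum_eq_zero fun j _ => ?_
  by_cases h : i + j = q
  · rw [if_pos h, if_pos (by omega)]
    have e : (-1 : ℤ) ^ j = - (-1) ^ i := by
      have h1 : (-1 : ℤ) ^ (i + j) = -1 := by rw [h]; exact hq.neg_one_pow
      have h2 : (-1 : ℤ) ^ i * (-1) ^ i = 1 := by rw [← mul_pow]; simp
      rw [pow_add] at h1
      linear_combination (-1) ^ i * h1 - (-1) ^ j * h2
    have : q.choose j = q.choose i := by rw [← h]; exact Nat.choose_symm_add.symm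
    rw [e, this]
    ring
  · rw [if_neg h, if_neg (by omega)]; rfl

/-- The even moments, continued by zero to negative order. -/
def evenMoment (a b : ℕ) (k : ℕ) : ℕ :=
  if a + b ≤ k + 1 then momentCoeff a b (2 * (k + 1 - a - b)) else 0

/-- The order p = 2k + 2 - 2a - 2b is even. If p ≥ 0, both terms are the same moment; if p < 0, then
p = -(q + 1) with q odd and the two terms cancel. This is why the coefficients are summed over all
permutations. -/
theorem oddZetaTerm_add_comm {a b : ℕ} (ha : 1 ≤ a) (hb : 1 ≤ b) (c k : ℕ) :
    oddZetaTerm a b c k + oddZetaTerm b a c k = (-1) ^ (c + 1) * (2 * evenMoment a b k) := by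
  rw [oddZetaTerm_eq hb, oddZetaTerm_eq ha, ← mul_add,
    show (2 * (k : ℤ) + 2 - 2 * b - 2 * a) = 2 * k + 2 - 2 * a - 2 * b by ring]
  congr 1
  unfold evenMoment
  split_ifs with h
  · rw [show (2 * (k : ℤ) + 2 - 2 * a - 2 * b) = ((2 * (k + 1 - a - b) : ℕ) : ℤ) by omega,
      poleCoeff_natCast hb, poleCoeff_natCast ha, momentCoeff_comm b a]
    ring
  · rw [show (2 * (k : ℤ) + 2 - 2 * a - 2 * b) = -(((2 * (a + b - k - 2) + 1 : ℕ) : ℤ) + 1) by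
      omega, poleCoeff_add_poleCoeff_comm ha hb ⟨_, rfl⟩]
    simp

theorem evenZetaTerm_add_comm {a b c : ℕ} (ha : 1 ≤ a) (hb : 1 ≤ b) (hc : 1 ≤ c) :
    evenZetaTerm a b c + evenZetaTerm b a c = (-1) ^ (a + b) * (2 * momentCoeff a b (2 * c - 1)) := by
  rw [evenZetaTerm_eq hb hc, evenZetaTerm_eq ha hc, add_comm b a, ← mul_add,
    show (2 * (c : ℤ) - 1) = ((2 * c - 1 : ℕ) : ℤ) by omega, poleCoeff_natCast hb,
    poleCoeff_natCast ha, momentCoeff_comm b a]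
  ring

/-- The permutations are paired by exchange of the first two arguments, the form to which the
symmetrization lemmas apply. -/
theorem sum_perm_fin_three {M : Type*} [AddCommMonoid M] (f : Fin 3 → Fin 3 → Fin 3 → M) :
    ∑ σ : Equiv.Perm (Fin 3), f (σ 0) (σ 1) (σ 2)
      = f 0 1 2 + f 1 0 2 + (f 0 2 1 + f 2 0 1) + (f 1 2 0 + f 2 1 0) := by
  have h : (univ : Finset (Equiv.Perm (Fin 3))) = {1, Equiv.swap 0 1, Equiv.swap 1 2,
      Equiv.swap 0 2 * Equiv.swap 0 1, Equiv.swap 0 1 * Equiv.swap 0 2, Equiv.swap 0 2} := by decide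
  have e : ∀ (i j k : Fin 3) (σ : Equiv.Perm (Fin 3)), σ 0 = i → σ 1 = j → σ 2 = k →
      f (σ 0) (σ 1) (σ 2) = f i j k := by rintro _ _ _ σ rfl rfl rfl; rfl
  rw [h, sum_insert (by decide), sum_insert (by decide), sum_insert (by decide),
    sum_insert (by decide), sum_insert (by decide), sum_singleton]
  rw [e 0 1 2 1 (by decide) (by decide) (by decide), e 1 0 2 (Equiv.swap 0 1) (by decide) (by decide) (by decide),
   e 0 2 1 (Equiv.swap 1 2) (by decide) (by decide) (by decide),
   e 1 2 0 (Equiv.swap 0 2 * Equiv.swap 0 1) (by decide) (by decide) (by decide),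
   e 2 0 1 (Equiv.swap 0 1 * Equiv.swap 0 2) (by decide) (by decide) (by decide),
   e 2 1 0 (Equiv.swap 0 2) (by decide) (by decide) (by decide)]
  abel

/-! ### Product formula for the even moments -/

/-- The coefficients of the reverse Bessel polynomials. -/
def besselCoeff (n j : ℕ) : ℚ := (2 * n - j).choose n * n.factorial / j.factorial

theorem besselCoeff_eq {n j : ℕ} (h : j ≤ n) :
    besselCoeff n j = (2 * n - j).factorial / ((n - j).factorial * j.factorial) := by
  unfold besselCoeff
  rw [Nat.cast_choose ℚ (by omega), show 2 * n - j - n = n - j by omega]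
  have : (n.factorial : ℚ) ≠ 0 := by positivity
  field_simp

/-- With Bₙ(x) the polynomial having these coefficients, this is the three-term recursion Bₙ₊₂ = x²
Bₙ + (4n + 6) Bₙ₊₁ in degree j + 2; degrees 0 and 1, where the x² term is absent, are treated
separately. -/
theorem besselCoeff_succ_succ {n j : ℕ} (h : j ≤ n) :
    besselCoeff (n + 2) (j + 2) = besselCoeff n j + (4 * n + 6) * besselCoeff (n + 1) (j + 2) := by
  obtain ⟨d, rfl⟩ := Nat.exists_eq_add_of_le h
  rw [besselCoeff_eq (by omega), besselCoeff_eq (by omega)]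
  rcases d with _ | d
  · have : besselCoeff (j + 0 + 1) (j + 2) = 0 := by
      unfold besselCoeff
      rw [Nat.choose_eq_zero_of_lt (by omega)]; simp
    rw [this]
    simp only [add_zero, Nat.sub_self, show 2 * (j + 2) - (j + 2) = j + 2 by omega,
      show 2 * j - j = j by omega]
    have : (j.factorial : ℚ) ≠ 0 := by positivity
    have : ((j + 2).factorial : ℚ) ≠ 0 := by positivity
    field_simp
    simp
  · rw [besselCoeff_eq (by omega), show 2 * (j + (d + 1) + 2) - (j + 2) = (j + 2 * d + 2) + 1 + 1 by omega,
      show j + (d + 1) + 2 - (j + 2) = d + 1 by omega,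
      show 2 * (j + (d + 1)) - j = j + 2 * d + 2 by omega,
      show j + (d + 1) - j = d + 1 by omega,
      show 2 * (j + (d + 1) + 1) - (j + 2) = j + 2 * d + 2 by omega,
      show j + (d + 1) + 1 - (j + 2) = d by omega]
    simp only [Nat.factorial_succ]
    have : (j.factorial : ℚ) ≠ 0 := by positivity
    have : (d.factorial : ℚ) ≠ 0 := by positivity
    push_cast
    field_simp
    ring

theorem besselCoeff_zero_right (n : ℕ) :
    besselCoeff (n + 2) 0 = (4 * n + 6) * besselCoeff (n + 1) 0 := by
  rw [besselCoeff_eq (by omega), besselCoeff_eq (by omega), Nat.sub_zero, Nat.sub_zero, Nat.sub_zero,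
    Nat.sub_zero, show 2 * (n + 2) = 2 * (n + 1) + 1 + 1 by ring]
  simp only [Nat.factorial_succ]
  have : (n.factorial : ℚ) ≠ 0 := by positivity
  push_cast
  field_simp
  ring

theorem besselCoeff_one_right (n : ℕ) :
    besselCoeff (n + 2) 1 = (4 * n + 6) * besselCoeff (n + 1) 1 := by
  rw [besselCoeff_eq (by omega), besselCoeff_eq (by omega), show n + 2 - 1 = n + 1 by omega,
    show n + 1 - 1 = n by omega, show 2 * (n + 2) - 1 = 2 * n + 1 + 1 + 1 by omega,
    show 2 * (n + 1) - 1 = 2 * n + 1 by omega]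
  simp only [Nat.factorial_succ]
  have : (n.factorial : ℚ) ≠ 0 := by positivity
  push_cast
  field_simp
  ring

/-- The recursion seen through the linear functional xʲ ↦ h j: multiplication by x² is a shift of h
by two. -/
theorem sum_besselCoeff_mul (n : ℕ) (h : ℕ → ℚ) :
    ∑ j ∈ range (n + 3), besselCoeff (n + 2) j * h j
      = ∑ j ∈ range (n + 1), besselCoeff n j * h (j + 2)
        + (4 * n + 6) * ∑ j ∈ range (n + 2), besselCoeff (n + 1) j * h j := by
  have h0 : besselCoeff (n + 1) (n + 2) = 0 := by
    unfold besselCoeff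
    rw [Nat.choose_eq_zero_of_lt (by omega)]; simp
  have e : ∑ j ∈ range (n + 2), besselCoeff (n + 1) j * h j
      = ∑ j ∈ range (n + 3), besselCoeff (n + 1) j * h j := by
    rw [sum_range_succ (n := n + 2), h0]; simp
  rw [e, sum_range_succ', sum_range_succ', sum_range_succ' (n := n + 2),
    sum_range_succ' (n := n + 1)]
  have : ∀ j ∈ range (n + 1), besselCoeff (n + 2) (j + 1 + 1) * h (j + 1 + 1)
      = besselCoeff n j * h (j + 2) + (4 * n + 6) * (besselCoeff (n + 1) (j + 1 + 1) * h (j + 1 + 1)) := by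
    intro j hj
    have : j ≤ n := by simpa [Nat.lt_succ_iff] using hj
    rw [show j + 1 + 1 = j + 2 by ring, besselCoeff_succ_succ this]; ring
  rw [sum_congr rfl this, sum_add_distrib, ← mul_sum]
  simp only [zero_add]
  rw [besselCoeff_zero_right, besselCoeff_one_right]
  ring

/-- Presents the moment as the value of a linear functional on a reverse Bessel polynomial, so that
the three-term recursion in n can be used. -/
theorem factorial_mul_momentCoeff (n m q : ℕ) :
    (n.factorial * q.factorial * momentCoeff (n + 1) (m + 1) q : ℚ)
      = ∑ j ∈ range (n + 1),
          besselCoeff n j * ((j + q).factorial * (2 * m + 1 + (j + q)).choose m) := by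
  rw [momentCoeff_eq_sum (by omega)]
  push_cast
  rw [mul_sum]
  refine sum_congr rfl fun j _ => ?_
  unfold besselCoeff
  have h1 := Nat.add_choose_mul_factorial_mul_factorial j q
  rw [← Nat.choose_symm_add] at h1
  have h1 : ((j + q).choose j * j.factorial * q.factorial : ℚ) = (j + q).factorial := by
    exact_mod_cast h1
  rw [← h1, show 2 * (n + 1) - 2 - j = 2 * n - j by omega,
    show 2 * (m + 1) - 1 + (j + q) = 2 * m + 1 + (j + q) by omega]
  have : (j.factorial : ℚ) ≠ 0 := by positivity
  field_simp

/-- The shift by two in the recursion replaces c by c + 1 and so preserves evenness of the moment.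
Hence strong induction on n with c free closes once n = 0 and n = 1 are checked and the product
formula is seen to satisfy the recursion. -/
theorem sum_besselCoeff_even (n m c : ℕ) :
    ∑ j ∈ range (n + 1),
        besselCoeff n j * ((j + 2 * c).factorial * (2 * m + 1 + (j + 2 * c)).choose m)
      = ((2 * c).factorial * (2 * (n + m + c) + 1).factorial * (m + c).factorial
          * (n + c).factorial : ℚ)
        / ((n + m + c).factorial * (2 * c + n + m + 1).factorial * c.factorial * m.factorial) := by
  have hN : ∀ q, ((q.factorial : ℚ) * (2 * m + 1 + q).choose m)
      = q.factorial * (2 * m + 1 + q).factorial / (m.factorial * (m + 1 + q).factorial) := by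
    intro q
    rw [Nat.cast_choose ℚ (by omega), show 2 * m + 1 + q - m = m + 1 + q by omega]
    ring
  have hfac : ∀ n : ℕ, (n.factorial : ℚ) ≠ 0 := fun n => by positivity
  induction n using Nat.strong_induction_on generalizing c with
  | _ n ih =>
    match n with
    | 0 =>
      simp only [zero_add, range_one, sum_singleton, add_zero]
      rw [hN]
      have : besselCoeff 0 0 = 1 := by simp [besselCoeff]
      rw [this, show 2 * (m + c) + 1 = 2 * m + 1 + 2 * c by ring,
        show 2 * c + m + 1 = m + 1 + 2 * c by ring]
      have := hfac c
      have := hfac m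
      have := hfac (m + c)
      have := hfac (m + 1 + 2 * c)
      field_simp
    | 1 =>
      rw [sum_range_succ, sum_range_one, hN, hN]
      have h0 : besselCoeff 1 0 = 2 := by simp [besselCoeff]
      have h1 : besselCoeff 1 1 = 1 := by simp [besselCoeff]
      rw [h0, h1, show 2 * (1 + m + c) + 1 = (2 * m + 2 * c + 1) + 1 + 1 by ring,
        show 2 * m + 1 + (0 + 2 * c) = 2 * m + 2 * c + 1 by ring,
        show 2 * m + 1 + (1 + 2 * c) = 2 * m + 2 * c + 1 + 1 by ring,
        show m + 1 + (0 + 2 * c) = m + 2 * c + 1 by ring,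
        show m + 1 + (1 + 2 * c) = m + 2 * c + 1 + 1 by ring,
        show 2 * c + 1 + m + 1 = m + 2 * c + 1 + 1 by ring,
        show 1 + m + c = m + c + 1 by ring, show 1 + c = c + 1 by ring,
        show 1 + 2 * c = 2 * c + 1 by ring, zero_add]
      rw [Nat.factorial_succ (2 * m + 2 * c + 1 + 1), Nat.factorial_succ (2 * m + 2 * c + 1),
        Nat.factorial_succ (m + 2 * c + 1), Nat.factorial_succ (m + c), Nat.factorial_succ c,
        Nat.factorial_succ (2 * c)]
      have := hfac c
      have := hfac m
      have := hfac (m + c)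
      have := hfac (m + 2 * c + 1)
      push_cast
      field_simp
      ring
    | n + 2 =>
      rw [sum_besselCoeff_mul, ih (n + 1) (by omega) c]
      have := ih n (by omega) (c + 1)
      simp only [show ∀ j, j + 2 + 2 * c = j + 2 * (c + 1) from fun j => by ring]
      rw [this, show 2 * (n + 2 + m + c) + 1 = 2 * (n + m + c) + 1 + 1 + 1 + 1 + 1 by ring,
        show 2 * (n + m + (c + 1)) + 1 = 2 * (n + m + c) + 1 + 1 + 1 by ring,
        show 2 * (n + 1 + m + c) + 1 = 2 * (n + m + c) + 1 + 1 + 1 by ring,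
        show n + m + (c + 1) = n + m + c + 1 by ring,
        show n + 1 + m + c = n + m + c + 1 by ring,
        show n + 2 + m + c = n + m + c + 1 + 1 by ring,
        show 2 * (c + 1) + n + m + 1 = 2 * c + n + m + 1 + 1 + 1 by ring,
        show 2 * c + (n + 1) + m + 1 = 2 * c + n + m + 1 + 1 by ring,
        show 2 * c + (n + 2) + m + 1 = 2 * c + n + m + 1 + 1 + 1 by ring,
        show n + (c + 1) = n + c + 1 by ring, show n + 1 + c = n + c + 1 by ring,
        show n + 2 + c = n + c + 1 + 1 by ring, show m + (c + 1) = m + c + 1 by ring,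
        show 2 * (c + 1) = 2 * c + 1 + 1 by ring]
      rw [Nat.factorial_succ (2 * (n + m + c) + 1 + 1 + 1 + 1),
        Nat.factorial_succ (2 * (n + m + c) + 1 + 1 + 1), Nat.factorial_succ (n + m + c + 1),
        Nat.factorial_succ (2 * c + n + m + 1 + 1), Nat.factorial_succ (n + c + 1),
        Nat.factorial_succ (m + c), Nat.factorial_succ c,
        Nat.factorial_succ (2 * c + 1), Nat.factorial_succ (2 * c)]
      have := hfac c
      have := hfac m
      have := hfac (n + m + c + 1)
      have := hfac (2 * c + n + m + 1 + 1)
      push_cast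
      field_simp
      ring

/-- The first fraction is symmetric in a, b, c, and the second depends on c and w = a + b + c alone.
The factor (a + b - 1)! is kept in both only to reach this shape, which reduces the comparison of
the three even moments to one function of one variable. -/
theorem momentCoeff_even {a b c : ℕ} (ha : 1 ≤ a) (hb : 1 ≤ b) (hc : 1 ≤ c) :
    (momentCoeff a b (2 * c) : ℚ)
      = (2 * (a + b + c) - 3).factorial * (a + b - 1).factorial * (b + c - 1).factorial
          * (a + c - 1).factorial
        / ((a + b + c - 2).factorial * (a - 1).factorial * (b - 1).factorial * (c - 1).factorial)
        * (1 / ((a + b + c + c - 1).factorial * (a + b + c - c - 1).factorial * c)) := by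
  obtain ⟨n, rfl⟩ : ∃ n, a = n + 1 := ⟨a - 1, by omega⟩
  obtain ⟨m, rfl⟩ : ∃ n, b = n + 1 := ⟨b - 1, by omega⟩
  have h := factorial_mul_momentCoeff n m (2 * c)
  rw [sum_besselCoeff_even] at h
  have hfac : ∀ n : ℕ, (n.factorial : ℚ) ≠ 0 := fun n => by positivity
  rw [show 2 * (n + 1 + (m + 1) + c) - 3 = 2 * (n + m + c) + 1 by omega,
    show n + 1 + (m + 1) + c - c - 1 = n + 1 + (m + 1) - 1 by omega,
    show n + 1 + (m + 1) + c - 2 = n + m + c by omega, Nat.add_sub_cancel, Nat.add_sub_cancel,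
    show n + 1 + (m + 1) + c + c - 1 = 2 * c + n + m + 1 by omega,
    show m + 1 + c - 1 = m + c by omega, show n + 1 + c - 1 = n + c by omega]
  obtain ⟨k, rfl⟩ : ∃ n, c = n + 1 := ⟨c - 1, by omega⟩
  have h2 := Nat.factorial_succ k
  rw [h2] at h
  have := hfac (2 * (k + 1))
  have := hfac n
  have := hfac m
  have := hfac k
  have := hfac (n + m + (k + 1))
  have := hfac (2 * (k + 1) + n + m + 1)
  have := hfac (n + 1 + (m + 1) - 1)
  rw [show k + 1 - 1 = k by omega]
  push_cast at h ⊢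
  field_simp at h ⊢
  linarith

/-! ### The alternating sum of three even moments does not vanish -/

/-- Quantitative decay: the factor (w - x - 1)/(w + x) is exactly the ratio of the values at x + 1
and x, and later steps only decrease the value. -/
theorem inv_factorial_mul_antitone {w x y : ℕ} (hxy : x < y) (hy : y < w) :
    (1 / ((w + y - 1).factorial * (w - y - 1).factorial) : ℚ)
      ≤ 1 / ((w + x - 1).factorial * (w - x - 1).factorial) * ((w - x - 1) / (w + x)) := by
  induction y, hxy using Nat.le_induction with
  | base =>
    apply le_of_eq
    obtain ⟨d, rfl⟩ : ∃ d, w = x + 1 + d + 1 := ⟨w - x - 2, by omega⟩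
    rw [show x + 1 + d + 1 + (x + 1) - 1 = (2 * x + d + 1) + 1 by omega,
      show x + 1 + d + 1 - (x + 1) - 1 = d by omega,
      show x + 1 + d + 1 + x - 1 = 2 * x + d + 1 by omega,
      show x + 1 + d + 1 - x - 1 = d + 1 by omega,
      Nat.factorial_succ (2 * x + d + 1), Nat.factorial_succ d]
    have : (d.factorial : ℚ) ≠ 0 := by positivity
    have : ((2 * x + d + 1).factorial : ℚ) ≠ 0 := by positivity
    push_cast
    have : ((d : ℚ) + 1) ≠ 0 := by positivity
    field_simp
    ring
  | succ y hxy ih =>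
    refine le_trans ?_ (ih (by omega))
    obtain ⟨d, rfl⟩ : ∃ d, w = y + 1 + d + 1 := ⟨w - y - 2, by omega⟩
    rw [show y + 1 + d + 1 + (y + 1) - 1 = (2 * y + d + 1) + 1 by omega,
      show y + 1 + d + 1 - (y + 1) - 1 = d by omega,
      show y + 1 + d + 1 + y - 1 = 2 * y + d + 1 by omega,
      show y + 1 + d + 1 - y - 1 = d + 1 by omega,
      Nat.factorial_succ (2 * y + d + 1), Nat.factorial_succ d]
    apply one_div_le_one_div_of_le (by positivity)
    push_cast
    have : (0 : ℚ) < d.factorial := by positivity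
    have : (0 : ℚ) < (2 * y + d + 1).factorial := by positivity
    nlinarith [mul_pos ‹(0 : ℚ) < d.factorial› this, (by positivity : (0 : ℚ) ≤ (y : ℚ) * ((2 * y + d + 1).factorial * d.factorial))]

/-- After division by the common factor κ the terms are ±φ(x)/x at x = a, b, c, and the smallest
argument dominates. If a = b, the first two terms coincide, sign included, and their double exceeds
the third. If a < b, the first term is larger than the other two together. -/
theorem momentCoeff_even_alternating_ne_zero_of_le {a b c : ℕ} (ha : 1 ≤ a) (hab : a ≤ b)
    (hbc : b ≤ c) :
    ((-1) ^ a * momentCoeff b c (2 * a) + (-1) ^ b * momentCoeff a c (2 * b)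
      + (-1) ^ c * momentCoeff a b (2 * c) : ℤ) ≠ 0 := by
  set w := a + b + c with hw
  set κ : ℚ := (2 * w - 3).factorial * (a + b - 1).factorial * (b + c - 1).factorial
          * (a + c - 1).factorial
        / ((w - 2).factorial * (a - 1).factorial * (b - 1).factorial * (c - 1).factorial) with hκ
  have hκ0 : 0 < κ := by positivity
  set φ : ℕ → ℚ := fun x => 1 / ((w + x - 1).factorial * (w - x - 1).factorial) with hφ
  have hφ0 : ∀ x, 0 < φ x := fun x => by positivity
  have hM : ∀ x, κ * (1 / ((w + x - 1).factorial * (w - x - 1).factorial * x)) = κ * (φ x / x) := by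
    intro x; simp only [hφ]; ring
  have hc : (momentCoeff a b (2 * c) : ℚ) = κ * (φ c / c) := by
    rw [momentCoeff_even ha (by omega) (by omega), ← hM]
  have hb : (momentCoeff a c (2 * b) : ℚ) = κ * (φ b / b) := by
    rw [momentCoeff_even ha (by omega) (by omega), ← hM, show a + c + b = w by omega,
      show c + b = b + c by ring, hκ]
    ring
  have ha' : (momentCoeff b c (2 * a) : ℚ) = κ * (φ a / a) := by
    rw [momentCoeff_even (by omega) (by omega) (by omega), ← hM, show b + c + a = w by omega,
      show c + a = a + c by ring, show b + a = a + b by ring, hκ]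
    ring
  have a0 : (0 : ℚ) < a := by exact_mod_cast ha
  have b0 : (0 : ℚ) < b := by exact_mod_cast (by omega : 0 < b)
  have c0 : (0 : ℚ) < c := by exact_mod_cast (by omega : 0 < c)
  intro h
  have h : ((-1) ^ a * (κ * (φ a / a)) + (-1) ^ b * (κ * (φ b / b)) + (-1) ^ c * (κ * (φ c / c)) : ℚ) = 0 := by
    rw [← ha', ← hb, ← hc]; exact_mod_cast h
  have h : ((-1) ^ a * (φ a / a) + (-1) ^ b * (φ b / b) + (-1) ^ c * (φ c / c) : ℚ) = 0 := by
    apply mul_left_cancel₀ hκ0.ne'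
    linear_combination h
  have sgn : ∀ n : ℕ, ((-1 : ℚ) ^ n = 1) ∨ ((-1 : ℚ) ^ n = -1) := fun n => neg_one_pow_eq_or ℚ n
  have pa : 0 < φ a / a := div_pos (hφ0 _) a0
  have pb : 0 < φ b / b := div_pos (hφ0 _) b0
  have pc : 0 < φ c / c := div_pos (hφ0 _) c0
  rcases hab.eq_or_lt with rfl | hab
  · have hle : φ c / c ≤ φ a / a := by
      rcases hbc.eq_or_lt with rfl | hbc
      · rfl
      · have h1 : φ c ≤ φ a := by
          refine (inv_factorial_mul_antitone hbc (by omega)).trans ?_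
          refine mul_le_of_le_one_right (hφ0 _).le ?_
          rw [div_le_one (by positivity)]
          linarith
        apply div_le_div₀ (hφ0 _).le h1 a0 (by exact_mod_cast hbc.le)
    rcases sgn a with e | e <;> rcases sgn c with e' | e' <;> rw [e, e'] at h <;> linarith
  · have hlt : φ b / b + φ c / c < φ a / a := by
      have h1 := inv_factorial_mul_antitone (w := w) hab (by omega)
      have h2 := inv_factorial_mul_antitone (w := w) (x := a) (y := c) (by omega) (by omega)
      change φ b ≤ φ a * _ at h1
      change φ c ≤ φ a * _ at h2
      have wc : (w : ℚ) = a + b + c := by simp [hw]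
      have hbc' : (b : ℚ) ≤ c := by exact_mod_cast hbc
      have hab' : (a : ℚ) + 1 ≤ b := by exact_mod_cast hab
      have key : (((w : ℚ) - a - 1) / (w + a)) / b + (((w : ℚ) - a - 1) / (w + a)) / c < 1 / a := by
        -- Writing b = a + 1 + u and c = a + 1 + u + v with u, v ≥ 0 makes the cross-multiplied
        -- difference a polynomial whose positivity is visible monomial by monomial.
        obtain ⟨u, hu⟩ : ∃ u : ℚ, u = b - a - 1 := ⟨_, rfl⟩
        obtain ⟨v, hv⟩ : ∃ v : ℚ, v = c - b := ⟨_, rfl⟩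
        have hb' : (b : ℚ) = a + 1 + u := by linarith
        have hc' : (c : ℚ) = a + 1 + u + v := by linarith
        have u0 : 0 ≤ u := by linarith
        have v0 : 0 ≤ v := by linarith
        rw [wc, div_div, div_div, div_add_div _ _ (by positivity) (by positivity),
          div_lt_div_iff₀ (by positivity) a0, hb', hc', ← sub_pos]
        ring_nf
        positivity
      calc φ b / b + φ c / c ≤ φ a * (((w : ℚ) - a - 1) / (w + a)) / b
            + φ a * (((w : ℚ) - a - 1) / (w + a)) / c := by gcongr
        _ = φ a * ((((w : ℚ) - a - 1) / (w + a)) / b + (((w : ℚ) - a - 1) / (w + a)) / c) := by ring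
        _ < φ a * (1 / a) := by gcongr
        _ = φ a / a := by ring
    rcases sgn a with e | e <;> rcases sgn b with e'' | e'' <;> rcases sgn c with e' | e' <;>
      rw [e, e', e''] at h <;> linarith

theorem momentCoeff_even_alternating_ne_zero {a b c : ℕ} (ha : 1 ≤ a) (hb : 1 ≤ b) (hc : 1 ≤ c) :
    ((-1) ^ a * momentCoeff b c (2 * a) + (-1) ^ b * momentCoeff a c (2 * b)
      + (-1) ^ c * momentCoeff a b (2 * c) : ℤ) ≠ 0 := by
  rcases le_total a b with h1 | h1 <;> rcases le_total b c with h2 | h2 <;>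
    rcases le_total a c with h3 | h3
  · exact momentCoeff_even_alternating_ne_zero_of_le ha h1 h2
  · exact momentCoeff_even_alternating_ne_zero_of_le ha h1 h2
  · have := momentCoeff_even_alternating_ne_zero_of_le ha h3 h2
    rw [momentCoeff_comm c b] at this
    convert this using 1; ring
  · have := momentCoeff_even_alternating_ne_zero_of_le hc h3 h1
    rw [momentCoeff_comm c b, momentCoeff_comm c a] at this
    convert this using 1; ring
  · have := momentCoeff_even_alternating_ne_zero_of_le hb h1 h3
    rw [momentCoeff_comm b a] at this
    convert this using 1; ring
  · have := momentCoeff_even_alternating_ne_zero_of_le hb h2 h3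
    rw [momentCoeff_comm b a, momentCoeff_comm c a] at this
    convert this using 1; ring
  · have := momentCoeff_even_alternating_ne_zero_of_le hc h2 h1
    rw [momentCoeff_comm c b, momentCoeff_comm c a, momentCoeff_comm b a] at this
    convert this using 1; ring
  · have := momentCoeff_even_alternating_ne_zero_of_le hc h2 h1
    rw [momentCoeff_comm c b, momentCoeff_comm c a, momentCoeff_comm b a] at this
    convert this using 1; ring

/-! ### Laplace integrals and the Fourier transform of the Bessel kernel -/

theorem integrableOn_pow_mul_exp {r : ℝ} (hr : 0 < r) (n : ℕ) :
    IntegrableOn (fun t : ℝ => t ^ n * Real.exp (-(r * t))) (Set.Ioi 0) := by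
  have := integrableOn_rpow_mul_exp_neg_mul_rpow (s := n) (p := 1) (b := r)
    (by linarith [(Nat.cast_nonneg n : (0 : ℝ) ≤ n)]) one_pos hr
  refine this.congr_fun (fun t _ => ?_) measurableSet_Ioi
  simp

theorem integrableOn_pow_mul_cexp {r : ℂ} (hr : 0 < r.re) (n : ℕ) :
    IntegrableOn (fun t : ℝ => (t : ℂ) ^ n * Complex.exp (-(r * t))) (Set.Ioi 0) := by
  refine (integrableOn_pow_mul_exp hr n).mono' (by fun_prop) ?_
  refine (ae_restrict_mem measurableSet_Ioi).mono fun t ht => ?_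
  have ht : 0 < t := ht
  rw [norm_mul, norm_pow, Complex.norm_real, Real.norm_of_nonneg ht.le, Complex.norm_exp]
  simp

theorem integral_pow_mul_cexp {r : ℂ} (hr : 0 < r.re) (n : ℕ) :
    ∫ t in Set.Ioi (0 : ℝ), (t : ℂ) ^ n * Complex.exp (-(r * t)) = n.factorial / r ^ (n + 1) := by
  have r0 : r ≠ 0 := fun h => by simp [h] at hr
  induction n with
  | zero =>
    have := integral_exp_mul_complex_Ioi (a := -r) (by simpa using hr) 0
    simp only [pow_zero, one_mul, zero_add, pow_one, Nat.factorial_zero, Nat.cast_one]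
    simp only [neg_mul] at this
    rw [this]; simp
  | succ n ih =>
    have hd : ∀ t : ℝ, HasDerivAt (fun t : ℝ => (t : ℂ) ^ (n + 1) * Complex.exp (-(r * t)))
        ((n + 1) * ((t : ℂ) ^ n * Complex.exp (-(r * t)))
          - r * ((t : ℂ) ^ (n + 1) * Complex.exp (-(r * t)))) t := by
      intro t
      have h1 : HasDerivAt (fun z : ℂ => z ^ (n + 1) * Complex.exp (-(r * z))) _ (t : ℂ) :=
        ((hasDerivAt_id (t : ℂ)).pow (n + 1)).mul (((hasDerivAt_id (t : ℂ)).const_mul r).neg.cexp)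
      convert h1.comp_ofReal using 1
      simp; ring
    have hint := ((integrableOn_pow_mul_cexp hr n).const_mul ((n : ℂ) + 1)).sub
      ((integrableOn_pow_mul_cexp hr (n + 1)).const_mul r)
    have hlim : Tendsto (fun t : ℝ => (t : ℂ) ^ (n + 1) * Complex.exp (-(r * t))) atTop (𝓝 0) := by
      rw [tendsto_zero_iff_norm_tendsto_zero]
      have := tendsto_rpow_mul_exp_neg_mul_atTop_nhds_zero (n + 1 : ℕ) r.re hr
      refine this.congr' ?_
      filter_upwards [eventually_ge_atTop 0] with t ht
      rw [norm_mul, norm_pow, Complex.norm_real, Real.norm_of_nonneg ht, Complex.norm_exp,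
        Real.rpow_natCast]
      simp
    have h := integral_Ioi_of_hasDerivAt_of_tendsto (a := 0) (hd 0).continuousAt.continuousWithinAt
      (fun t _ => hd t) hint hlim
    have h' : ∫ t in Set.Ioi (0 : ℝ), ((n + 1) * ((t : ℂ) ^ n * Complex.exp (-(r * t)))
          - r * ((t : ℂ) ^ (n + 1) * Complex.exp (-(r * t)))) = _ :=
      integral_sub ((integrableOn_pow_mul_cexp hr n).const_mul ((n : ℂ) + 1))
        ((integrableOn_pow_mul_cexp hr (n + 1)).const_mul r)
    rw [h', integral_const_mul, integral_const_mul, ih] at h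
    simp only [Complex.ofReal_zero, ne_eq, Nat.add_eq_zero_iff, one_ne_zero, and_false,
      not_false_eq_true, zero_pow, zero_mul, sub_zero] at h
    rw [eq_div_iff (pow_ne_zero _ r0), Nat.factorial_succ]
    push_cast
    have h2 : r * ∫ t in Set.Ioi (0 : ℝ), (t : ℂ) ^ (n + 1) * Complex.exp (-(r * t))
        = (n + 1) * (n.factorial / r ^ (n + 1)) := by linear_combination -h
    rw [pow_succ r (n + 1)]
    calc _ = (r * ∫ t in Set.Ioi (0 : ℝ), (t : ℂ) ^ (n + 1) * Complex.exp (-(r * t))) * r ^ (n + 1) := by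
          ring
      _ = _ := by rw [h2]; field_simp

theorem integral_pow_mul_exp {r : ℝ} (hr : 0 < r) (n : ℕ) :
    ∫ t in Set.Ioi (0 : ℝ), t ^ n * Real.exp (-(r * t)) = n.factorial / r ^ (n + 1) := by
  have := integral_pow_mul_cexp (r := (r : ℂ)) (by simpa using hr) n
  have h2 : ∫ t in Set.Ioi (0 : ℝ), (t : ℂ) ^ n * Complex.exp (-(r * t))
      = ((∫ t in Set.Ioi (0 : ℝ), t ^ n * Real.exp (-(r * t)) : ℝ) : ℂ) := by
    rw [← integral_complex_ofReal]
    congr 1 with t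
    push_cast; ring
  rw [h2] at this
  exact_mod_cast this

/-- The function `(ξ² + c²)⁻ᵃ`. -/
noncomputable def lorentz (a : ℕ) (c ξ : ℝ) : ℝ := ((ξ ^ 2 + c ^ 2)⁻¹) ^ a

/-- The Fourier transform of `ξ ↦ (ξ² + c²)⁻ᵃ`. -/
noncomputable def besselKernel (a : ℕ) (c t : ℝ) : ℝ :=
  ∑ i ∈ range a, ((2 * a - 2 - i).choose (a - 1) : ℝ) * ((2 * c)⁻¹) ^ (2 * a - 1 - i)
    * (2 * Real.pi) ^ (i + 1) / i.factorial * (|t| ^ i * Real.exp (-(2 * Real.pi * c * |t|)))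

theorem besselKernel_neg (a : ℕ) (c t : ℝ) : besselKernel a c (-t) = besselKernel a c t := by
  simp [besselKernel]

theorem continuous_besselKernel (a : ℕ) (c : ℝ) : Continuous (besselKernel a c) := by
  unfold besselKernel; fun_prop

theorem besselKernel_nonneg (a : ℕ) {c : ℝ} (hc : 0 ≤ c) (t : ℝ) : 0 ≤ besselKernel a c t := by
  unfold besselKernel
  exact sum_nonneg fun i _ => by positivity

theorem integral_eq_integral_Ioi_add {f : ℝ → ℂ} (h1 : IntegrableOn f (Set.Ioi 0))
    (h2 : IntegrableOn (fun t => f (-t)) (Set.Ioi 0)) :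
    Integrable f ∧ ∫ t, f t = (∫ t in Set.Ioi 0, f t) + ∫ t in Set.Ioi 0, f (-t) := by
  have h3 : IntegrableOn f (Set.Iic 0) := by
    have := (integrableOn_Ici_iff_integrableOn_Ioi (by simp)).2 h2
    refine ((Measure.measurePreserving_neg (volume : Measure ℝ)).integrableOn_comp_preimage
      (MeasurableEquiv.neg ℝ).measurableEmbedding (f := f) (s := Set.Iic 0)).1 ?_
    rwa [show Neg.neg ⁻¹' Set.Iic (0 : ℝ) = Set.Ici 0 by ext; simp]
  refine ⟨?_, ?_⟩
  · rw [← integrableOn_univ, ← Set.Iic_union_Ioi (a := (0 : ℝ))]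
    exact h3.union h1
  · rw [integral_comp_neg_Ioi, neg_zero, add_comm, intervalIntegral.integral_Iic_add_Ioi h3 h1]

theorem besselKernel_term_fourier {c : ℝ} (hc : 0 < c) (i : ℕ) (ξ : ℝ) :
    Integrable (fun t : ℝ => Complex.exp (((-2 * Real.pi * t * ξ : ℝ) : ℂ) * Complex.I)
        * ((|t| ^ i * Real.exp (-(2 * Real.pi * c * |t|)) : ℝ) : ℂ)) ∧
    ∫ t : ℝ, Complex.exp (((-2 * Real.pi * t * ξ : ℝ) : ℂ) * Complex.I)
        * ((|t| ^ i * Real.exp (-(2 * Real.pi * c * |t|)) : ℝ) : ℂ)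
      = i.factorial / (2 * Real.pi) ^ (i + 1)
        * (((c + ξ * Complex.I)⁻¹) ^ (i + 1) + ((c - ξ * Complex.I)⁻¹) ^ (i + 1)) := by
  have hp := Real.pi_pos
  have e1 : ∀ t ∈ Set.Ioi (0 : ℝ), (t : ℂ) ^ i * Complex.exp (-(2 * Real.pi * (c + ξ * Complex.I) * t))
      = Complex.exp (((-2 * Real.pi * t * ξ : ℝ) : ℂ) * Complex.I)
        * ((|t| ^ i * Real.exp (-(2 * Real.pi * c * |t|)) : ℝ) : ℂ) := by
    intro t ht
    rw [abs_of_pos ht]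
    push_cast
    rw [mul_left_comm, ← Complex.exp_add]
    congr 2; ring
  have e2 : ∀ t ∈ Set.Ioi (0 : ℝ), (t : ℂ) ^ i * Complex.exp (-(2 * Real.pi * (c - ξ * Complex.I) * t))
      = Complex.exp (((-2 * Real.pi * (-t) * ξ : ℝ) : ℂ) * Complex.I)
        * ((|-t| ^ i * Real.exp (-(2 * Real.pi * c * |-t|)) : ℝ) : ℂ) := by
    intro t ht
    rw [abs_neg, abs_of_pos ht]
    push_cast
    rw [mul_left_comm, ← Complex.exp_add]
    congr 2; ring
  have r1 : 0 < (2 * (Real.pi : ℂ) * (c + ξ * Complex.I)).re := by simp; positivity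
  have r2 : 0 < (2 * (Real.pi : ℂ) * (c - ξ * Complex.I)).re := by simp; positivity
  have i1 := (integrableOn_pow_mul_cexp r1 i).congr_fun e1 measurableSet_Ioi
  have i2 := (integrableOn_pow_mul_cexp r2 i).congr_fun e2 measurableSet_Ioi
  obtain ⟨hi, he⟩ := integral_eq_integral_Ioi_add (f := fun t : ℝ =>
    Complex.exp (((-2 * Real.pi * t * ξ : ℝ) : ℂ) * Complex.I)
        * ((|t| ^ i * Real.exp (-(2 * Real.pi * c * |t|)) : ℝ) : ℂ)) i1 i2
  refine ⟨hi, ?_⟩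
  rw [he, ← setIntegral_congr_fun measurableSet_Ioi e1, ← setIntegral_congr_fun measurableSet_Ioi e2,
    integral_pow_mul_cexp r1, integral_pow_mul_cexp r2, mul_pow, mul_pow (2 * (Real.pi : ℂ)), inv_pow, inv_pow]
  field_simp

/-- The half-lines t > 0 and t < 0 contribute powers of z⁻¹ and z'⁻¹ for z = c + iξ, z' = c - iξ.
Since z + z' = 2c, the coefficients of the kernel are precisely those in the partial fraction
expansion of z⁻ᵃ z'⁻ᵃ with v = (2c)⁻¹. -/
theorem besselKernel_fourier {a : ℕ} (ha : 1 ≤ a) {c : ℝ} (hc : 0 < c) (ξ : ℝ) :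
    Integrable (fun t : ℝ => Complex.exp (((-2 * Real.pi * t * ξ : ℝ) : ℂ) * Complex.I)
        * (besselKernel a c t : ℂ)) ∧
    ∫ t : ℝ, Complex.exp (((-2 * Real.pi * t * ξ : ℝ) : ℂ) * Complex.I) * (besselKernel a c t : ℂ)
      = lorentz a c ξ := by
  have key : ∀ t : ℝ, Complex.exp (((-2 * Real.pi * t * ξ : ℝ) : ℂ) * Complex.I)
        * (besselKernel a c t : ℂ)
      = ∑ i ∈ range a, ((((2 * a - 2 - i).choose (a - 1) : ℝ) * ((2 * c)⁻¹) ^ (2 * a - 1 - i)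
          * (2 * Real.pi) ^ (i + 1) / i.factorial : ℝ) : ℂ)
        * (Complex.exp (((-2 * Real.pi * t * ξ : ℝ) : ℂ) * Complex.I)
        * ((|t| ^ i * Real.exp (-(2 * Real.pi * c * |t|)) : ℝ) : ℂ)) := by
    intro t
    rw [besselKernel, Complex.ofReal_sum, mul_sum]
    refine sum_congr rfl fun i _ => ?_
    push_cast; ring
  simp only [key]
  have hI : ∀ i ∈ range a, Integrable (fun t : ℝ => ((((2 * a - 2 - i).choose (a - 1) : ℝ) * ((2 * c)⁻¹) ^ (2 * a - 1 - i)
          * (2 * Real.pi) ^ (i + 1) / i.factorial : ℝ) : ℂ)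
        * (Complex.exp (((-2 * Real.pi * t * ξ : ℝ) : ℂ) * Complex.I)
        * ((|t| ^ i * Real.exp (-(2 * Real.pi * c * |t|)) : ℝ) : ℂ))) := fun i _ =>
    (besselKernel_term_fourier hc i ξ).1.const_mul _
  refine ⟨integrable_finsetSum _ hI, ?_⟩
  rw [integral_finsetSum _ hI]
  simp only [integral_const_mul, (besselKernel_term_fourier hc _ ξ).2]
  obtain ⟨n, rfl⟩ : ∃ n, a = n + 1 := ⟨a - 1, by omega⟩
  set z : ℂ := c + ξ * Complex.I with hz
  set z' : ℂ := c - ξ * Complex.I with hz'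
  have z0 : z ≠ 0 := fun h => by have := congrArg Complex.re h; simp [hz] at this; linarith
  have z0' : z' ≠ 0 := fun h => by have := congrArg Complex.re h; simp [hz'] at this; linarith
  have c0 : (c : ℂ) ≠ 0 := by exact_mod_cast hc.ne'
  have pf := pow_mul_pow_eq_partialFractions (u := z⁻¹) (w := z'⁻¹) (v := (2 * c : ℂ)⁻¹) (by
    field_simp; simp [hz, hz']; ring) n n
  have hl : ((lorentz (n + 1) c ξ : ℝ) : ℂ) = z⁻¹ ^ (n + 1) * z'⁻¹ ^ (n + 1) := by
    unfold lorentz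
    push_cast
    rw [← mul_pow, ← mul_inv]
    congr 2
    simp only [hz, hz']
    linear_combination (ξ : ℂ) ^ 2 * Complex.I_sq
  rw [hl, pf, ← sum_add_distrib]
  refine sum_congr rfl fun i _ => ?_
  rw [show 2 * (n + 1) - 2 - i = n + n - i by omega, show 2 * (n + 1) - 1 - i = n + n + 1 - i by omega,
    Nat.add_sub_cancel]
  have : (Real.pi : ℂ) ≠ 0 := by exact_mod_cast Real.pi_pos.ne'
  have : (i.factorial : ℂ) ≠ 0 := by exact_mod_cast i.factorial_ne_zero
  push_cast
  field_simp

/-- Half of the exponential absorbs the powers of |t|. The bound is uniform in c ≥ 1, and the factor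
1/c, available because every power of (2c)⁻¹ is at least the first, later makes the errors summable
over the rows. -/
theorem besselKernel_le {a : ℕ} (ha : 1 ≤ a) : ∃ B : ℝ, 0 < B ∧ ∀ c : ℝ, 1 ≤ c → ∀ t : ℝ,
    besselKernel a c t ≤ B / c * Real.exp (-(Real.pi * c * |t|)) := by
  refine ⟨∑ i ∈ range a, ((2 * a - 2 - i).choose (a - 1) : ℝ) * (2 * Real.pi) ^ (i + 1) + 1,
    by positivity, fun c hc t => ?_⟩
  have hp := Real.pi_pos
  have hp3 := Real.pi_gt_three
  have c0 : 0 < c := by linarith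
  have : besselKernel a c t ≤ ∑ i ∈ range a, ((2 * a - 2 - i).choose (a - 1) : ℝ) * (2 * Real.pi) ^ (i + 1)
      * (1 / c * Real.exp (-(Real.pi * c * |t|))) := by
    refine sum_le_sum fun i hi => ?_
    have hi : i < a := by simpa using hi
    have h1 : |t| ^ i / i.factorial ≤ Real.exp (Real.pi * c * |t|) := by
      refine le_trans ?_ (Real.pow_div_factorial_le_exp _ (by positivity) i)
      gcongr
      nlinarith [abs_nonneg t, mul_nonneg (mul_nonneg hp.le (sub_nonneg.2 hc)) (abs_nonneg t)]
    have h2 : ((2 * c)⁻¹) ^ (2 * a - 1 - i) ≤ 1 / c := by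
      have : (2 * c)⁻¹ ≤ 1 := inv_le_one_of_one_le₀ (by linarith)
      calc ((2 * c)⁻¹) ^ (2 * a - 1 - i) ≤ ((2 * c)⁻¹) ^ 1 :=
            pow_le_pow_of_le_one (by positivity) this (by omega)
        _ ≤ 1 / c := by rw [pow_one, one_div]; gcongr; linarith
    have h3 : Real.exp (-(2 * Real.pi * c * |t|))
        = Real.exp (-(Real.pi * c * |t|)) * Real.exp (-(Real.pi * c * |t|)) := by
      rw [← Real.exp_add]; ring_nf
    have h4 : |t| ^ i / i.factorial * Real.exp (-(2 * Real.pi * c * |t|)) ≤ Real.exp (-(Real.pi * c * |t|)) := by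
      rw [h3, ← mul_assoc]
      refine mul_le_of_le_one_left (by positivity) ?_
      rw [Real.exp_neg, ← div_eq_mul_inv]
      exact div_le_one_of_le₀ h1 (by positivity)
    calc _ = ((2 * a - 2 - i).choose (a - 1) : ℝ) * (2 * Real.pi) ^ (i + 1)
          * (((2 * c)⁻¹) ^ (2 * a - 1 - i) * (|t| ^ i / i.factorial * Real.exp (-(2 * Real.pi * c * |t|)))) := by
          ring
      _ ≤ _ := by gcongr
  refine this.trans ?_
  rw [← sum_mul]
  have : 0 ≤ 1 / c * Real.exp (-(Real.pi * c * |t|)) := by positivity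
  rw [add_div, add_mul]
  refine le_of_eq_of_le ?_ (le_add_of_nonneg_right this)
  simp only [div_eq_mul_inv, mul_assoc, one_mul]

theorem lorentz_nonneg (a : ℕ) (c ξ : ℝ) : 0 ≤ lorentz a c ξ := by
  unfold lorentz; positivity

theorem summable_lorentz {a : ℕ} (ha : 1 ≤ a) (c u : ℝ) :
    Summable fun m : ℤ => lorentz a c (m + u) := by
  refine summable_of_isBigO (Real.summable_abs_int_rpow (b := 2) (by norm_num))
    (Asymptotics.IsBigO.of_bound (4 ^ a) ?_)
  have h := (Int.tendsto_coe_cofinite.eventually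
    ((tendsto_norm_cocompact_atTop (E := ℝ)).eventually_ge_atTop (2 * |u| + 1)))
  filter_upwards [h] with m hm
  rw [Real.norm_eq_abs] at hm
  rw [Real.norm_of_nonneg (lorentz_nonneg _ _ _), Real.norm_of_nonneg (by positivity),
    Real.rpow_neg (abs_nonneg _), show ((2 : ℝ)) = ((2 : ℕ) : ℝ) by norm_num, Real.rpow_natCast]
  have hu := abs_nonneg u
  have hm1 : 1 ≤ |(m : ℝ)| := by linarith
  have h1 : |(m : ℝ)| / 2 ≤ |m + u| := by
    have := abs_sub_abs_le_abs_sub (m : ℝ) (-u)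
    rw [abs_neg, sub_neg_eq_add] at this
    linarith
  have h2 : |(m : ℝ)| ^ 2 / 4 ≤ (m + u) ^ 2 + c ^ 2 := by
    rw [← sq_abs ((m : ℝ) + u)]
    nlinarith [sq_nonneg c]
  have h3 : ((m + u) ^ 2 + c ^ 2)⁻¹ ≤ 4 * (|(m : ℝ)| ^ 2)⁻¹ := by
    calc ((m + u) ^ 2 + c ^ 2)⁻¹ ≤ (|(m : ℝ)| ^ 2 / 4)⁻¹ := by gcongr
      _ = _ := by rw [inv_div]; ring
  calc lorentz a c (m + u) ≤ (4 * (|(m : ℝ)| ^ 2)⁻¹) ^ a := by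
        unfold lorentz; gcongr
    _ = 4 ^ a * ((|(m : ℝ)| ^ 2)⁻¹) ^ a := mul_pow _ _ _
    _ ≤ 4 ^ a * ((|(m : ℝ)| ^ 2)⁻¹) ^ 1 := by
        exact mul_le_mul_of_nonneg_left (pow_le_pow_of_le_one (by positivity)
          (inv_le_one_of_one_le₀ (one_le_pow₀ hm1)) ha) (by positivity)
    _ = _ := by rw [pow_one]

/-! ### Poisson summation -/

/-- The trigonometric series with coefficients `A`. -/
noncomputable def trigSeries (A : ℤ → ℂ) (s : ℝ) : ℂ :=
  ∑' m : ℤ, A m * Complex.exp (2 * Real.pi * Complex.I * m * s)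

theorem norm_exp_two_pi (m : ℤ) (s : ℝ) :
    ‖Complex.exp (2 * Real.pi * Complex.I * m * s)‖ = 1 := by
  rw [show 2 * (Real.pi : ℂ) * Complex.I * m * s = ((2 * Real.pi * m * s : ℝ) : ℂ) * Complex.I by
    push_cast; ring, Complex.norm_exp_ofReal_mul_I]

/-- Poisson summation for the kernel times exp(-2πitu): the modulation shifts its Fourier transform
from ξ to ξ + u. -/
theorem trigSeries_lorentz {a : ℕ} (ha : 1 ≤ a) {c : ℝ} (hc : 1 ≤ c) (u s : ℝ) :
    trigSeries (fun m => (lorentz a c (m + u) : ℂ)) s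
      = ∑' k : ℤ, (besselKernel a c (s + k) : ℂ)
          * Complex.exp (((-2 * Real.pi * (s + k) * u : ℝ) : ℂ) * Complex.I) := by
  have c0 : 0 < c := by linarith
  obtain ⟨B, hB, hle⟩ := besselKernel_le ha
  set f : ℝ → ℂ := fun t => (besselKernel a c t : ℂ)
      * Complex.exp (((-2 * Real.pi * t * u : ℝ) : ℂ) * Complex.I) with hf
  have hcont : Continuous f := by
    have := continuous_besselKernel a c
    simp only [hf]
    fun_prop
  have hF : ∀ ξ, FourierTransform.fourier f ξ = (lorentz a c (ξ + u) : ℂ) := by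
    intro ξ
    rw [Real.fourier_real_eq_integral_exp_smul, ← (besselKernel_fourier ha c0 (ξ + u)).2]
    congr 1 with t
    simp only [hf, smul_eq_mul]
    rw [mul_left_comm, ← Complex.exp_add, mul_comm]
    congr 2
    push_cast; ring
  have hdecay : f =O[cocompact ℝ] fun x => |x| ^ (-(2 : ℝ)) := by
    refine Asymptotics.IsBigO.of_bound (2 * B) ?_
    filter_upwards [(isCompact_singleton (x := (0 : ℝ))).compl_mem_cocompact] with t ht
    have ht : 0 < |t| := abs_pos.2 ht
    rw [Real.norm_of_nonneg (by positivity), Real.rpow_neg ht.le,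
      show ((2 : ℝ)) = ((2 : ℕ) : ℝ) by norm_num, Real.rpow_natCast]
    simp only [hf, norm_mul, Complex.norm_exp_ofReal_mul_I, mul_one, Complex.norm_real]
    rw [Real.norm_of_nonneg (besselKernel_nonneg a c0.le t)]
    refine (hle c hc t).trans ?_
    have hp := Real.pi_gt_three
    have h1 : |t| ^ 2 / 2 ≤ Real.exp (Real.pi * c * |t|) := by
      refine le_trans ?_ (Real.pow_div_factorial_le_exp _ (by positivity) 2)
      rw [show ((Nat.factorial 2 : ℕ) : ℝ) = 2 by norm_num]
      gcongr
      nlinarith [mul_nonneg (by linarith : (0 : ℝ) ≤ Real.pi) (sub_nonneg.2 hc)]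
    have h2 : Real.exp (-(Real.pi * c * |t|)) ≤ 2 * (|t| ^ 2)⁻¹ := by
      rw [Real.exp_neg]
      calc (Real.exp (Real.pi * c * |t|))⁻¹ ≤ (|t| ^ 2 / 2)⁻¹ := by gcongr
        _ = _ := by rw [inv_div]; ring
    calc B / c * Real.exp (-(Real.pi * c * |t|)) ≤ B * (2 * (|t| ^ 2)⁻¹) := by
          gcongr
          exact div_le_self hB.le hc
      _ = _ := by push_cast; ring
  have hsum : Summable fun n : ℤ => FourierTransform.fourier f (n : ℝ) := by
    simp only [hF]
    exact Complex.hasSum_ofReal.2 (summable_lorentz ha c u).hasSum |>.summable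
  have := Real.tsum_eq_tsum_fourier_of_rpow_decay_of_summable hcont one_lt_two hdecay hsum s
  unfold trigSeries
  refine Eq.trans ?_ this.symm
  simp only [hF, fourier_coe_apply]
  congr 1 with m
  congr 1
  push_cast
  simp

/-! ### Exponentially small errors from distant and unequal translates -/

/-- A summable majorant of `k ↦ exp (-(π / 2) |s + k|)`, uniform in `0 ≤ s ≤ 1`. -/
noncomputable def expMajorant (k : ℤ) : ℝ := Real.exp (Real.pi / 2) * Real.exp (-(Real.pi / 2)) ^ k.natAbs

theorem expMajorant_nonneg (k : ℤ) : 0 ≤ expMajorant k := by unfold expMajorant; positivity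

theorem summable_expMajorant : Summable expMajorant := by
  have h : Summable fun n : ℕ => Real.exp (Real.pi / 2) * Real.exp (-(Real.pi / 2)) ^ n :=
    (summable_geometric_of_lt_one (Real.exp_pos _).le
      (by rw [Real.exp_lt_one_iff]; linarith [Real.pi_pos])).mul_left _
  exact Summable.of_nat_of_neg (by simpa [expMajorant] using h) (by simpa [expMajorant] using h)

theorem exp_le_expMajorant {s : ℝ} (hs : s ∈ Set.Icc (0 : ℝ) 1) (k : ℤ) :
    Real.exp (-(Real.pi / 2 * |s + k|)) ≤ expMajorant k := by
  unfold expMajorant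
  rw [← Real.exp_nat_mul, ← Real.exp_add]
  apply Real.exp_le_exp.2
  have h : ((k.natAbs : ℕ) : ℝ) = |(k : ℝ)| := by rw [Nat.cast_natAbs]; simp
  have h1 : |(k : ℝ)| ≤ |s + k| + 1 := by
    have := abs_sub (s + k) s
    rw [add_sub_cancel_left, abs_of_nonneg hs.1] at this
    linarith [hs.2]
  rw [h]
  nlinarith [Real.pi_pos]

/-- `∑ k, expMajorant k`. -/
noncomputable def expMajorantSum : ℝ := ∑' k, expMajorant k

theorem expMajorantSum_nonneg : 0 ≤ expMajorantSum := tsum_nonneg expMajorant_nonneg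

section Decay

variable {s c : ℝ} {φ ψ : ℤ → ℂ} {A A' : ℝ}

theorem exp_le_expMajorant_of_one_le (hs : s ∈ Set.Icc (0 : ℝ) 1) (hc : 1 ≤ c) (k : ℤ) :
    Real.exp (-(Real.pi * c * |s + k|)) ≤ expMajorant k := by
  refine le_trans (Real.exp_le_exp.2 ?_) (exp_le_expMajorant hs k)
  have := Real.pi_pos
  have h : 0 ≤ |s + k| := abs_nonneg _
  nlinarith [mul_nonneg this.le (mul_nonneg h (sub_nonneg.2 hc)), mul_nonneg this.le h]

theorem summable_norm_of_decay (hs : s ∈ Set.Icc (0 : ℝ) 1) (hc : 1 ≤ c) (hA : 0 ≤ A)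
    (hφ : ∀ k, ‖φ k‖ ≤ A * Real.exp (-(Real.pi * c * |s + k|))) : Summable fun k => ‖φ k‖ :=
  (summable_expMajorant.mul_left A).of_nonneg_of_le (fun _ => norm_nonneg _) fun k =>
    (hφ k).trans (mul_le_mul_of_nonneg_left (exp_le_expMajorant_of_one_le hs hc k) hA)

theorem norm_tsum_le_of_decay (hs : s ∈ Set.Icc (0 : ℝ) 1) (hc : 1 ≤ c) (hA : 0 ≤ A)
    (hφ : ∀ k, ‖φ k‖ ≤ A * Real.exp (-(Real.pi * c * |s + k|))) :
    ‖∑' k, φ k‖ ≤ A * expMajorantSum :=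
  tsum_of_norm_bounded ((summable_expMajorant.hasSum).mul_left A) fun k =>
    (hφ k).trans (mul_le_mul_of_nonneg_left (exp_le_expMajorant_of_one_le hs hc k) hA)

theorem norm_mul_le_of_decay (hc : 1 ≤ c) (hA : 0 ≤ A) (hA' : 0 ≤ A')
    (hφ : ∀ k, ‖φ k‖ ≤ A * Real.exp (-(Real.pi * c * |s + k|)))
    (hψ : ∀ k, ‖ψ k‖ ≤ A' * Real.exp (-(Real.pi * c * |s + k|))) (k : ℤ) :
    ‖φ k * ψ k‖ ≤ A * A' * Real.exp (-(Real.pi * c * |s + k|)) := by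
  have h0 : 0 ≤ Real.pi * c * |s + k| := by have := Real.pi_pos; positivity
  rw [norm_mul]
  calc ‖φ k‖ * ‖ψ k‖ ≤ (A * Real.exp (-(Real.pi * c * |s + k|))) * (A' * 1) := by
        gcongr
        · exact hφ k
        · exact (hψ k).trans (mul_le_mul_of_nonneg_left (Real.exp_le_one_iff.2 (by linarith)) hA')
    _ = _ := by ring

/-- For 0 ≤ s ≤ 1 every k other than 0 and -1 has |s + k| ≥ 1. Then πc|s + k| ≥ (π/2)c + (π/2)|s +
k|: one half is the gain, the other keeps the sum convergent. -/
theorem norm_tsum_sub_le_of_decay (hs : s ∈ Set.Icc (0 : ℝ) 1) (hc : 1 ≤ c) (hA : 0 ≤ A)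
    (hφ : ∀ k, ‖φ k‖ ≤ A * Real.exp (-(Real.pi * c * |s + k|))) :
    ‖∑' k, φ k - (φ 0 + φ (-1))‖ ≤ A * expMajorantSum * Real.exp (-(Real.pi / 2 * c)) := by
  have hsum := (summable_norm_of_decay hs hc hA hφ).of_norm
  have h := hsum.sum_add_tsum_compl (s := ({0, -1} : Finset ℤ))
  rw [sum_pair (by norm_num)] at h
  rw [← h, add_sub_cancel_left, tsum_subtype (↑({0, -1} : Finset ℤ))ᶜ φ]
  have hh : HasSum (fun k => A * Real.exp (-(Real.pi / 2 * c)) * expMajorant k)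
      (A * Real.exp (-(Real.pi / 2 * c)) * expMajorantSum) :=
    summable_expMajorant.hasSum.mul_left _
  refine (tsum_of_norm_bounded hh fun k => ?_).trans (le_of_eq (by ring))
  by_cases hk : k ∈ ((↑({0, -1} : Finset ℤ))ᶜ : Set ℤ)
  · rw [Set.indicator_of_mem hk]
    have hk' : k ≤ -2 ∨ 1 ≤ k := by
      simp at hk; omega
    have h1 : 1 ≤ |s + k| := by
      rcases hk' with h | h
      · have : (k : ℝ) ≤ -2 := by exact_mod_cast h
        rw [abs_of_nonpos (by linarith [hs.2])]; linarith [hs.2]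
      · have : (1 : ℝ) ≤ k := by exact_mod_cast h
        rw [abs_of_nonneg (by linarith [hs.1])]; linarith [hs.1]
    refine (hφ k).trans ?_
    rw [mul_assoc A]
    refine mul_le_mul_of_nonneg_left ?_ hA
    refine le_trans ?_ (mul_le_mul_of_nonneg_left (exp_le_expMajorant hs k) (Real.exp_pos _).le)
    rw [← Real.exp_add]
    apply Real.exp_le_exp.2
    have := Real.pi_pos
    nlinarith [mul_nonneg this.le (mul_nonneg (sub_nonneg.2 hc) (abs_nonneg (s + k))),
      mul_nonneg this.le (mul_nonneg (by linarith : (0 : ℝ) ≤ c) (sub_nonneg.2 h1))]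
  · rw [Set.indicator_of_notMem hk, norm_zero]
    have := expMajorant_nonneg k
    positivity

/-- Off the diagonal |s + k| + |s + l| ≥ |k - l| ≥ 1, so half of the total exponent is again a gain
of exp(-(π/2)c). -/
theorem norm_tsum_mul_tsum_sub_le_of_decay (hs : s ∈ Set.Icc (0 : ℝ) 1) (hc : 1 ≤ c) (hA : 0 ≤ A)
    (hA' : 0 ≤ A') (hφ : ∀ k, ‖φ k‖ ≤ A * Real.exp (-(Real.pi * c * |s + k|)))
    (hψ : ∀ k, ‖ψ k‖ ≤ A' * Real.exp (-(Real.pi * c * |s + k|))) :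
    ‖(∑' k, φ k) * (∑' k, ψ k) - ∑' k, φ k * ψ k‖
      ≤ A * A' * expMajorantSum ^ 2 * Real.exp (-(Real.pi / 2 * c)) := by
  have s1 := summable_norm_of_decay hs hc hA hφ
  have s2 := summable_norm_of_decay hs hc hA' hψ
  have hprod : Summable fun p : ℤ × ℤ => φ p.1 * ψ p.2 := summable_mul_of_summable_norm s1 s2
  have hdiag : ∑' k, φ k * ψ k = ∑' p : ℤ × ℤ, if p.1 = p.2 then φ p.1 * ψ p.2 else 0 := by
    have hinj : Function.Injective fun k : ℤ => (k, k) := fun a b h => (Prod.ext_iff.1 h).1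
    rw [← hinj.tsum_eq (f := fun p : ℤ × ℤ => if p.1 = p.2 then φ p.1 * ψ p.2 else 0)]
    · simp
    · intro p hp
      by_contra h
      apply hp
      have : p.1 ≠ p.2 := fun e => h ⟨p.1, Prod.ext rfl e⟩
      simp [this]
  have hsd : Summable fun p : ℤ × ℤ => if p.1 = p.2 then φ p.1 * ψ p.2 else 0 := by
    refine hprod.norm.of_norm_bounded fun p => ?_
    split_ifs
    · exact le_rfl
    · rw [norm_zero]; exact norm_nonneg _
  rw [tsum_mul_tsum_of_summable_norm s1 s2, hdiag, ← hprod.tsum_sub hsd]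
  have hh : HasSum (fun p : ℤ × ℤ => A * A' * Real.exp (-(Real.pi / 2 * c))
      * (expMajorant p.1 * expMajorant p.2))
      (A * A' * Real.exp (-(Real.pi / 2 * c)) * (expMajorantSum * expMajorantSum)) := by
    refine HasSum.mul_left _ ?_
    have hn : Summable fun k => ‖expMajorant k‖ := summable_expMajorant.norm
    unfold expMajorantSum
    rw [tsum_mul_tsum_of_summable_norm hn hn]
    exact (summable_mul_of_summable_norm hn hn).hasSum
  refine (tsum_of_norm_bounded hh fun p => ?_).trans (le_of_eq (by ring))
  have e1 := expMajorant_nonneg p.1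
  have e2 := expMajorant_nonneg p.2
  split_ifs with h
  · rw [sub_self, norm_zero]; positivity
  · rw [sub_zero, norm_mul]
    have h1 : 1 ≤ |s + p.1| + |s + p.2| := by
      have h2 : (1 : ℝ) ≤ |(p.1 : ℝ) - p.2| := by
        have := Int.one_le_abs (sub_ne_zero.2 h)
        exact_mod_cast this
      have h3 := abs_sub (s + p.1) (s + p.2)
      rw [add_sub_add_left_eq_sub] at h3
      linarith
    calc ‖φ p.1‖ * ‖ψ p.2‖ ≤ (A * Real.exp (-(Real.pi * c * |s + p.1|)))
          * (A' * Real.exp (-(Real.pi * c * |s + p.2|))) :=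
          mul_le_mul (hφ _) (hψ _) (norm_nonneg _) (by positivity)
      _ = A * A' * Real.exp (-(Real.pi * c * |s + p.1|) + -(Real.pi * c * |s + p.2|)) := by
          rw [Real.exp_add]; ring
      _ ≤ A * A' * Real.exp (-(Real.pi / 2 * c) + (-(Real.pi / 2 * |s + p.1|) + -(Real.pi / 2 * |s + p.2|))) := by
          refine mul_le_mul_of_nonneg_left (Real.exp_le_exp.2 ?_) (by positivity)
          have := Real.pi_pos
          nlinarith [mul_nonneg this.le (mul_nonneg (sub_nonneg.2 hc) (add_nonneg (abs_nonneg (s + p.1)) (abs_nonneg (s + p.2)))),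
            mul_nonneg this.le (mul_nonneg (by linarith : (0 : ℝ) ≤ c) (sub_nonneg.2 h1))]
      _ = A * A' * Real.exp (-(Real.pi / 2 * c)) * (Real.exp (-(Real.pi / 2 * |s + p.1|))
          * Real.exp (-(Real.pi / 2 * |s + p.2|))) := by
          rw [Real.exp_add, Real.exp_add]; ring
      _ ≤ _ := by
          gcongr
          · exact exp_le_expMajorant hs _
          · exact exp_le_expMajorant hs _

end Decay

/-- Expanding the product, only frequencies with m₁ + m₂ + m₃ = 0 survive integration over a period.
This is what encodes momentum conservation. -/
theorem integral_trigSeries_mul {A B C : ℤ → ℂ} (hA : Summable fun m => ‖A m‖)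
    (hB : Summable fun m => ‖B m‖) (hC : Summable fun m => ‖C m‖) :
    ∫ s in (0 : ℝ)..1, trigSeries A s * trigSeries B s * trigSeries C s
      = ∑' p : ℤ × ℤ, A p.1 * B p.2 * C (-p.1 - p.2) := by
  have hAB : Summable fun p : ℤ × ℤ => ‖A p.1 * B p.2‖ := by
    simpa only [norm_mul] using hA.mul_of_nonneg hB (fun _ => norm_nonneg _) (fun _ => norm_nonneg _)
  have hABC : Summable fun p : (ℤ × ℤ) × ℤ => ‖A p.1.1 * B p.1.2 * C p.2‖ := by
    simpa only [norm_mul] using hAB.mul_of_nonneg hC (fun _ => norm_nonneg _) (fun _ => norm_nonneg _)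
  have hn : ∀ (D : ℤ → ℂ), (Summable fun m => ‖D m‖) → ∀ s : ℝ,
      Summable fun m : ℤ => ‖D m * Complex.exp (2 * Real.pi * Complex.I * m * s)‖ := by
    intro D hD s
    simpa only [norm_mul, norm_exp_two_pi, mul_one] using hD
  have h1 : ∀ s : ℝ, trigSeries A s * trigSeries B s * trigSeries C s
      = ∑' p : (ℤ × ℤ) × ℤ, A p.1.1 * B p.1.2 * C p.2
          * Complex.exp (2 * Real.pi * Complex.I * (p.1.1 + p.1.2 + p.2 : ℤ) * s) := by
    intro s
    unfold trigSeries
    rw [tsum_mul_tsum_of_summable_norm (hn A hA s) (hn B hB s),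
      tsum_mul_tsum_of_summable_norm _ (hn C hC s)]
    · congr 1 with p
      have : Complex.exp (2 * Real.pi * Complex.I * (p.1.1 + p.1.2 + p.2 : ℤ) * s)
          = Complex.exp (2 * Real.pi * Complex.I * p.1.1 * s)
            * Complex.exp (2 * Real.pi * Complex.I * p.1.2 * s)
            * Complex.exp (2 * Real.pi * Complex.I * p.2 * s) := by
        rw [← Complex.exp_add, ← Complex.exp_add]
        congr 1; push_cast; ring
      rw [this]; ring
    · refine hAB.congr fun p => ?_
      simp only [norm_mul, norm_exp_two_pi, mul_one]
  simp only [h1]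
  rw [intervalIntegral.integral_of_le zero_le_one]
  have hI : ∀ m : ℤ, ∫ s in Set.Ioc (0 : ℝ) 1, Complex.exp (2 * Real.pi * Complex.I * m * s)
      = if m = 0 then 1 else 0 := by
    intro m
    rw [← intervalIntegral.integral_of_le zero_le_one]
    split_ifs with h
    · simp [h]
    · have hne : 2 * (Real.pi : ℂ) * Complex.I * m ≠ 0 := by
        have : (Real.pi : ℂ) ≠ 0 := by exact_mod_cast Real.pi_ne_zero
        have : (m : ℂ) ≠ 0 := by exact_mod_cast h
        simp [*]
      rw [integral_exp_mul_complex hne]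
      have : Complex.exp (2 * Real.pi * Complex.I * m * (1 : ℝ)) = 1 := by
        rw [Complex.exp_eq_one_iff]; exact ⟨m, by push_cast; ring⟩
      rw [this]; simp
  have hs := hasSum_integral_of_summable_integral_norm
    (μ := (volume : Measure ℝ).restrict (Set.Ioc 0 1))
    (F := fun (p : (ℤ × ℤ) × ℤ) (s : ℝ) => A p.1.1 * B p.1.2 * C p.2
          * Complex.exp (2 * Real.pi * Complex.I * (p.1.1 + p.1.2 + p.2 : ℤ) * s))
    (fun p => by
      have : Continuous fun s : ℝ => A p.1.1 * B p.1.2 * C p.2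
          * Complex.exp (2 * Real.pi * Complex.I * (p.1.1 + p.1.2 + p.2 : ℤ) * s) := by fun_prop
      exact (this.integrableOn_Icc (a := 0) (b := 1)).mono_set Set.Ioc_subset_Icc_self)
    (by
      refine hABC.congr fun p => ?_
      simp only [norm_mul _ (Complex.exp _), norm_exp_two_pi, mul_one]
      simp)
  rw [← hs.tsum_eq]
  simp only [integral_const_mul, hI]
  have hinj : Function.Injective fun p : ℤ × ℤ => (p, -p.1 - p.2) := fun a b h => (Prod.ext_iff.1 h).1
  rw [← hinj.tsum_eq]
  · congr 1 with p
    simp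
  · intro p hp
    by_contra h
    apply hp
    have : ¬ (p.1.1 + p.1.2 + p.2 = 0) := fun e => h ⟨p.1, Prod.ext rfl (by simp; omega)⟩
    simp [this]

theorem continuous_trigSeries {A : ℤ → ℂ} (hA : Summable fun m => ‖A m‖) :
    Continuous (trigSeries A) := by
  refine continuous_tsum (fun m => by fun_prop) hA fun m s => ?_
  rw [norm_mul, norm_exp_two_pi, mul_one]

theorem summable_norm_lorentz {a : ℕ} (ha : 1 ≤ a) (c u : ℝ) :
    Summable fun m : ℤ => ‖(lorentz a c (m + u) : ℂ)‖ := by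
  simpa only [Complex.norm_real] using (summable_lorentz ha c u).norm

/-! ### Rows compared with half-line integrals -/

/-- The terms of the Poisson-transformed series. -/
noncomputable def kernelTerm (a : ℕ) (c u s : ℝ) (k : ℤ) : ℂ :=
  (besselKernel a c (s + k) : ℂ) * Complex.exp (((-2 * Real.pi * (s + k) * u : ℝ) : ℂ) * Complex.I)

/-- The rate c is relaxed to a common rate y so that factors with different parameters can be
multiplied; the prefactor B / c keeps the true parameter. -/
theorem norm_kernelTerm_le {a : ℕ} {B : ℝ} (hB : 0 < B) (hle : ∀ c : ℝ, 1 ≤ c → ∀ t : ℝ,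
    besselKernel a c t ≤ B / c * Real.exp (-(Real.pi * c * |t|))) {y c : ℝ} (hy : 1 ≤ y)
    (hyc : y ≤ c) (u s : ℝ) (k : ℤ) :
    ‖kernelTerm a c u s k‖ ≤ B / c * Real.exp (-(Real.pi * y * |s + k|)) := by
  have c0 : 0 < c := by linarith
  unfold kernelTerm
  rw [norm_mul, Complex.norm_exp_ofReal_mul_I, mul_one, Complex.norm_real,
    Real.norm_of_nonneg (besselKernel_nonneg a c0.le _)]
  refine (hle c (hy.trans hyc) _).trans ?_
  have := Real.pi_pos
  gcongr

/-- The half-line integral approximates the integral of the two dominant translates. -/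
theorem norm_integral_sub_two_mul_le {P G : ℝ → ℝ} {Θ : ℝ → ℂ} {M A E c : ℝ} (hP : Continuous P)
    (hPs : ∀ s, P (1 - s) = P s) (hPM : ∀ t, 0 ≤ t → |P t| ≤ M * Real.exp t)
    (hG : Continuous G) (hGe : ∀ t, G (-t) = G t) (hM : 0 ≤ M) (hA : 0 ≤ A) (hc : 1 ≤ c)
    (hGA : ∀ t, |G t| ≤ A * Real.exp (-(Real.pi * c * |t|)))
    (hΘ : Continuous Θ)
    (h : ∀ s ∈ Set.Icc (0 : ℝ) 1, ‖Θ s - ((P s * (G s + G (s - 1)) : ℝ) : ℂ)‖ ≤ E) :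
    IntegrableOn (fun t => P t * G t) (Set.Ioi 0) ∧
    ‖(∫ s in (0 : ℝ)..1, Θ s) - ((2 * ∫ t in Set.Ioi 0, P t * G t : ℝ) : ℂ)‖
      ≤ E + 2 * (M * A * Real.exp (-(Real.pi / 2 * c))
          * ∫ t in Set.Ioi (1 : ℝ), Real.exp (-(Real.pi / 2 - 1) * t)) := by
  have hp := Real.pi_gt_three
  have hbound : ∀ t, 0 ≤ t → ‖P t * G t‖ ≤ M * A * (Real.exp (-(Real.pi * c * t) + t)) := by
    intro t ht
    rw [norm_mul, Real.exp_add]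
    calc |P t| * |G t| ≤ (M * Real.exp t) * (A * Real.exp (-(Real.pi * c * |t|))) := by
          gcongr
          · exact hPM t ht
          · exact hGA t
      _ = _ := by rw [abs_of_nonneg ht]; ring
  have hint : IntegrableOn (fun t => P t * G t) (Set.Ioi 0) := by
    have h1 : IntegrableOn (fun t => M * A * Real.exp (-t)) (Set.Ioi 0) := by
      have := (exp_neg_integrableOn_Ioi 0 one_pos).const_mul (M * A)
      simpa [IntegrableOn] using this
    refine h1.mono' (hP.mul hG).aestronglyMeasurable ?_
    refine (ae_restrict_mem measurableSet_Ioi).mono fun t ht => ?_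
    have ht : 0 < t := ht
    refine (hbound t ht.le).trans (mul_le_mul_of_nonneg_left (Real.exp_le_exp.2 ?_) (by positivity))
    nlinarith [mul_nonneg (by linarith : 0 ≤ Real.pi) (mul_nonneg ht.le (sub_nonneg.2 hc)),
      mul_nonneg ht.le (by linarith : 0 ≤ Real.pi - 3)]
  refine ⟨hint, ?_⟩
  have hsplit := intervalIntegral.integral_interval_add_Ioi hint
    (hint.mono_set (Set.Ioi_subset_Ioi zero_le_one))
  -- The reflection s ↦ 1 - s fixes P and carries the translate G(s - 1) to G(s), since G is even;
  -- both translates contribute the same integral.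
  have hmain : ∫ s in (0 : ℝ)..1, P s * (G s + G (s - 1)) = 2 * ∫ s in (0 : ℝ)..1, P s * G s := by
    have h1 : ∫ s in (0 : ℝ)..1, P s * G (s - 1) = ∫ s in (0 : ℝ)..1, P s * G s := by
      have := intervalIntegral.integral_comp_sub_left (fun s => P s * G s) (1 : ℝ) (a := 0) (b := 1)
      simp only [sub_self, sub_zero] at this
      rw [← this]
      congr 1 with s
      rw [hPs, ← hGe, neg_sub]
    simp only [mul_add]
    have c1 : Continuous fun s => P s * G s := by fun_prop
    have c2 : Continuous fun s => P s * G (s - 1) := by fun_prop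
    rw [intervalIntegral.integral_add (c1.intervalIntegrable _ _) (c2.intervalIntegrable _ _), h1]
    ring
  have hcont : Continuous fun s => ((P s * (G s + G (s - 1)) : ℝ) : ℂ) :=
    Complex.continuous_ofReal.comp (hP.mul (hG.add (hG.comp (continuous_id.sub continuous_const))))
  have h1 : ‖(∫ s in (0 : ℝ)..1, Θ s) - ((2 * ∫ s in (0 : ℝ)..1, P s * G s : ℝ) : ℂ)‖ ≤ E := by
    rw [← hmain, ← intervalIntegral.integral_ofReal, ← intervalIntegral.integral_sub
      (hΘ.intervalIntegrable _ _) (hcont.intervalIntegrable _ _)]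
    have := intervalIntegral.norm_integral_le_of_norm_le_const (a := (0 : ℝ)) (b := 1) (C := E)
      (f := fun s => Θ s - ((P s * (G s + G (s - 1)) : ℝ) : ℂ)) (fun s hs => by
        rw [Set.uIoc_of_le zero_le_one] at hs
        exact h s ⟨hs.1.le, hs.2⟩)
    simpa using this
  have h2 : |∫ t in Set.Ioi (1 : ℝ), P t * G t| ≤ M * A * Real.exp (-(Real.pi / 2 * c))
          * ∫ t in Set.Ioi (1 : ℝ), Real.exp (-(Real.pi / 2 - 1) * t) := by
    rw [← integral_const_mul, ← Real.norm_eq_abs]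
    refine norm_integral_le_of_norm_le
      ((exp_neg_integrableOn_Ioi 1 (by linarith : 0 < Real.pi / 2 - 1)).const_mul _) ?_
    refine (ae_restrict_mem measurableSet_Ioi).mono fun t ht => ?_
    have ht : 1 < t := ht
    refine (hbound t (by linarith)).trans ?_
    rw [mul_assoc _ (Real.exp _) (Real.exp _), ← Real.exp_add]
    refine mul_le_mul_of_nonneg_left (Real.exp_le_exp.2 ?_) (by positivity)
    nlinarith [mul_nonneg (by linarith : 0 ≤ Real.pi) (mul_nonneg (by linarith : 0 ≤ t) (sub_nonneg.2 hc)),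
      mul_nonneg (by linarith : 0 ≤ Real.pi) (mul_nonneg (by linarith : 0 ≤ c) (sub_nonneg.2 ht.le))]
  have e : (∫ s in (0 : ℝ)..1, Θ s) - ((2 * ∫ t in Set.Ioi 0, P t * G t : ℝ) : ℂ)
      = ((∫ s in (0 : ℝ)..1, Θ s) - ((2 * ∫ s in (0 : ℝ)..1, P s * G s : ℝ) : ℂ))
        - ((2 * ∫ t in Set.Ioi (1 : ℝ), P t * G t : ℝ) : ℂ) := by
    rw [← hsplit]; push_cast; ring
  rw [e]
  refine (norm_sub_le _ _).trans (add_le_add h1 ?_)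
  rw [Complex.norm_real, norm_mul]
  simpa using h2

/-- At equal translates the three phases multiply to 1, because the shifts u₁, u₂, -u₁ - u₂ add up
to zero. Hence x leaves no trace in the main term. -/
theorem kernelTerm_mul (a b c : ℕ) (c₁ c₂ c₃ u₁ u₂ s : ℝ) (k : ℤ) :
    kernelTerm a c₁ u₁ s k * (kernelTerm b c₂ u₂ s k * kernelTerm c c₃ (-u₁ - u₂) s k)
      = ((besselKernel a c₁ (s + k) * besselKernel b c₂ (s + k) * besselKernel c c₃ (s + k) : ℝ) : ℂ) := by
  unfold kernelTerm
  have h : Complex.exp (((-2 * Real.pi * (s + k) * u₁ : ℝ) : ℂ) * Complex.I)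
      * Complex.exp (((-2 * Real.pi * (s + k) * u₂ : ℝ) : ℂ) * Complex.I)
      * Complex.exp (((-2 * Real.pi * (s + k) * (-u₁ - u₂) : ℝ) : ℂ) * Complex.I) = 1 := by
    rw [← Complex.exp_add, ← Complex.exp_add, Complex.exp_eq_one_iff]
    exact ⟨0, by push_cast; ring⟩
  push_cast at h ⊢
  linear_combination (besselKernel a c₁ (s + k) * besselKernel b c₂ (s + k)
    * besselKernel c c₃ (s + k) : ℂ) * h

theorem kernelTerm_mul_neg (b c : ℕ) (c₂ c₃ u s : ℝ) (k : ℤ) :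
    kernelTerm b c₂ u s k * kernelTerm c c₃ (-u) s k
      = ((besselKernel b c₂ (s + k) * besselKernel c c₃ (s + k) : ℝ) : ℂ) := by
  unfold kernelTerm
  have h : Complex.exp (((-2 * Real.pi * (s + k) * u : ℝ) : ℂ) * Complex.I)
      * Complex.exp (((-2 * Real.pi * (s + k) * (-u) : ℝ) : ℂ) * Complex.I) = 1 := by
    rw [← Complex.exp_add, Complex.exp_eq_one_iff]
    exact ⟨0, by push_cast; ring⟩
  push_cast at h ⊢
  linear_combination (besselKernel b c₂ (s + k) * besselKernel c c₃ (s + k) : ℂ) * h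

/-- No momentum coefficient vanishes here, so all three series become sums of decaying translates.
The factor 1/(c₁c₂c₃) is retained for the later summation over all such rows. -/
theorem exists_norm_integral_triple_sub_le {a b c : ℕ} (ha : 1 ≤ a) (hb : 1 ≤ b) (hc : 1 ≤ c) :
    ∃ K : ℝ, 0 ≤ K ∧ ∀ y c₁ c₂ c₃ : ℝ, 1 ≤ y → y ≤ c₁ → y ≤ c₂ → y ≤ c₃ → ∀ u₁ u₂ : ℝ,
      ‖(∫ s in (0 : ℝ)..1, trigSeries (fun m => (lorentz a c₁ (m + u₁) : ℂ)) s
          * trigSeries (fun m => (lorentz b c₂ (m + u₂) : ℂ)) s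
          * trigSeries (fun m => (lorentz c c₃ (m + (-u₁ - u₂)) : ℂ)) s)
        - ((2 * ∫ t in Set.Ioi 0, besselKernel a c₁ t * besselKernel b c₂ t * besselKernel c c₃ t : ℝ) : ℂ)‖
      ≤ K / (c₁ * c₂ * c₃) * Real.exp (-(Real.pi / 2 * y)) := by
  obtain ⟨B₁, hB₁, h₁⟩ := besselKernel_le ha
  obtain ⟨B₂, hB₂, h₂⟩ := besselKernel_le hb
  obtain ⟨B₃, hB₃, h₃⟩ := besselKernel_le hc
  set S := expMajorantSum with hS
  have S0 : 0 ≤ S := expMajorantSum_nonneg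
  set I := ∫ t in Set.Ioi (1 : ℝ), Real.exp (-(Real.pi / 2 - 1) * t) with hI
  have I0 : 0 ≤ I := setIntegral_nonneg measurableSet_Ioi fun t _ => (Real.exp_pos _).le
  refine ⟨B₁ * B₂ * B₃ * (S * S ^ 2 + S ^ 2 + S + 2 * I), by positivity, ?_⟩
  intro y c₁ c₂ c₃ hy hy₁ hy₂ hy₃ u₁ u₂
  have p₁ : 0 < c₁ := by linarith
  have p₂ : 0 < c₂ := by linarith
  have p₃ : 0 < c₃ := by linarith
  have hA₁ : 0 ≤ B₁ / c₁ := by positivity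
  have hA₂ : 0 ≤ B₂ / c₂ := by positivity
  have hA₃ : 0 ≤ B₃ / c₃ := by positivity
  have hcont : Continuous fun s => trigSeries (fun m => (lorentz a c₁ (m + u₁) : ℂ)) s
          * trigSeries (fun m => (lorentz b c₂ (m + u₂) : ℂ)) s
          * trigSeries (fun m => (lorentz c c₃ (m + (-u₁ - u₂)) : ℂ)) s :=
    ((continuous_trigSeries (summable_norm_lorentz ha _ _)).mul
      (continuous_trigSeries (summable_norm_lorentz hb _ _))).mul
      (continuous_trigSeries (summable_norm_lorentz hc _ _))
  have hGA : ∀ t, |besselKernel a c₁ t * besselKernel b c₂ t * besselKernel c c₃ t|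
      ≤ B₁ / c₁ * (B₂ / c₂ * (B₃ / c₃)) * Real.exp (-(Real.pi * y * |t|)) := by
    intro t
    have k₁ := norm_kernelTerm_le hB₁ h₁ hy hy₁ u₁ t
    have k₂ := norm_kernelTerm_le hB₂ h₂ hy hy₂ u₂ t
    have k₃ := norm_kernelTerm_le hB₃ h₃ hy hy₃ (-u₁ - u₂) t
    have := norm_mul_le_of_decay hy hA₁ (mul_nonneg hA₂ hA₃) k₁
      (norm_mul_le_of_decay hy hA₂ hA₃ k₂ k₃) 0
    rw [kernelTerm_mul, Complex.norm_real] at this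
    simpa using this
  have := (norm_integral_sub_two_mul_le (P := fun _ => 1)
    (G := fun t => besselKernel a c₁ t * besselKernel b c₂ t * besselKernel c c₃ t)
    (Θ := fun s => trigSeries (fun m => (lorentz a c₁ (m + u₁) : ℂ)) s
          * trigSeries (fun m => (lorentz b c₂ (m + u₂) : ℂ)) s
          * trigSeries (fun m => (lorentz c c₃ (m + (-u₁ - u₂)) : ℂ)) s)
    (M := 1) (c := y)
    (E := B₁ / c₁ * (B₂ / c₂ * (B₃ / c₃)) * (S * S ^ 2 + S ^ 2 + S) * Real.exp (-(Real.pi / 2 * y)))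
    continuous_const (fun _ => rfl) (fun t ht => by simpa using ht)
    (((continuous_besselKernel a c₁).mul (continuous_besselKernel b c₂)).mul
      (continuous_besselKernel c c₃)) (fun t => by simp only [besselKernel_neg]) zero_le_one
    (mul_nonneg hA₁ (mul_nonneg hA₂ hA₃)) hy hGA hcont ?_).2
  · simp only [one_mul] at this
    refine this.trans (le_of_eq ?_)
    rw [← hI]
    field_simp
  · intro s hs
    have k₁ := norm_kernelTerm_le hB₁ h₁ hy hy₁ u₁ s
    have k₂ := norm_kernelTerm_le hB₂ h₂ hy hy₂ u₂ s
    have k₃ := norm_kernelTerm_le hB₃ h₃ hy hy₃ (-u₁ - u₂) s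
    have k₂₃ := norm_mul_le_of_decay hy hA₂ hA₃ k₂ k₃
    have k₁₂₃ := norm_mul_le_of_decay hy hA₁ (mul_nonneg hA₂ hA₃) k₁ k₂₃
    have e₁ := norm_tsum_le_of_decay hs hy hA₁ k₁
    have e₂ := norm_tsum_mul_tsum_sub_le_of_decay hs hy hA₂ hA₃ k₂ k₃
    have e₃ := norm_tsum_mul_tsum_sub_le_of_decay hs hy hA₁ (mul_nonneg hA₂ hA₃) k₁ k₂₃
    have e₄ := norm_tsum_sub_le_of_decay hs hy (mul_nonneg hA₁ (mul_nonneg hA₂ hA₃)) k₁₂₃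
    rw [trigSeries_lorentz ha (hy.trans hy₁), trigSeries_lorentz hb (hy.trans hy₂),
      trigSeries_lorentz hc (hy.trans hy₃)]
    change ‖(∑' k, kernelTerm a c₁ u₁ s k) * (∑' k, kernelTerm b c₂ u₂ s k)
      * (∑' k, kernelTerm c c₃ (-u₁ - u₂) s k) - _‖ ≤ _
    have e5 : kernelTerm a c₁ u₁ s 0 * (kernelTerm b c₂ u₂ s 0 * kernelTerm c c₃ (-u₁ - u₂) s 0)
        + kernelTerm a c₁ u₁ s (-1) * (kernelTerm b c₂ u₂ s (-1) * kernelTerm c c₃ (-u₁ - u₂) s (-1))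
        = ((1 * (besselKernel a c₁ s * besselKernel b c₂ s * besselKernel c c₃ s
          + besselKernel a c₁ (s - 1) * besselKernel b c₂ (s - 1) * besselKernel c c₃ (s - 1)) : ℝ) : ℂ) := by
      rw [kernelTerm_mul, kernelTerm_mul]
      push_cast
      simp [sub_eq_add_neg]
    rw [← e5]
    set X₁ := ∑' k, kernelTerm a c₁ u₁ s k
    set X₂ := ∑' k, kernelTerm b c₂ u₂ s k
    set X₃ := ∑' k, kernelTerm c c₃ (-u₁ - u₂) s k
    set X₂₃ := ∑' k, kernelTerm b c₂ u₂ s k * kernelTerm c c₃ (-u₁ - u₂) s k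
    set X₁₂₃ := ∑' k, kernelTerm a c₁ u₁ s k * (kernelTerm b c₂ u₂ s k * kernelTerm c c₃ (-u₁ - u₂) s k)
    set D := kernelTerm a c₁ u₁ s 0 * (kernelTerm b c₂ u₂ s 0 * kernelTerm c c₃ (-u₁ - u₂) s 0)
        + kernelTerm a c₁ u₁ s (-1) * (kernelTerm b c₂ u₂ s (-1) * kernelTerm c c₃ (-u₁ - u₂) s (-1))
    -- Off-diagonal terms are discarded first between factors 2 and 3, then between factor 1 and
    -- their diagonal; last, diagonal terms other than k = 0, -1.
    have split : X₁ * X₂ * X₃ - D = X₁ * (X₂ * X₃ - X₂₃) + (X₁ * X₂₃ - X₁₂₃) + (X₁₂₃ - D) := by ring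
    rw [split]
    refine (norm_add₃_le).trans ?_
    rw [norm_mul]
    have e6 : ‖X₁‖ * ‖X₂ * X₃ - X₂₃‖ ≤ (B₁ / c₁ * S)
        * (B₂ / c₂ * (B₃ / c₃) * S ^ 2 * Real.exp (-(Real.pi / 2 * y))) := by
      gcongr
    calc _ ≤ _ := add_le_add (add_le_add e6 e₃) e₄
      _ = _ := by ring

/-! ### Rows with one vanishing coefficient: Bernoulli polynomials and moments -/

/-- The Fourier series `∑_{m ≠ 0} m ^ (-2a) exp (2πims)` for `0 ≤ s ≤ 1`, as a polynomial. -/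
noncomputable def bernoulliWeight (a : ℕ) (s : ℝ) : ℝ :=
  (-1) ^ (a + 1) * (2 * Real.pi) ^ (2 * a) / (2 * a).factorial * bernoulliFun (2 * a) s

/-- At width c = 0 there is no decaying kernel and Poisson summation is replaced by the Fourier
series of a Bernoulli polynomial. The term m = 0 drops out by the convention 0⁻¹ = 0. -/
theorem trigSeries_lorentz_zero {a : ℕ} (ha : 1 ≤ a) {s : ℝ} (hs : s ∈ Set.Icc (0 : ℝ) 1) :
    trigSeries (fun m => (lorentz a 0 (m + 0) : ℂ)) s = (bernoulliWeight a s : ℂ) := by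
  have h := hasSum_one_div_pow_mul_fourier_mul_bernoulliFun (k := 2 * a) (by omega) hs
  unfold trigSeries bernoulliWeight
  have e : ∀ m : ℤ, (lorentz a 0 (m + 0) : ℂ) * Complex.exp (2 * Real.pi * Complex.I * m * s)
      = 1 / (m : ℂ) ^ (2 * a) * fourier m (s : UnitAddCircle) := by
    intro m
    rw [fourier_coe_apply]
    simp [lorentz, pow_mul]
  simp only [e]
  rw [h.tsum_eq]
  push_cast
  rw [mul_pow (2 * (Real.pi : ℂ)), pow_mul Complex.I, Complex.I_sq, pow_succ]
  ring

theorem bernoulliFun_eq_sum (k : ℕ) (t : ℝ) :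
    bernoulliFun k t = ∑ i ∈ range (k + 1), (bernoulli (k - i) : ℝ) * k.choose i * t ^ i := by
  unfold bernoulliFun
  rw [Polynomial.bernoulli_def]
  simp only [Polynomial.map_sum, Polynomial.map_monomial, Polynomial.eval_finsetSum,
    Polynomial.eval_monomial]
  refine sum_congr rfl fun i _ => ?_
  push_cast
  simp

theorem exists_abs_bernoulliWeight_le (a : ℕ) :
    ∃ M : ℝ, 0 ≤ M ∧ ∀ t, 0 ≤ t → |bernoulliWeight a t| ≤ M * Real.exp t := by
  refine ⟨|(-1) ^ (a + 1) * (2 * Real.pi) ^ (2 * a) / (2 * a).factorial|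
    * ∑ i ∈ range (2 * a + 1), |(bernoulli (2 * a - i) : ℝ) * (2 * a).choose i| * i.factorial,
    by positivity, fun t ht => ?_⟩
  unfold bernoulliWeight
  rw [abs_mul, mul_assoc]
  refine mul_le_mul_of_nonneg_left ?_ (abs_nonneg _)
  rw [bernoulliFun_eq_sum, sum_mul]
  refine (abs_sum_le_sum_abs _ _).trans (sum_le_sum fun i _ => ?_)
  rw [abs_mul, mul_assoc, abs_of_nonneg (pow_nonneg ht i)]
  refine mul_le_mul_of_nonneg_left ?_ (abs_nonneg _)
  have := Real.pow_div_factorial_le_exp t ht i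
  rwa [div_le_iff₀ (by positivity), mul_comm] at this

theorem exists_norm_integral_pair_sub_le {a b c : ℕ} (ha : 1 ≤ a) (hb : 1 ≤ b) (hc : 1 ≤ c) :
    ∃ K : ℝ, 0 ≤ K ∧ ∀ y : ℝ, 1 ≤ y → ∀ u : ℝ,
      ‖(∫ s in (0 : ℝ)..1, trigSeries (fun m => (lorentz a 0 (m + 0) : ℂ)) s
          * trigSeries (fun m => (lorentz b y (m + u) : ℂ)) s
          * trigSeries (fun m => (lorentz c y (m + -u) : ℂ)) s)
        - ((2 * ∫ t in Set.Ioi 0, bernoulliWeight a t * (besselKernel b y t * besselKernel c y t) : ℝ) : ℂ)‖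
      ≤ K * Real.exp (-(Real.pi / 2 * y)) := by
  obtain ⟨B₂, hB₂, h₂⟩ := besselKernel_le hb
  obtain ⟨B₃, hB₃, h₃⟩ := besselKernel_le hc
  obtain ⟨M, M0, hM⟩ := exists_abs_bernoulliWeight_le a
  set S := expMajorantSum with hS
  have S0 : 0 ≤ S := expMajorantSum_nonneg
  set I := ∫ t in Set.Ioi (1 : ℝ), Real.exp (-(Real.pi / 2 - 1) * t) with hI
  have I0 : 0 ≤ I := setIntegral_nonneg measurableSet_Ioi fun t _ => (Real.exp_pos _).le
  refine ⟨M * (B₂ * B₃) * (Real.exp 1 * (S ^ 2 + S) + 2 * I), by positivity, ?_⟩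
  intro y hy u
  have hA₂ : 0 ≤ B₂ := by positivity
  have hA₃ : 0 ≤ B₃ := by positivity
  have hdiv : ∀ {B : ℝ}, 0 < B → ∀ x, B / y * Real.exp x ≤ B * Real.exp x := by
    intro B hB x
    gcongr
    exact div_le_self hB.le hy
  have hk₂ : ∀ s k, ‖kernelTerm b y u s k‖ ≤ B₂ * Real.exp (-(Real.pi * y * |s + k|)) :=
    fun s k => (norm_kernelTerm_le hB₂ h₂ hy le_rfl u s k).trans (hdiv hB₂ _)
  have hk₃ : ∀ s k, ‖kernelTerm c y (-u) s k‖ ≤ B₃ * Real.exp (-(Real.pi * y * |s + k|)) :=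
    fun s k => (norm_kernelTerm_le hB₃ h₃ hy le_rfl (-u) s k).trans (hdiv hB₃ _)
  have hGA : ∀ t, |besselKernel b y t * besselKernel c y t|
      ≤ B₂ * B₃ * Real.exp (-(Real.pi * y * |t|)) := by
    intro t
    have := norm_mul_le_of_decay hy hA₂ hA₃ (hk₂ t) (hk₃ t) 0
    rw [kernelTerm_mul_neg, Complex.norm_real] at this
    simpa using this
  have hsym : ∀ s, bernoulliWeight a (1 - s) = bernoulliWeight a s := by
    intro s
    unfold bernoulliWeight
    rw [bernoulliFun_eval_one_sub]
    simp
  have hcont : Continuous fun s => trigSeries (fun m => (lorentz a 0 (m + 0) : ℂ)) s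
          * trigSeries (fun m => (lorentz b y (m + u) : ℂ)) s
          * trigSeries (fun m => (lorentz c y (m + -u) : ℂ)) s :=
    ((continuous_trigSeries (summable_norm_lorentz ha _ _)).mul
      (continuous_trigSeries (summable_norm_lorentz hb _ _))).mul
      (continuous_trigSeries (summable_norm_lorentz hc _ _))
  have := (norm_integral_sub_two_mul_le (P := bernoulliWeight a)
    (G := fun t => besselKernel b y t * besselKernel c y t)
    (Θ := fun s => trigSeries (fun m => (lorentz a 0 (m + 0) : ℂ)) s
          * trigSeries (fun m => (lorentz b y (m + u) : ℂ)) s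
          * trigSeries (fun m => (lorentz c y (m + -u) : ℂ)) s)
    (M := M) (c := y) (A := B₂ * B₃)
    (E := M * Real.exp 1 * (B₂ * B₃ * (S ^ 2 + S) * Real.exp (-(Real.pi / 2 * y))))
    (by unfold bernoulliWeight; exact continuous_const.mul (continuous_bernoulliFun _)) hsym hM
    ((continuous_besselKernel b y).mul (continuous_besselKernel c y))
    (fun t => by simp only [besselKernel_neg]) M0
    (mul_nonneg hA₂ hA₃) hy hGA hcont ?_).2
  · refine this.trans (le_of_eq ?_)
    rw [← hI]
    ring
  · intro s hs
    have k₂₃ := norm_mul_le_of_decay hy hA₂ hA₃ (hk₂ s) (hk₃ s)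
    have e₂ := norm_tsum_mul_tsum_sub_le_of_decay hs hy hA₂ hA₃ (hk₂ s) (hk₃ s)
    have e₄ := norm_tsum_sub_le_of_decay hs hy (mul_nonneg hA₂ hA₃) k₂₃
    rw [trigSeries_lorentz_zero ha hs, trigSeries_lorentz hb hy, trigSeries_lorentz hc hy]
    change ‖(bernoulliWeight a s : ℂ) * (∑' k, kernelTerm b y u s k)
      * (∑' k, kernelTerm c y (-u) s k) - _‖ ≤ _
    have e5 : (kernelTerm b y u s 0 * kernelTerm c y (-u) s 0)
        + kernelTerm b y u s (-1) * kernelTerm c y (-u) s (-1)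
        = ((besselKernel b y s * besselKernel c y s
          + besselKernel b y (s - 1) * besselKernel c y (s - 1) : ℝ) : ℂ) := by
      rw [kernelTerm_mul_neg, kernelTerm_mul_neg]
      push_cast
      simp [sub_eq_add_neg]
    rw [Complex.ofReal_mul, ← e5, mul_assoc, ← mul_sub, norm_mul, Complex.norm_real]
    have e6 : |bernoulliWeight a s| ≤ M * Real.exp 1 :=
      (hM s hs.1).trans (mul_le_mul_of_nonneg_left (Real.exp_le_exp.2 hs.2) M0)
    set X₂ := ∑' k, kernelTerm b y u s k
    set X₃ := ∑' k, kernelTerm c y (-u) s k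
    set X₂₃ := ∑' k, kernelTerm b y u s k * kernelTerm c y (-u) s k
    set D := (kernelTerm b y u s 0 * kernelTerm c y (-u) s 0)
        + kernelTerm b y u s (-1) * kernelTerm c y (-u) s (-1)
    have split : X₂ * X₃ - D = (X₂ * X₃ - X₂₃) + (X₂₃ - D) := by ring
    refine mul_le_mul e6 ?_ (norm_nonneg _) (by positivity)
    rw [split]
    refine (norm_add_le _ _).trans ?_
    calc _ ≤ _ := add_le_add e₂ e₄
      _ = _ := by ring

/-- The (i, j) term of the product integrates to a multiple of (i + j + p)! / (4πy)^(i+j+p+1). The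
prefactors of the kernels cancel the dependence of the power of y on i and j, leaving the
multinomial sum `momentCoeff`. -/
theorem besselKernel_mul_moment {b c : ℕ} {y : ℝ} (hy : 0 < y) (p : ℕ) :
    IntegrableOn (fun t => t ^ p * (besselKernel b y t * besselKernel c y t)) (Set.Ioi 0) ∧
    ∫ t in Set.Ioi 0, t ^ p * (besselKernel b y t * besselKernel c y t)
      = (2 * Real.pi) ^ 2 * ((2 * y)⁻¹) ^ (2 * b + 2 * c - 2) / (4 * Real.pi * y) ^ (p + 1)
        * p.factorial * momentCoeff b c p := by
  have hp := Real.pi_pos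
  have key : ∀ t ∈ Set.Ioi (0 : ℝ), ∑ i ∈ range b, ∑ j ∈ range c,
      (((2 * b - 2 - i).choose (b - 1) : ℝ) * (2 * c - 2 - j).choose (c - 1)
        * ((2 * y)⁻¹) ^ (2 * b + 2 * c - 2 - i - j) * (2 * Real.pi) ^ (i + j + 2)
        / (i.factorial * j.factorial)) * (t ^ (i + j + p) * Real.exp (-(4 * Real.pi * y * t)))
      = t ^ p * (besselKernel b y t * besselKernel c y t) := by
    intro t ht
    have ht : 0 < t := ht
    unfold besselKernel
    rw [sum_mul_sum, mul_sum]
    refine sum_congr rfl fun i hi => ?_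
    rw [mul_sum]
    refine sum_congr rfl fun j hj => ?_
    have hi : i < b := by simpa using hi
    have hj : j < c := by simpa using hj
    have e : Real.exp (-(4 * Real.pi * y * t))
        = Real.exp (-(2 * Real.pi * y * t)) * Real.exp (-(2 * Real.pi * y * t)) := by
      rw [← Real.exp_add]; ring_nf
    rw [abs_of_pos ht, e, show 2 * b + 2 * c - 2 - i - j = (2 * b - 1 - i) + (2 * c - 1 - j) by omega,
      pow_add ((2 * y)⁻¹)]
    ring
  have hr : 0 < 4 * Real.pi * y := by positivity
  have hI : ∀ i ∈ range b, ∀ j ∈ range c, IntegrableOn (fun t : ℝ =>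
      (((2 * b - 2 - i).choose (b - 1) : ℝ) * (2 * c - 2 - j).choose (c - 1)
        * ((2 * y)⁻¹) ^ (2 * b + 2 * c - 2 - i - j) * (2 * Real.pi) ^ (i + j + 2)
        / (i.factorial * j.factorial)) * (t ^ (i + j + p) * Real.exp (-(4 * Real.pi * y * t))))
      (Set.Ioi 0) := fun i _ j _ => (integrableOn_pow_mul_exp hr _).const_mul _
  have hI' : ∀ i ∈ range b, IntegrableOn (fun t : ℝ => ∑ j ∈ range c,
      (((2 * b - 2 - i).choose (b - 1) : ℝ) * (2 * c - 2 - j).choose (c - 1)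
        * ((2 * y)⁻¹) ^ (2 * b + 2 * c - 2 - i - j) * (2 * Real.pi) ^ (i + j + 2)
        / (i.factorial * j.factorial)) * (t ^ (i + j + p) * Real.exp (-(4 * Real.pi * y * t))))
      (Set.Ioi 0) := fun i hi => integrable_finsetSum _ (hI i hi)
  have hI'' := integrable_finsetSum (μ := volume.restrict (Set.Ioi (0 : ℝ))) _ hI'
  refine ⟨IntegrableOn.congr_fun hI'' key measurableSet_Ioi, ?_⟩
  rw [← setIntegral_congr_fun measurableSet_Ioi key, integral_finsetSum _ hI']
  unfold momentCoeff
  push_cast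
  rw [mul_sum]
  refine sum_congr rfl fun i hi => ?_
  rw [integral_finsetSum _ (hI i hi), mul_sum]
  refine sum_congr rfl fun j hj => ?_
  have hi : i < b := by simpa using hi
  have hj : j < c := by simpa using hj
  rw [integral_const_mul, integral_pow_mul_exp hr]
  have h1 := Nat.add_choose_mul_factorial_mul_factorial i p
  rw [← Nat.choose_symm_add] at h1
  have h2 := Nat.add_choose_mul_factorial_mul_factorial (i + p) j
  have h3 : ((i + j + p).factorial : ℝ) = (i + p + j).choose j * ((i + p).choose i * i.factorial
      * p.factorial) * j.factorial := by
    rw [show i + j + p = i + p + j by ring]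
    exact_mod_cast (by rw [h1, h2] : (i + p + j).factorial = (i + p + j).choose j * ((i + p).choose i * i.factorial
      * p.factorial) * j.factorial)
  have h4 : (4 * Real.pi * y) ^ (i + j + p + 1)
      = (4 * Real.pi * y) ^ (p + 1) * ((2 * Real.pi) ^ (i + j) * (2 * y) ^ (i + j)) := by
    rw [← mul_pow, show 2 * Real.pi * (2 * y) = 4 * Real.pi * y by ring, ← pow_add]
    congr 1; ring
  have h5 : ((2 * y)⁻¹) ^ (2 * b + 2 * c - 2)
      = ((2 * y)⁻¹) ^ (2 * b + 2 * c - 2 - i - j) * ((2 * y)⁻¹) ^ (i + j) := by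
    rw [← pow_add]; congr 1; omega
  rw [h3, h4, h5, inv_pow, inv_pow, pow_add (2 * Real.pi) (i + j) 2]
  have : (i.factorial : ℝ) ≠ 0 := by positivity
  have : (j.factorial : ℝ) ≠ 0 := by positivity
  field_simp

theorem integral_bernoulliWeight_mul {a b c : ℕ} {y : ℝ} (hy : 0 < y) :
    2 * ∫ t in Set.Ioi 0, bernoulliWeight a t * (besselKernel b y t * besselKernel c y t)
      = ∑ p ∈ range (2 * a + 1), 2 * (-1) ^ (a + 1) * (2 * Real.pi) ^ (2 * a + 2)
          * ((2 * y)⁻¹) ^ (2 * b + 2 * c - 2) / (4 * Real.pi * y) ^ (p + 1)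
          * ((bernoulli (2 * a - p) : ℝ) / (2 * a - p).factorial) * momentCoeff b c p := by
  have key : ∀ t, bernoulliWeight a t * (besselKernel b y t * besselKernel c y t)
      = ∑ p ∈ range (2 * a + 1), ((-1) ^ (a + 1) * (2 * Real.pi) ^ (2 * a) / (2 * a).factorial
        * ((bernoulli (2 * a - p) : ℝ) * (2 * a).choose p))
          * (t ^ p * (besselKernel b y t * besselKernel c y t)) := by
    intro t
    unfold bernoulliWeight
    rw [bernoulliFun_eq_sum, mul_sum, sum_mul]
    exact sum_congr rfl fun p _ => by ring
  simp only [key]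
  rw [integral_finsetSum _ fun p _ => (besselKernel_mul_moment hy p).1.const_mul _, mul_sum]
  refine sum_congr rfl fun p hp => ?_
  have hp : p ≤ 2 * a := by simpa [Nat.lt_succ_iff] using hp
  rw [integral_const_mul, (besselKernel_mul_moment hy p).2, Nat.cast_choose ℝ hp]
  have : (p.factorial : ℝ) ≠ 0 := by positivity
  have : ((2 * a).factorial : ℝ) ≠ 0 := by positivity
  have : ((2 * a - p).factorial : ℝ) ≠ 0 := by positivity
  field_simp
  ring

/-- The contribution of one vanishing momentum to the Laurent polynomial, at `Y = 4πy`. -/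
noncomputable def pairMain (a b c : ℕ) (Y : ℝ) : ℝ :=
  ∑ k ∈ Icc 1 (a + b + c - 1), 4 * (-1) ^ (a + 1)
      * ((bernoulli (2 * (a + b + c) - 2 * k - 2) : ℝ) / (2 * (a + b + c) - 2 * k - 2).factorial)
      * evenMoment b c k * zeta (2 * k + 1) * Y ^ (((a + b + c : ℕ) : ℤ) - 2 * k - 1)
    + 2 * (-1) ^ a * momentCoeff b c (2 * a - 1) * zeta (2 * (a + b + c) - 2)
      * Y ^ (2 - ((a + b + c : ℕ) : ℤ))

theorem hasSum_zeta {s : ℕ} (hs : 2 ≤ s) : HasSum (fun n : ℕ+ => 1 / (n : ℝ) ^ s) (zeta s) := by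
  have h1 : Summable fun n : ℕ => 1 / ((n + 1 : ℕ) : ℝ) ^ s :=
    (summable_nat_add_iff (f := fun n : ℕ => 1 / (n : ℝ) ^ s) 1).2
      (Real.summable_one_div_nat_pow.2 (by omega))
  have h2 : HasSum (fun n : ℕ => 1 / ((n + 1 : ℕ) : ℝ) ^ s) (zeta s) := by
    convert h1.hasSum
    unfold zeta
    rw [zeta_eq_tsum_one_div_nat_add_one_cpow (by simp; omega)]
    have : ∀ n : ℕ, (1 : ℂ) / ((n : ℂ) + 1) ^ (s : ℂ) = ((1 / ((n + 1 : ℕ) : ℝ) ^ s : ℝ) : ℂ) := by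
      intro n
      rw [Complex.cpow_natCast]; push_cast; rfl
    simp only [this]
    rw [← Complex.ofReal_tsum, Complex.ofReal_re]
  have := (Equiv.pnatEquivNat.symm.hasSum_iff (f := fun n : ℕ+ => 1 / (n : ℝ) ^ s) (a := zeta s)).1
  apply this
  exact h2

/-- The p-th moment scales like n^-(2b+2c-1+p). Even p = 2j gives ζ(2k + 1) with k = b + c - 1 + j.
Among odd p only p = 2a - 1 has a nonzero Bernoulli number, B₁ = -1/2, and gives ζ(2w - 2). One
factor 2 counts n and -n, the other comes with the half-line integral. -/
theorem hasSum_pair {a b c : ℕ} (ha : 1 ≤ a) (hb : 1 ≤ b) (hc : 1 ≤ c) {y : ℝ} (hy : 0 < y) :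
    HasSum (fun n : ℕ+ => (y / Real.pi) ^ (a + b + c)
      * (2 * (2 * ∫ t in Set.Ioi 0, bernoulliWeight a t
        * (besselKernel b (n * y) t * besselKernel c (n * y) t))))
      (pairMain a b c (4 * Real.pi * y)) := by
  have hp := Real.pi_pos
  set w := a + b + c with hw
  set Y := 4 * Real.pi * y with hY
  have Y0 : 0 < Y := by positivity
  have h1 : ∀ n : ℕ+, (y / Real.pi) ^ w
      * (2 * (2 * ∫ t in Set.Ioi 0, bernoulliWeight a t
        * (besselKernel b (n * y) t * besselKernel c (n * y) t)))
      = ∑ p ∈ range (2 * a + 1), (4 * (-1) ^ (a + 1) * ((bernoulli (2 * a - p) : ℝ) / (2 * a - p).factorial)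
          * momentCoeff b c p * Y ^ ((w : ℤ) + 1 - 2 * b - 2 * c - p)) * (1 / (n : ℝ) ^ (2 * b + 2 * c - 1 + p)) := by
    intro n
    have n0 : (0 : ℝ) < n := by exact_mod_cast n.pos
    rw [integral_bernoulliWeight_mul (by positivity), mul_sum, mul_sum]
    refine sum_congr rfl fun p _ => ?_
    have e1 : Y ^ ((w : ℤ) + 1 - 2 * b - 2 * c - p) = Y ^ w / (Y ^ (2 * b + 2 * c - 2) * Y ^ (p + 1)) := by
      rw [← pow_add, ← zpow_natCast, ← zpow_natCast, ← zpow_sub₀ Y0.ne']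
      congr 1
      omega
    have e2 : (2 * Real.pi) ^ (2 * a + 2) * (2 * Real.pi) ^ (2 * b + 2 * c - 2) = (4 * Real.pi ^ 2) ^ w := by
      rw [← pow_add, show 4 * Real.pi ^ 2 = (2 * Real.pi) ^ 2 by ring, ← pow_mul]
      congr 1; omega
    have e3 : (y / Real.pi) ^ w = Y ^ w / (4 * Real.pi ^ 2) ^ w := by
      rw [← div_pow]; congr 1; rw [hY]; field_simp
    have e4 : ((2 * ((n : ℝ) * y))⁻¹) ^ (2 * b + 2 * c - 2)
        = (2 * Real.pi) ^ (2 * b + 2 * c - 2) / (Y ^ (2 * b + 2 * c - 2) * (n : ℝ) ^ (2 * b + 2 * c - 2)) := by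
      rw [← mul_pow, ← div_pow]; congr 1; rw [hY]; field_simp; ring
    have e5 : (4 * Real.pi * ((n : ℝ) * y)) ^ (p + 1) = Y ^ (p + 1) * (n : ℝ) ^ (p + 1) := by
      rw [← mul_pow]; congr 1; rw [hY]; ring
    have e6 : (n : ℝ) ^ (2 * b + 2 * c - 1 + p) = (n : ℝ) ^ (2 * b + 2 * c - 2) * (n : ℝ) ^ (p + 1) := by
      rw [← pow_add]; congr 1; omega
    rw [e1, e3, ← e2, e4, e5, e6]
    have := hp.ne'
    field_simp
    ring
  simp only [h1]
  have h2 : HasSum (fun n : ℕ+ => ∑ p ∈ range (2 * a + 1), (4 * (-1) ^ (a + 1) * ((bernoulli (2 * a - p) : ℝ) / (2 * a - p).factorial)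
          * momentCoeff b c p * Y ^ ((w : ℤ) + 1 - 2 * b - 2 * c - p)) * (1 / (n : ℝ) ^ (2 * b + 2 * c - 1 + p)))
      (∑ p ∈ range (2 * a + 1), (4 * (-1) ^ (a + 1) * ((bernoulli (2 * a - p) : ℝ) / (2 * a - p).factorial)
          * momentCoeff b c p * Y ^ ((w : ℤ) + 1 - 2 * b - 2 * c - p)) * zeta (2 * b + 2 * c - 1 + p)) :=
    hasSum_sum fun p _ => (hasSum_zeta (by omega)).mul_left _
  convert h2 using 1
  unfold pairMain
  set F : ℕ → ℝ := fun p => (4 * (-1) ^ (a + 1) * ((bernoulli (2 * a - p) : ℝ) / (2 * a - p).factorial)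
          * momentCoeff b c p * Y ^ ((w : ℤ) + 1 - 2 * b - 2 * c - p)) * zeta (2 * b + 2 * c - 1 + p) with hF
  have hodd : ∀ j, 2 * j + 1 < 2 * a - 1 → F (2 * j + 1) = 0 := by
    intro j hj
    simp only [hF]
    rw [bernoulli_eq_zero_of_odd (by exact ⟨a - j - 1, by omega⟩) (by omega)]
    simp
  have hsplit : ∀ (G : ℕ → ℝ) (m : ℕ), ∑ p ∈ range (2 * m + 1), G p
      = ∑ j ∈ range (m + 1), G (2 * j) + ∑ j ∈ range m, G (2 * j + 1) := by
    intro G m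
    induction m with
    | zero => simp
    | succ m ih =>
      rw [show 2 * (m + 1) + 1 = 2 * m + 1 + 1 + 1 by ring, sum_range_succ, sum_range_succ, ih,
        sum_range_succ (n := m + 1), sum_range_succ (n := m) (f := fun j => G (2 * j + 1)),
        show 2 * (m + 1) = 2 * m + 1 + 1 by ring]
      ring
  rw [hsplit F a]
  congr 1
  · have hz : ∀ k ∈ Icc 1 (w - 1), k ∉ Ico (b + c - 1) (b + c - 1 + (a + 1)) →
        4 * (-1) ^ (a + 1) * ((bernoulli (2 * w - 2 * k - 2) : ℝ) / (2 * w - 2 * k - 2).factorial)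
        * evenMoment b c k * zeta (2 * k + 1) * Y ^ ((w : ℤ) - 2 * k - 1) = 0 := by
      intro k hk hk'
      simp only [mem_Icc, mem_Ico, not_and, not_lt] at hk hk'
      have : evenMoment b c k = 0 := by
        unfold evenMoment; rw [if_neg (by omega)]
      rw [this]; simp
    rw [← sum_subset (s₁ := Ico (b + c - 1) (b + c - 1 + (a + 1))) (fun k hk => by
      simp only [mem_Icc, mem_Ico] at hk ⊢; omega) hz, sum_Ico_eq_sum_range, Nat.add_sub_cancel_left]
    refine sum_congr rfl fun j hj => ?_
    have hj : j ≤ a := by simpa [Nat.lt_succ_iff] using hj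
    simp only [hF]
    rw [show 2 * w - 2 * (b + c - 1 + j) - 2 = 2 * a - 2 * j by omega]
    have : evenMoment b c (b + c - 1 + j) = momentCoeff b c (2 * j) := by
      unfold evenMoment
      rw [if_pos (by omega), show b + c - 1 + j + 1 - b - c = j by omega]
    rw [this, show 2 * (b + c - 1 + j) + 1 = 2 * b + 2 * c - 1 + 2 * j by omega,
      show (w : ℤ) - 2 * ((b + c - 1 + j : ℕ) : ℤ) - 1 = (w : ℤ) + 1 - 2 * b - 2 * c - (2 * j : ℕ) by omega]
    ring
  · obtain ⟨n, rfl⟩ : ∃ n, a = n + 1 := ⟨a - 1, by omega⟩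
    rw [sum_range_succ, sum_eq_zero fun j hj => hodd j (by simp at hj; omega), zero_add]
    simp only [hF]
    rw [show 2 * (n + 1) - (2 * n + 1) = 1 by omega, show 2 * (n + 1) - 1 = 2 * n + 1 by omega,
      show 2 * w - 2 = 2 * b + 2 * c - 1 + (2 * n + 1) by omega,
      show 2 - (w : ℤ) = (w : ℤ) + 1 - 2 * b - 2 * c - (2 * n + 1 : ℕ) by omega, bernoulli_one]
    push_cast
    rw [Nat.factorial_one]
    ring

/-! ### Integrals of products of poles, and the integral of three kernels -/

/-- The function `ξ ↦ (p + iξ)⁻¹`. -/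
noncomputable def pole (p : ℂ) (ξ : ℝ) : ℂ := (p + ξ * Complex.I)⁻¹

theorem add_mul_I_ne_zero {p : ℂ} (hp : 0 < p.re) (ξ : ℝ) : p + ξ * Complex.I ≠ 0 := by
  intro h
  have := congrArg Complex.re h
  simp at this
  linarith

theorem continuous_pole {p : ℂ} (hp : 0 < p.re) : Continuous (pole p) :=
  Continuous.inv₀ (by fun_prop) (add_mul_I_ne_zero hp)

theorem norm_pole_le {p : ℂ} (hp : 0 < p.re) : ∃ K : ℝ, 0 < K ∧ ∀ ξ, ‖pole p ξ‖ ≤ K * (1 + |ξ|)⁻¹ := by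
  refine ⟨1 + (1 + ‖p‖) / p.re, by positivity, fun ξ => ?_⟩
  unfold pole
  have h1 : p.re ≤ ‖p + ξ * Complex.I‖ := by
    have := Complex.re_le_norm (p + ξ * Complex.I)
    simpa using this
  have h2 : |ξ| ≤ ‖p + ξ * Complex.I‖ + ‖p‖ := by
    have := norm_sub_le (p + ξ * Complex.I) p
    simpa using this
  have h0 : 0 < ‖p + ξ * Complex.I‖ := by linarith
  rw [norm_inv, inv_le_iff_one_le_mul₀ h0, mul_assoc, ← div_eq_inv_mul, mul_div, le_div_iff₀ (by positivity)]
  have h3 : 1 + ‖p‖ ≤ (1 + ‖p‖) / p.re * ‖p + ξ * Complex.I‖ := by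
    rw [div_mul_eq_mul_div, le_div_iff₀ hp]
    gcongr
  linarith

theorem tendsto_pole {p : ℂ} (hp : 0 < p.re) :
    Tendsto (pole p) atBot (𝓝 0) ∧ Tendsto (pole p) atTop (𝓝 0) := by
  obtain ⟨K, hK, h⟩ := norm_pole_le hp
  have e : ∀ l : Filter ℝ, Tendsto (fun ξ : ℝ => |ξ|) l atTop → Tendsto (pole p) l (𝓝 0) := by
    intro l hl
    refine squeeze_zero_norm h ?_
    have := (tendsto_inv_atTop_zero.comp (tendsto_atTop_add_const_left l 1 hl)).const_mul K
    simpa using this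
  exact ⟨e _ tendsto_abs_atBot_atTop, e _ tendsto_abs_atTop_atTop⟩

theorem integrable_pow_mul_pow {f h : ℝ → ℂ} (hf : Continuous f) (hh : Continuous h)
    (hf' : ∃ K : ℝ, 0 < K ∧ ∀ ξ, ‖f ξ‖ ≤ K * (1 + |ξ|)⁻¹)
    (hh' : ∃ K : ℝ, 0 < K ∧ ∀ ξ, ‖h ξ‖ ≤ K * (1 + |ξ|)⁻¹) {k l : ℕ} (hkl : 2 ≤ k + l) :
    Integrable fun ξ => f ξ ^ k * h ξ ^ l := by
  obtain ⟨K, hK, hf'⟩ := hf'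
  obtain ⟨M, hM, hh'⟩ := hh'
  refine Integrable.mono' (integrable_inv_one_add_sq.const_mul (K ^ k * M ^ l))
    (by fun_prop) (ae_of_all _ fun ξ => ?_)
  have h1 : (1 + |ξ|)⁻¹ ≤ 1 := inv_le_one_of_one_le₀ (by linarith [abs_nonneg ξ])
  have h2 : ((1 + |ξ|)⁻¹) ^ 2 ≤ (1 + ξ ^ 2)⁻¹ := by
    rw [inv_pow]
    refine inv_anti₀ (by positivity) ?_
    nlinarith [abs_nonneg ξ, sq_abs ξ]
  rw [norm_mul, norm_pow, norm_pow]
  calc _ ≤ (K * (1 + |ξ|)⁻¹) ^ k * (M * (1 + |ξ|)⁻¹) ^ l := by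
        gcongr
        · exact hf' ξ
        · exact hh' ξ
    _ = K ^ k * M ^ l * ((1 + |ξ|)⁻¹) ^ (k + l) := by rw [mul_pow, mul_pow, pow_add]; ring
    _ ≤ K ^ k * M ^ l * ((1 + |ξ|)⁻¹) ^ 2 := by
        exact mul_le_mul_of_nonneg_left (pow_le_pow_of_le_one (by positivity) h1 hkl)
          (by positivity)
    _ ≤ _ := by gcongr

theorem norm_pole_neg_le {p : ℂ} (hp : 0 < p.re) :
    ∃ K : ℝ, 0 < K ∧ ∀ ξ, ‖pole p (-ξ)‖ ≤ K * (1 + |ξ|)⁻¹ := by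
  obtain ⟨K, hK, h⟩ := norm_pole_le hp
  exact ⟨K, hK, fun ξ => by simpa using h (-ξ)⟩

theorem hasDerivAt_pole {p : ℂ} (hp : 0 < p.re) (ξ : ℝ) :
    HasDerivAt (pole p) (-Complex.I * pole p ξ ^ 2) ξ := by
  have h1 : HasDerivAt (fun ξ : ℝ => p + ξ * Complex.I) (1 * Complex.I) ξ :=
    ((Complex.ofRealCLM.hasDerivAt (x := ξ)).mul_const Complex.I).const_add p
  have := h1.inv (add_mul_I_ne_zero hp ξ)
  refine this.congr_deriv ?_
  unfold pole
  have := add_mul_I_ne_zero hp ξ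
  field_simp

theorem integral_pole_pow {p : ℂ} (hp : 0 < p.re) {n : ℕ} (hn : 2 ≤ n) :
    ∫ ξ, pole p ξ ^ n = 0 := by
  obtain ⟨m, rfl⟩ : ∃ m, n = m + 2 := ⟨n - 2, by omega⟩
  have h1 : ∀ ξ, HasDerivAt (fun ξ => pole p ξ ^ (m + 1))
      (-(m + 1) * Complex.I * pole p ξ ^ (m + 2)) ξ := fun ξ => by
    refine ((hasDerivAt_pole hp ξ).pow (m + 1)).congr_deriv ?_
    push_cast
    ring
  have h2 := integrable_pow_mul_pow (continuous_pole hp) (continuous_pole hp) (norm_pole_le hp)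
    (norm_pole_le hp) (k := m + 2) (l := 0) (by omega)
  simp only [pow_zero, mul_one] at h2
  have h3 := integral_of_hasDerivAt_of_tendsto h1 (h2.const_mul _)
    ((tendsto_pole hp).1.pow (m + 1)) ((tendsto_pole hp).2.pow (m + 1))
  rw [integral_const_mul, sub_self] at h3
  refine (mul_eq_zero.1 h3).resolve_left ?_
  refine mul_ne_zero (neg_ne_zero.2 ?_) Complex.I_ne_zero
  exact_mod_cast Nat.succ_ne_zero m

/-- The logarithm of (p + iξ)/(q + iξ) is, up to a nonzero constant, an antiderivative that vanishes
at both ends. The quotient avoids the negative axis: were it a real number ≤ 0, comparison of real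
parts would contradict p.re, q.re > 0. -/
theorem integral_pole_mul_pole {p q : ℂ} (hp : 0 < p.re) (hq : 0 < q.re) (hpq : p ≠ q) :
    ∫ ξ, pole p ξ ^ 1 * pole q ξ ^ 1 = 0 := by
  have h0 : ∀ ξ, (p + ξ * Complex.I) / (q + ξ * Complex.I) = 1 + (p - q) * pole q ξ := by
    intro ξ
    have := add_mul_I_ne_zero hq ξ
    unfold pole
    field_simp
    ring
  have hs : ∀ ξ, 1 + (p - q) * pole q ξ ∈ Complex.slitPlane := by
    intro ξ
    rw [← h0, Complex.mem_slitPlane_iff]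
    by_contra hcon
    push Not at hcon
    obtain ⟨h1, h2⟩ := hcon
    have e : p + ξ * Complex.I = (((p + ξ * Complex.I) / (q + ξ * Complex.I)).re : ℂ) * (q + ξ * Complex.I) := by
      conv_lhs => rw [← div_mul_cancel₀ (p + ξ * Complex.I) (add_mul_I_ne_zero hq ξ)]
      congr 1
      apply Complex.ext <;> simp [h2]
    have e2 := congrArg Complex.re e
    rw [Complex.re_ofReal_mul] at e2
    simp only [Complex.add_re, Complex.mul_re, Complex.ofReal_re, Complex.I_re, mul_zero,
      Complex.ofReal_im, Complex.I_im, mul_one, sub_self, add_zero] at e2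
    nlinarith
  have h1 : ∀ ξ, HasDerivAt (fun ξ => Complex.log (1 + (p - q) * pole q ξ))
      ((q - p) * Complex.I * (pole p ξ ^ 1 * pole q ξ ^ 1)) ξ := fun ξ => by
    have := (((hasDerivAt_pole hq ξ).const_mul (p - q)).const_add 1).clog_real (hs ξ)
    convert this using 1
    rw [← h0]
    have := add_mul_I_ne_zero hq ξ
    have := add_mul_I_ne_zero hp ξ
    unfold pole
    field_simp
    ring
  have h2 := integrable_pow_mul_pow (continuous_pole hp) (continuous_pole hq) (norm_pole_le hp)
    (norm_pole_le hq) (k := 1) (l := 1) (by omega)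
  have ht : ∀ l : Filter ℝ, Tendsto (pole q) l (𝓝 0) →
      Tendsto (fun ξ => Complex.log (1 + (p - q) * pole q ξ)) l (𝓝 0) := by
    intro l hl
    have h3 : Tendsto (fun ξ => 1 + (p - q) * pole q ξ) l (𝓝 1) := by
      simpa using (hl.const_mul (p - q)).const_add 1
    have h4 := (continuousAt_clog (x := 1) (by simp)).tendsto.comp h3
    rwa [Complex.log_one] at h4
  have h3 := integral_of_hasDerivAt_of_tendsto h1 (h2.const_mul _)
    (ht _ (tendsto_pole hq).1) (ht _ (tendsto_pole hq).2)
  rw [integral_const_mul, sub_self] at h3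
  exact (mul_eq_zero.1 h3).resolve_left (mul_ne_zero (sub_ne_zero.2 hpq.symm) Complex.I_ne_zero)

/-- Two factors with poles in the same half plane. -/
theorem integral_pole_pow_mul_pole_pow {p q : ℂ} (hp : 0 < p.re) (hq : 0 < q.re) (k l : ℕ) :
    ∫ ξ, pole p ξ ^ (k + 1) * pole q ξ ^ (l + 1) = 0 := by
  by_cases hpq : p = q
  · subst hpq
    simp only [← pow_add]
    exact integral_pole_pow hp (by omega)
  -- The resolvent identity lowers the total order by one. It requires p ≠ q; confluent poles have
  -- been treated above by an antiderivative.
  have key : ∀ k l, ∀ ξ, pole p ξ ^ (k + 1) * pole q ξ ^ (l + 1)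
      = (q - p)⁻¹ * (pole p ξ ^ (k + 1) * pole q ξ ^ l - pole p ξ ^ k * pole q ξ ^ (l + 1)) := by
    intro k l ξ
    have h1 := add_mul_I_ne_zero hp ξ
    have h2 := add_mul_I_ne_zero hq ξ
    have h3 : (q - p) ≠ 0 := sub_ne_zero.2 (Ne.symm hpq)
    have h4 : pole p ξ - pole q ξ = (q - p) * (pole p ξ * pole q ξ) := by
      unfold pole
      field_simp
      ring
    rw [show pole p ξ ^ (k + 1) * pole q ξ ^ l - pole p ξ ^ k * pole q ξ ^ (l + 1)
      = pole p ξ ^ k * pole q ξ ^ l * (pole p ξ - pole q ξ) by ring, h4]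
    field_simp
    ring
  have hI : ∀ k l, 2 ≤ k + l → Integrable fun ξ => pole p ξ ^ k * pole q ξ ^ l := fun k l h =>
    integrable_pow_mul_pow (continuous_pole hp) (continuous_pole hq) (norm_pole_le hp)
      (norm_pole_le hq) h
  have hrec : ∀ k l, 1 ≤ k + l → ∫ ξ, pole p ξ ^ (k + 1) * pole q ξ ^ (l + 1)
      = (q - p)⁻¹ * ((∫ ξ, pole p ξ ^ (k + 1) * pole q ξ ^ l)
        - ∫ ξ, pole p ξ ^ k * pole q ξ ^ (l + 1)) := by
    intro k l h
    simp only [key]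
    rw [integral_const_mul, integral_sub (hI _ _ (by omega)) (hI _ _ (by omega))]
  suffices H : ∀ n k l, k + l = n → ∫ ξ, pole p ξ ^ (k + 1) * pole q ξ ^ (l + 1) = 0 from H _ k l rfl
  intro n
  induction n with
  | zero =>
    intro k l h
    obtain ⟨rfl, rfl⟩ : k = 0 ∧ l = 0 := by omega
    exact integral_pole_mul_pole hp hq hpq
  | succ n ih =>
    intro k l h
    rw [hrec k l (by omega)]
    have h1 : ∫ ξ, pole p ξ ^ (k + 1) * pole q ξ ^ l = 0 := by
      rcases l with _ | l
      · simpa using integral_pole_pow hp (n := k + 1) (by omega)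
      · exact ih k l (by omega)
    have h2 : ∫ ξ, pole p ξ ^ k * pole q ξ ^ (l + 1) = 0 := by
      rcases k with _ | k
      · simpa using integral_pole_pow hq (n := l + 1) (by omega)
      · exact ih k l (by omega)
    rw [h1, h2]; simp

/-- Two factors with opposite poles. -/
theorem integral_pole_pow_mul_pole_neg_pow {c : ℝ} (hc : 0 < c) (k l : ℕ) :
    ∫ ξ, pole c ξ ^ (k + 1) * pole c (-ξ) ^ (l + 1)
      = 2 * Real.pi * (k + l).choose k * ((2 * c)⁻¹) ^ (k + l + 1) := by
  have hp : 0 < (c : ℂ).re := by simpa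
  have hcn : Continuous fun ξ => pole c (-ξ) := (continuous_pole hp).comp continuous_neg
  have hI : ∀ k l, 2 ≤ k + l → Integrable fun ξ => pole c ξ ^ k * pole c (-ξ) ^ l := fun k l h =>
    integrable_pow_mul_pow (continuous_pole hp) hcn (norm_pole_le hp)
      (norm_pole_neg_le hp) h
  have c0 : (c : ℂ) ≠ 0 := by exact_mod_cast hc.ne'
  -- Here the sum of the two poles is 2c times their product, so the recursion is Pascal's rule. It
  -- ends at the arctangent integral k = l = 0, and integrals with only one of the two poles vanish.
  have key : ∀ k l, ∀ ξ, pole c ξ ^ (k + 1) * pole c (-ξ) ^ (l + 1)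
      = (2 * c : ℂ)⁻¹ * (pole c ξ ^ k * pole c (-ξ) ^ (l + 1) + pole c ξ ^ (k + 1) * pole c (-ξ) ^ l) := by
    intro k l ξ
    have h1 := add_mul_I_ne_zero hp ξ
    have h2 := add_mul_I_ne_zero hp (-ξ)
    have h4 : pole c ξ + pole c (-ξ) = (2 * c) * (pole c ξ * pole c (-ξ)) := by
      unfold pole
      rw [inv_add_inv h1 h2, div_eq_mul_inv, mul_inv]
      congr 1
      push_cast
      ring
    rw [show pole c ξ ^ k * pole c (-ξ) ^ (l + 1) + pole c ξ ^ (k + 1) * pole c (-ξ) ^ l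
      = pole c ξ ^ k * pole c (-ξ) ^ l * (pole c ξ + pole c (-ξ)) by ring, h4]
    field_simp
    ring
  have hrec : ∀ k l, 1 ≤ k + l → ∫ ξ, pole c ξ ^ (k + 1) * pole c (-ξ) ^ (l + 1)
      = (2 * c : ℂ)⁻¹ * ((∫ ξ, pole c ξ ^ k * pole c (-ξ) ^ (l + 1))
        + ∫ ξ, pole c ξ ^ (k + 1) * pole c (-ξ) ^ l) := by
    intro k l h
    simp only [key]
    rw [integral_const_mul, integral_add (hI _ _ (by omega)) (hI _ _ (by omega))]
  suffices H : ∀ n k l, k + l = n → ∫ ξ, pole c ξ ^ (k + 1) * pole c (-ξ) ^ (l + 1)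
      = 2 * Real.pi * (k + l).choose k * ((2 * c)⁻¹) ^ (k + l + 1) from H _ k l rfl
  intro n
  induction n with
  | zero =>
    intro k l h
    obtain ⟨rfl, rfl⟩ : k = 0 ∧ l = 0 := by omega
    have h1 : ∀ ξ : ℝ, pole c ξ ^ (0 + 1) * pole c (-ξ) ^ (0 + 1)
        = (((c ^ 2)⁻¹ * (1 + (ξ * c⁻¹) ^ 2)⁻¹ : ℝ) : ℂ) := by
      intro ξ
      have : (c : ℂ) ^ 2 + ξ ^ 2 ≠ 0 := by
        have : c ^ 2 + ξ ^ 2 ≠ 0 := by positivity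
        exact_mod_cast this
      unfold pole
      rw [zero_add, pow_one, pow_one, ← mul_inv]
      push_cast
      rw [← mul_inv]
      congr 1
      field_simp
      linear_combination (-(ξ : ℂ) ^ 2) * Complex.I_sq
    simp only [h1]
    rw [integral_complex_ofReal, integral_const_mul,
      Measure.integral_comp_mul_right (fun x : ℝ => (1 + x ^ 2)⁻¹), integral_univ_inv_one_add_sq,
      inv_inv, abs_of_pos hc]
    simp only [smul_eq_mul]
    push_cast
    simp
    field_simp
  | succ n ih =>
    intro k l h
    rw [hrec k l (by omega)]
    have h1 : ∫ ξ, pole c ξ ^ k * pole c (-ξ) ^ (l + 1)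
        = 2 * Real.pi * (if k = 0 then 0 else (k - 1 + l).choose (k - 1) : ℕ) * ((2 * c)⁻¹) ^ (k + l) := by
      rcases k with _ | k
      · simp only [pow_zero, one_mul]
        rw [integral_neg_eq_self (fun ξ => pole c ξ ^ (l + 1)), integral_pole_pow hp (by omega)]
        simp
      · rw [ih k l (by omega)]
        simp [show k + 1 + l = k + l + 1 by ring]
    have h2 : ∫ ξ, pole c ξ ^ (k + 1) * pole c (-ξ) ^ l
        = 2 * Real.pi * (if l = 0 then 0 else (k + (l - 1)).choose k : ℕ) * ((2 * c)⁻¹) ^ (k + l) := by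
      rcases l with _ | l
      · simp only [pow_zero, mul_one]
        rw [integral_pole_pow hp (by omega)]
        simp
      · rw [ih k l (by omega)]
        simp [show k + (l + 1) = k + l + 1 by ring]
    rw [h1, h2]
    have h3 : (k + l).choose k = (if k = 0 then 0 else (k - 1 + l).choose (k - 1))
        + (if l = 0 then 0 else (k + (l - 1)).choose k) := by
      rcases k with _ | k
      · rcases l with _ | l
        · omega
        · simp
      · rcases l with _ | l
        · simp
        · simp only [Nat.add_sub_cancel, Nat.succ_ne_zero, if_false]
          rw [show k + 1 + (l + 1) = k + l + 1 + 1 by ring, Nat.choose_succ_succ,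
            show k + (l + 1) = k + l + 1 by ring, show k + 1 + l = k + l + 1 by ring]
    rw [h3]
    push_cast
    ring

theorem lorentz_eq_pole (a : ℕ) (c ξ : ℝ) :
    (lorentz a c ξ : ℂ) = pole c ξ ^ a * pole c (-ξ) ^ a := by
  unfold lorentz pole
  rw [← mul_pow, ← mul_inv]
  push_cast
  congr 2
  linear_combination ((ξ : ℂ) ^ 2) * Complex.I_sq

theorem integrable_lorentz {a : ℕ} (ha : 1 ≤ a) {c : ℝ} (hc : 0 < c) :
    Integrable fun ξ => (lorentz a c ξ : ℂ) := by
  have hp : 0 < (c : ℂ).re := by simpa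
  simp only [lorentz_eq_pole]
  exact integrable_pow_mul_pow (continuous_pole hp) ((continuous_pole hp).comp continuous_neg)
    (norm_pole_le hp) (norm_pole_neg_le hp) (by omega)

theorem integrable_besselKernel {a : ℕ} (ha : 1 ≤ a) {c : ℝ} (hc : 0 < c) :
    Integrable fun t => (besselKernel a c t : ℂ) := by
  simpa using (besselKernel_fourier ha hc 0).1

theorem fourier_besselKernel {a : ℕ} (ha : 1 ≤ a) {c : ℝ} (hc : 0 < c) :
    FourierTransform.fourier (fun t => (besselKernel a c t : ℂ)) = fun ξ => (lorentz a c ξ : ℂ) := by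
  ext ξ
  rw [Real.fourier_real_eq_integral_exp_smul]
  simpa only [smul_eq_mul] using (besselKernel_fourier ha hc ξ).2

theorem fourier_lorentz {a : ℕ} (ha : 1 ≤ a) {c : ℝ} (hc : 0 < c) :
    FourierTransform.fourier (fun ξ => (lorentz a c ξ : ℂ)) = fun t => (besselKernel a c t : ℂ) := by
  have h := Continuous.fourierInv_fourier_eq (f := fun t => (besselKernel a c t : ℂ))
    (Complex.continuous_ofReal.comp (continuous_besselKernel a c)) (integrable_besselKernel ha hc)
    (by rw [fourier_besselKernel ha hc]; exact integrable_lorentz ha hc)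
  rw [fourier_besselKernel ha hc] at h
  ext t
  have := congrFun h (-t)
  rw [Real.fourierInv_eq_fourier_neg, neg_neg, besselKernel_neg] at this
  exact this

/-- The product of the first two kernels is the Fourier transform of a convolution of Lorentzians;
self-adjointness of the Fourier transform moves it to the third kernel. -/
theorem integral_besselKernel_mul {a b c : ℕ} (ha : 1 ≤ a) (hb : 1 ≤ b) (hc : 1 ≤ c)
    {x y z : ℝ} (hx : 0 < x) (hy : 0 < y) (hz : 0 < z) :
    ((2 * ∫ t in Set.Ioi 0, besselKernel a x t * (besselKernel b y t * besselKernel c z t) : ℝ) : ℂ)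
      = ∫ ξ, (∫ s, (lorentz a x s : ℂ) * lorentz b y (ξ - s)) * lorentz c z ξ := by
  have h1 : 2 * ∫ t in Set.Ioi 0, besselKernel a x t * (besselKernel b y t * besselKernel c z t)
      = ∫ t, besselKernel a x t * (besselKernel b y t * besselKernel c z t) := by
    rw [← integral_comp_abs (f := fun t => besselKernel a x t * (besselKernel b y t * besselKernel c z t))]
    congr 1 with t
    simp [besselKernel]
  rw [h1, ← integral_complex_ofReal]
  have h2 : ∀ t, ((besselKernel a x t * (besselKernel b y t * besselKernel c z t) : ℝ) : ℂ)
      = FourierTransform.fourier (convolution (fun ξ => (lorentz a x ξ : ℂ)) (fun ξ => (lorentz b y ξ : ℂ))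
        (ContinuousLinearMap.mul ℂ ℂ) volume) t • (besselKernel c z t : ℂ) := by
    intro t
    rw [Real.fourier_mul_convolution_eq (integrable_lorentz ha hx) (integrable_lorentz hb hy),
      fourier_lorentz ha hx, fourier_lorentz hb hy, smul_eq_mul]
    push_cast
    ring
  simp only [h2]
  have h3 := VectorFourier.integral_fourierIntegral_smul_eq_flip (L := innerₗ ℝ) (μ := volume) (ν := volume)
      Real.continuous_fourierChar continuous_inner
      ((integrable_lorentz ha hx).integrable_convolution (ContinuousLinearMap.mul ℂ ℂ) (integrable_lorentz hb hy))
      (integrable_besselKernel hc hz)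
  refine h3.trans ?_
  congr 1 with ξ
  rw [flip_innerₗ]
  have h4 := congrFun (fourier_besselKernel hc hz) ξ
  rw [smul_eq_mul]
  exact congrArg₂ _ rfl h4

/-- The convolution of two functions `(ξ² + c²)⁻ᵃ`. -/
theorem integral_lorentz_mul_lorentz {a b : ℕ} {x y : ℝ} (hx : 0 < x) (hy : 0 < y) (ξ : ℝ) :
    ∫ s, (lorentz (a + 1) x s : ℂ) * lorentz (b + 1) y (ξ - s)
      = (∑ k ∈ range (a + 1), ∑ l ∈ range (a + 1), (((a + b - k).choose b * (a + b - l).choose b : ℕ) : ℂ)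
          * (2 * Real.pi * (k + l).choose k * ((2 * x)⁻¹) ^ (k + l + 1))
          * (pole (x + y : ℝ) ξ ^ (a + b + 1 - k) * pole (x + y : ℝ) (-ξ) ^ (a + b + 1 - l)))
      + (∑ k ∈ range (b + 1), ∑ l ∈ range (b + 1), (((a + b - k).choose a * (a + b - l).choose a : ℕ) : ℂ)
          * (2 * Real.pi * (k + l).choose k * ((2 * y)⁻¹) ^ (k + l + 1))
          * (pole (x + y : ℝ) ξ ^ (a + b + 1 - k) * pole (x + y : ℝ) (-ξ) ^ (a + b + 1 - l))) := by
  have hxp : 0 < (x : ℂ).re := by simpa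
  have hyp : 0 < (y : ℂ).re := by simpa
  have hyp1 : 0 < (y + ξ * Complex.I : ℂ).re := by simpa
  have hyp2 : 0 < (y - ξ * Complex.I : ℂ).re := by simpa
  have hxy : 0 < ((x + y : ℝ) : ℂ).re := by rw [Complex.ofReal_re]; positivity
  have hw1 : ∀ s, pole y (ξ - s) = pole (y + ξ * Complex.I) (-s) := by
    intro s; unfold pole; push_cast; congr 1; ring
  have hw2 : ∀ s, pole y (-(ξ - s)) = pole (y - ξ * Complex.I) s := by
    intro s; unfold pole; push_cast; congr 1; ring
  -- The denominators x + is and y + i(ξ - s) add up to x + y + iξ, free of s. Hence partial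
  -- fractions in s with v = `pole (x + y) ξ`, and likewise for the conjugate factors.
  have rel1 : ∀ s, pole x s * pole y (ξ - s) = pole (x + y : ℝ) ξ * (pole x s + pole y (ξ - s)) := by
    intro s
    have h1 := add_mul_I_ne_zero hxp s
    have h2 := add_mul_I_ne_zero hyp (ξ - s)
    have h3 := add_mul_I_ne_zero hxy ξ
    unfold pole
    rw [inv_add_inv h1 h2, show (x : ℂ) + s * Complex.I + (y + (ξ - s : ℝ) * Complex.I)
      = (x + y : ℝ) + ξ * Complex.I by push_cast; ring, ← mul_div_assoc, inv_mul_cancel₀ h3, one_div, mul_inv]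
  have rel2 : ∀ s, pole x (-s) * pole y (-(ξ - s))
      = pole (x + y : ℝ) (-ξ) * (pole x (-s) + pole y (-(ξ - s))) := by
    intro s
    have h1 := add_mul_I_ne_zero hxp (-s)
    have h2 := add_mul_I_ne_zero hyp (-(ξ - s))
    have h3 := add_mul_I_ne_zero hxy (-ξ)
    unfold pole
    rw [inv_add_inv h1 h2, show (x : ℂ) + (-s : ℝ) * Complex.I + (y + (-(ξ - s) : ℝ) * Complex.I)
      = (x + y : ℝ) + (-ξ : ℝ) * Complex.I by push_cast; ring, ← mul_div_assoc, inv_mul_cancel₀ h3, one_div, mul_inv]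
  set v := pole (x + y : ℝ) ξ
  set v' := pole (x + y : ℝ) (-ξ)
  have cx := continuous_pole hxp
  have cxn : Continuous fun s => pole x (-s) := cx.comp continuous_neg
  have cy : Continuous fun s => pole y (ξ - s) := (continuous_pole hyp).comp (by fun_prop)
  have cyn : Continuous fun s => pole y (-(ξ - s)) := (continuous_pole hyp).comp (by fun_prop)
  have by1 : ∃ K : ℝ, 0 < K ∧ ∀ s, ‖pole y (ξ - s)‖ ≤ K * (1 + |s|)⁻¹ := by
    simp only [hw1]; exact norm_pole_neg_le hyp1
  have by2 : ∃ K : ℝ, 0 < K ∧ ∀ s, ‖pole y (-(ξ - s))‖ ≤ K * (1 + |s|)⁻¹ := by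
    simp only [hw2]; exact norm_pole_le hyp2
  have i1 : ∀ k l, ∫ s, pole x s ^ (k + 1) * pole x (-s) ^ (l + 1)
      = 2 * Real.pi * (k + l).choose k * ((2 * x)⁻¹) ^ (k + l + 1) :=
    integral_pole_pow_mul_pole_neg_pow hx
  have i2 : ∀ k l, ∫ s, pole y (ξ - s) ^ (k + 1) * pole y (-(ξ - s)) ^ (l + 1)
      = 2 * Real.pi * (k + l).choose k * ((2 * y)⁻¹) ^ (k + l + 1) := fun k l => by
    rw [integral_sub_left_eq_self (fun s => pole y s ^ (k + 1) * pole y (-s) ^ (l + 1)) volume ξ]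
    exact integral_pole_pow_mul_pole_neg_pow hy k l
  -- The mixed products have both poles in the same half plane and integrate to zero, so only the
  -- two unmixed sums remain.
  have i3 : ∀ k l, ∫ s, pole x s ^ (k + 1) * pole y (-(ξ - s)) ^ (l + 1) = 0 := fun k l => by
    simp only [hw2]
    exact integral_pole_pow_mul_pole_pow hxp hyp2 k l
  have i4 : ∀ k l, ∫ s, pole y (ξ - s) ^ (k + 1) * pole x (-s) ^ (l + 1) = 0 := fun k l => by
    simp only [hw1]
    rw [integral_neg_eq_self (fun s => pole (y + ξ * Complex.I) s ^ (k + 1) * pole x s ^ (l + 1))]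
    exact integral_pole_pow_mul_pole_pow hyp1 hxp k l
  have j1 : ∀ k l, Integrable fun s => pole x s ^ (k + 1) * pole x (-s) ^ (l + 1) := fun k l =>
    integrable_pow_mul_pow cx cxn (norm_pole_le hxp) (norm_pole_neg_le hxp) (by omega)
  have j2 : ∀ k l, Integrable fun s => pole y (ξ - s) ^ (k + 1) * pole y (-(ξ - s)) ^ (l + 1) := fun k l =>
    integrable_pow_mul_pow cy cyn by1 by2 (by omega)
  have j3 : ∀ k l, Integrable fun s => pole x s ^ (k + 1) * pole y (-(ξ - s)) ^ (l + 1) := fun k l =>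
    integrable_pow_mul_pow cx cyn (norm_pole_le hxp) by2 (by omega)
  have j4 : ∀ k l, Integrable fun s => pole y (ξ - s) ^ (k + 1) * pole x (-s) ^ (l + 1) := fun k l =>
    integrable_pow_mul_pow cy cxn by1 (norm_pole_neg_le hxp) (by omega)
  have main : ∀ (m n : ℕ) (A B : ℕ → ℂ) (f h : ℝ → ℂ) (V : ℕ → ℕ → ℂ),
      (∀ k l, Integrable fun s => f s ^ (k + 1) * h s ^ (l + 1)) →
      (∀ k l, ∫ s, f s ^ (k + 1) * h s ^ (l + 1) = V k l) →
      Integrable (fun s => (∑ k ∈ range m, A k * f s ^ (k + 1)) * ∑ l ∈ range n, B l * h s ^ (l + 1)) ∧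
      ∫ s, (∑ k ∈ range m, A k * f s ^ (k + 1)) * ∑ l ∈ range n, B l * h s ^ (l + 1)
        = ∑ k ∈ range m, ∑ l ∈ range n, A k * B l * V k l := by
    intro m n A B f h V hi hV
    have e : ∀ s, (∑ k ∈ range m, A k * f s ^ (k + 1)) * ∑ l ∈ range n, B l * h s ^ (l + 1)
        = ∑ k ∈ range m, ∑ l ∈ range n, A k * B l * (f s ^ (k + 1) * h s ^ (l + 1)) := by
      intro s
      rw [sum_mul_sum]
      exact sum_congr rfl fun k _ => sum_congr rfl fun l _ => by ring
    simp only [e]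
    have i0 : ∀ k ∈ range m, Integrable fun s => ∑ l ∈ range n, A k * B l * (f s ^ (k + 1) * h s ^ (l + 1)) :=
      fun k _ => integrable_finsetSum _ fun l _ => (hi k l).const_mul _
    refine ⟨integrable_finsetSum _ i0, ?_⟩
    rw [integral_finsetSum _ i0]
    refine sum_congr rfl fun k _ => ?_
    rw [integral_finsetSum _ fun l _ => (hi k l).const_mul _]
    refine sum_congr rfl fun l _ => ?_
    rw [integral_const_mul, hV]
  have expand : ∀ s, (lorentz (a + 1) x s : ℂ) * lorentz (b + 1) y (ξ - s)
      = ((∑ k ∈ range (a + 1), ((a + b - k).choose b * v ^ (a + b + 1 - k)) * pole x s ^ (k + 1))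
        * (∑ k ∈ range (a + 1), ((a + b - k).choose b * v' ^ (a + b + 1 - k)) * pole x (-s) ^ (k + 1))
      + (∑ k ∈ range (b + 1), ((a + b - k).choose a * v ^ (a + b + 1 - k)) * pole y (ξ - s) ^ (k + 1))
        * (∑ k ∈ range (b + 1), ((a + b - k).choose a * v' ^ (a + b + 1 - k)) * pole y (-(ξ - s)) ^ (k + 1)))
      + ((∑ k ∈ range (a + 1), ((a + b - k).choose b * v ^ (a + b + 1 - k)) * pole x s ^ (k + 1))
        * (∑ k ∈ range (b + 1), ((a + b - k).choose a * v' ^ (a + b + 1 - k)) * pole y (-(ξ - s)) ^ (k + 1))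
      + (∑ k ∈ range (b + 1), ((a + b - k).choose a * v ^ (a + b + 1 - k)) * pole y (ξ - s) ^ (k + 1))
        * (∑ k ∈ range (a + 1), ((a + b - k).choose b * v' ^ (a + b + 1 - k)) * pole x (-s) ^ (k + 1))) := by
    intro s
    rw [lorentz_eq_pole, lorentz_eq_pole]
    have e1 := pow_mul_pow_eq_partialFractions (rel1 s) a b
    have e2 := pow_mul_pow_eq_partialFractions (rel2 s) a b
    have q : ∀ (n : ℕ) (A : ℕ → ℕ) (f V : ℂ), ∑ k ∈ range n, (A k : ℂ) * (f ^ (k + 1) * V ^ (a + b + 1 - k))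
        = ∑ k ∈ range n, ((A k) * V ^ (a + b + 1 - k)) * f ^ (k + 1) := fun n A f V =>
      sum_congr rfl fun k _ => by ring
    rw [q, q] at e1 e2
    rw [show pole x s ^ (a + 1) * pole x (-s) ^ (a + 1) * (pole y (ξ - s) ^ (b + 1) * pole y (-(ξ - s)) ^ (b + 1))
      = (pole x s ^ (a + 1) * pole y (ξ - s) ^ (b + 1)) * (pole x (-s) ^ (a + 1) * pole y (-(ξ - s)) ^ (b + 1)) by ring,
      e1, e2]
    ring
  simp only [expand]
  have m1 := main (a + 1) (a + 1) (fun k => (a + b - k).choose b * v ^ (a + b + 1 - k))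
    (fun k => (a + b - k).choose b * v' ^ (a + b + 1 - k)) _ _ _ j1 i1
  have m2 := main (b + 1) (b + 1) (fun k => (a + b - k).choose a * v ^ (a + b + 1 - k))
    (fun k => (a + b - k).choose a * v' ^ (a + b + 1 - k)) _ _ _ j2 i2
  have m3 := main (a + 1) (b + 1) (fun k => (a + b - k).choose b * v ^ (a + b + 1 - k))
    (fun k => (a + b - k).choose a * v' ^ (a + b + 1 - k)) _ _ _ j3 i3
  have m4 := main (b + 1) (a + 1) (fun k => (a + b - k).choose a * v ^ (a + b + 1 - k))
    (fun k => (a + b - k).choose b * v' ^ (a + b + 1 - k)) _ _ _ j4 i4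
  have four : ∀ f₁ f₂ f₃ f₄ : ℝ → ℂ, Integrable f₁ → Integrable f₂ → Integrable f₃ → Integrable f₄ →
      ∫ s, (f₁ s + f₂ s + (f₃ s + f₄ s)) = (∫ s, f₁ s) + (∫ s, f₂ s) + ((∫ s, f₃ s) + ∫ s, f₄ s) := by
    intro f₁ f₂ f₃ f₄ h₁ h₂ h₃ h₄
    rw [← integral_add h₁ h₂, ← integral_add h₃ h₄]
    exact integral_add (h₁.add h₂) (h₃.add h₄)
  rw [four _ _ _ _ m1.1 m2.1 m3.1 m4.1, m1.2, m2.2, m3.2, m4.2]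
  simp only [mul_zero, sum_const_zero, add_zero]
  congr 1
  · refine sum_congr rfl fun k _ => sum_congr rfl fun l _ => ?_
    push_cast; ring
  · refine sum_congr rfl fun k _ => sum_congr rfl fun l _ => ?_
    push_cast; ring

/-- One half of the triple integral of Bessel kernels. -/
noncomputable def tripleHalf (a b c : ℕ) (x z : ℝ) : ℝ :=
  ∑ k ∈ Icc 1 a, ∑ l ∈ Icc 1 a, (((a + b - k - 1).choose (b - 1) * (a + b - l - 1).choose (b - 1)
      * (k + l - 2).choose (k - 1) * (2 * (a + b + c) - k - l - 2).choose (a + b + c - k - 1) : ℕ) : ℝ)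
    * ((2 * Real.pi) ^ 2 * ((2 * x)⁻¹) ^ (k + l - 1) * ((2 * z)⁻¹) ^ (2 * (a + b + c) - k - l - 1))

/-- The relation z = x + y is decisive: the convolution of the first two Lorentzians has its poles
at the same parameter x + y as the third, so the product only raises exponents and a single two-pole
integral evaluates each term. -/
theorem integral_besselKernel_triple {a b c : ℕ} (ha : 1 ≤ a) (hb : 1 ≤ b) (hc : 1 ≤ c)
    {x y : ℝ} (hx : 0 < x) (hy : 0 < y) :
    2 * ∫ t in Set.Ioi 0, besselKernel a x t * (besselKernel b y t * besselKernel c (x + y) t)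
      = tripleHalf a b c x (x + y) + tripleHalf b a c y (x + y) := by
  have hz : 0 < x + y := by positivity
  apply Complex.ofReal_injective
  rw [integral_besselKernel_mul ha hb hc hx hy hz]
  obtain ⟨a, rfl⟩ : ∃ m, a = m + 1 := ⟨a - 1, by omega⟩
  obtain ⟨b, rfl⟩ : ∃ m, b = m + 1 := ⟨b - 1, by omega⟩
  simp only [integral_lorentz_mul_lorentz hx hy, add_mul, sum_mul]
  set z := x + y
  have hzp : 0 < (z : ℂ).re := by simpa
  have key : ∀ (A : ℂ) (k l : ℕ), k < a + b + 1 → l < a + b + 1 →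
      Integrable (fun ξ => A * (pole z ξ ^ (a + b + 1 - k) * pole z (-ξ) ^ (a + b + 1 - l)) * lorentz c z ξ) ∧
      ∫ ξ, A * (pole z ξ ^ (a + b + 1 - k) * pole z (-ξ) ^ (a + b + 1 - l)) * lorentz c z ξ
        = A * (2 * Real.pi * (2 * (a + b + c) - k - l).choose (a + b + c - k)
          * ((2 * z)⁻¹) ^ (2 * (a + b + c) - k - l + 1)) := by
    intro A k l hk hl
    have e : ∀ ξ, A * (pole z ξ ^ (a + b + 1 - k) * pole z (-ξ) ^ (a + b + 1 - l)) * lorentz c z ξ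
        = A * (pole z ξ ^ (a + b + c - k + 1) * pole z (-ξ) ^ (a + b + c - l + 1)) := by
      intro ξ
      rw [lorentz_eq_pole, show a + b + c - k + 1 = a + b + 1 - k + c by omega,
        show a + b + c - l + 1 = a + b + 1 - l + c by omega]
      ring
    simp only [e]
    refine ⟨(integrable_pow_mul_pow (continuous_pole hzp) ((continuous_pole hzp).comp continuous_neg)
      (norm_pole_le hzp) (norm_pole_neg_le hzp) (by omega)).const_mul _, ?_⟩
    rw [integral_const_mul, integral_pole_pow_mul_pole_neg_pow hz,
      show a + b + c - k + (a + b + c - l) = 2 * (a + b + c) - k - l by omega]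
  have main : ∀ (m : ℕ) (A : ℕ → ℕ → ℂ), m ≤ a + b + 1 →
      Integrable (fun ξ => ∑ k ∈ range m, ∑ l ∈ range m,
        A k l * (pole z ξ ^ (a + b + 1 - k) * pole z (-ξ) ^ (a + b + 1 - l)) * lorentz c z ξ) ∧
      ∫ ξ, ∑ k ∈ range m, ∑ l ∈ range m,
        A k l * (pole z ξ ^ (a + b + 1 - k) * pole z (-ξ) ^ (a + b + 1 - l)) * lorentz c z ξ
        = ∑ k ∈ range m, ∑ l ∈ range m, A k l * (2 * Real.pi * (2 * (a + b + c) - k - l).choose (a + b + c - k)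
          * ((2 * z)⁻¹) ^ (2 * (a + b + c) - k - l + 1)) := by
    intro m A hm
    have i1 : ∀ k ∈ range m, ∀ l ∈ range m, Integrable (fun ξ =>
        A k l * (pole z ξ ^ (a + b + 1 - k) * pole z (-ξ) ^ (a + b + 1 - l)) * lorentz c z ξ) :=
      fun k hk l hl => (key _ k l (by simp at hk; omega) (by simp at hl; omega)).1
    have i2 : ∀ k ∈ range m, Integrable (fun ξ => ∑ l ∈ range m,
        A k l * (pole z ξ ^ (a + b + 1 - k) * pole z (-ξ) ^ (a + b + 1 - l)) * lorentz c z ξ) :=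
      fun k hk => integrable_finsetSum _ (i1 k hk)
    refine ⟨integrable_finsetSum _ i2, ?_⟩
    rw [integral_finsetSum _ i2]
    refine sum_congr rfl fun k hk => ?_
    rw [integral_finsetSum _ (i1 k hk)]
    exact sum_congr rfl fun l hl => (key _ k l (by simp at hk; omega) (by simp at hl; omega)).2
  have m1 := main (a + 1) (fun k l => (((a + b - k).choose b * (a + b - l).choose b : ℕ) : ℂ)
          * (2 * Real.pi * (k + l).choose k * ((2 * x)⁻¹) ^ (k + l + 1))) (by omega)
  have m2 := main (b + 1) (fun k l => (((a + b - k).choose a * (a + b - l).choose a : ℕ) : ℂ)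
          * (2 * Real.pi * (k + l).choose k * ((2 * y)⁻¹) ^ (k + l + 1))) (by omega)
  rw [integral_add m1.1 m2.1, m1.2, m2.2]
  have shift : ∀ (m : ℕ) (f : ℕ → ℕ → ℝ), ∑ k ∈ Icc 1 (m + 1), ∑ l ∈ Icc 1 (m + 1), f k l
      = ∑ k ∈ range (m + 1), ∑ l ∈ range (m + 1), f (k + 1) (l + 1) := by
    intro m f
    have s1 : ∀ g : ℕ → ℝ, ∑ k ∈ Icc 1 (m + 1), g k = ∑ k ∈ range (m + 1), g (k + 1) := by
      intro g
      rw [range_eq_Ico, sum_Ico_add' g 0 (m + 1) 1]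
      rfl
    rw [s1]
    exact sum_congr rfl fun k _ => s1 _
  unfold tripleHalf
  rw [shift, shift]
  push_cast
  congr 1
  · refine sum_congr rfl fun k hk => sum_congr rfl fun l hl => ?_
    simp only [mem_range] at hk hl
    rw [show a + 1 + (b + 1) - (k + 1) - 1 = a + b - k by omega,
      show a + 1 + (b + 1) - (l + 1) - 1 = a + b - l by omega,
      show k + 1 + (l + 1) - 2 = k + l by omega, show k + 1 + (l + 1) - 1 = k + l + 1 by omega,
      show 2 * (a + 1 + (b + 1) + c) - (k + 1) - (l + 1) - 2 = 2 * (a + b + c) - k - l by omega,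
      show a + 1 + (b + 1) + c - (k + 1) - 1 = a + b + c - k by omega,
      show 2 * (a + 1 + (b + 1) + c) - (k + 1) - (l + 1) - 1 = 2 * (a + b + c) - k - l + 1 by omega]
    ring
  · refine sum_congr rfl fun k hk => sum_congr rfl fun l hl => ?_
    simp only [mem_range] at hk hl
    rw [show b + 1 + (a + 1) - (k + 1) - 1 = a + b - k by omega,
      show b + 1 + (a + 1) - (l + 1) - 1 = a + b - l by omega,
      show k + 1 + (l + 1) - 2 = k + l by omega, show k + 1 + (l + 1) - 1 = k + l + 1 by omega,
      show 2 * (b + 1 + (a + 1) + c) - (k + 1) - (l + 1) - 2 = 2 * (a + b + c) - k - l by omega,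
      show b + 1 + (a + 1) + c - (k + 1) - 1 = a + b + c - k by omega,
      show 2 * (b + 1 + (a + 1) + c) - (k + 1) - (l + 1) - 1 = 2 * (a + b + c) - k - l + 1 by omega]
    ring

theorem summable_one_div_sq_mul_sq :
    Summable fun p : ℕ+ × ℕ+ => 1 / (p.1 : ℝ) ^ 2 * (1 / (p.2 : ℝ) ^ 2) := by
  have h := (hasSum_zeta (s := 2) le_rfl).summable
  exact h.mul_of_nonneg h (fun _ => by positivity) (fun _ => by positivity)

theorem hasSum_doubleZeta {s t : ℕ} (hs : 3 ≤ s) (ht : 1 ≤ t) :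
    HasSum (fun p : ℕ+ × ℕ+ => 1 / (((p.1 : ℝ) + (p.2 : ℝ)) ^ s * (p.2 : ℝ) ^ t)) (doubleZeta s t) := by
  refine (Summable.of_nonneg_of_le (fun _ => by positivity) (fun p => ?_) summable_one_div_sq_mul_sq).hasSum
  have h1 : (1 : ℝ) ≤ p.1 := by exact_mod_cast p.1.pos
  have h2 : (1 : ℝ) ≤ p.2 := by exact_mod_cast p.2.pos
  rw [one_div_mul_one_div]
  refine one_div_le_one_div_of_le (by positivity) ?_
  calc (p.1 : ℝ) ^ 2 * (p.2 : ℝ) ^ 2 ≤ ((p.1 : ℝ) + p.2) ^ 3 * (p.2 : ℝ) ^ 1 := by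
        have : 0 ≤ (p.1 : ℝ) * p.2 * ((p.1 : ℝ) ^ 2 + 2 * p.1 * p.2 + 3 * (p.2 : ℝ) ^ 2) := by positivity
        nlinarith [pow_pos (zero_lt_one.trans_le h2) 4, pow_pos (zero_lt_one.trans_le h1) 3,
          mul_pos (zero_lt_one.trans_le h2) (pow_pos (zero_lt_one.trans_le h1) 3),
          mul_pos (zero_lt_one.trans_le h1) (pow_pos (zero_lt_one.trans_le h2) 3),
          mul_pos (pow_pos (zero_lt_one.trans_le h1) 2) (pow_pos (zero_lt_one.trans_le h2) 2)]
    _ ≤ _ := by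
        gcongr
        · linarith

theorem hasSum_tripleHalf {a b c : ℕ} (ha : 1 ≤ a) (hb : 1 ≤ b) (hc : 1 ≤ c) {y : ℝ} (hy : 0 < y) :
    HasSum (fun p : ℕ+ × ℕ+ => (y / Real.pi) ^ (a + b + c)
      * tripleHalf a b c (p.2 * y) (((p.1 : ℝ) + p.2) * y))
      (Z a b c * (4 * Real.pi * y) ^ (2 - ((a + b + c : ℕ) : ℤ))) := by
  have hp := Real.pi_pos
  set Y := 4 * Real.pi * y with hY
  have Y0 : 0 < Y := by positivity
  have h1 : ∀ p : ℕ+ × ℕ+, (y / Real.pi) ^ (a + b + c)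
      * tripleHalf a b c (p.2 * y) (((p.1 : ℝ) + p.2) * y)
      = (∑ k ∈ Icc 1 a, ∑ l ∈ Icc 1 a, (((a + b - k - 1).choose (b - 1) * (a + b - l - 1).choose (b - 1)
      * (k + l - 2).choose (k - 1) * (2 * (a + b + c) - k - l - 2).choose (a + b + c - k - 1) : ℕ) : ℝ)
      * (1 / (((p.1 : ℝ) + (p.2 : ℝ)) ^ (2 * (a + b + c) - k - l - 1) * (p.2 : ℝ) ^ (k + l - 1))))
      * Y ^ (2 - ((a + b + c : ℕ) : ℤ)) := by
    intro p
    have h1 : (0 : ℝ) < p.1 := by exact_mod_cast p.1.pos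
    have h2 : (0 : ℝ) < p.2 := by exact_mod_cast p.2.pos
    unfold tripleHalf
    rw [mul_sum, sum_mul]
    refine sum_congr rfl fun k hk => ?_
    rw [mul_sum, sum_mul]
    refine sum_congr rfl fun l hl => ?_
    simp only [mem_Icc] at hk hl
    set w := a + b + c with hw
    have e1 : Y ^ (2 - (w : ℤ)) = Y ^ w * (Y⁻¹) ^ (2 * w - 2) := by
      rw [inv_pow, ← zpow_natCast, ← zpow_natCast, ← zpow_neg, ← zpow_add₀ Y0.ne']
      congr 1
      omega
    have e3 : (y / Real.pi) ^ w = Y ^ w / (4 * Real.pi ^ 2) ^ w := by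
      rw [← div_pow]; congr 1; rw [hY]; field_simp
    have e4 : (2 * ((p.2 : ℝ) * y))⁻¹ = 2 * Real.pi * Y⁻¹ * (p.2 : ℝ)⁻¹ := by
      rw [hY]; field_simp; ring
    have e5 : (2 * (((p.1 : ℝ) + p.2) * y))⁻¹ = 2 * Real.pi * Y⁻¹ * ((p.1 : ℝ) + p.2)⁻¹ := by
      rw [hY]; field_simp; ring
    have e6 : (4 * Real.pi ^ 2) ^ w = (2 * Real.pi) ^ 2 * (2 * Real.pi) ^ (2 * w - 2) := by
      rw [← pow_add, show 4 * Real.pi ^ 2 = (2 * Real.pi) ^ 2 by ring, ← pow_mul]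
      congr 1; omega
    have e7 : ∀ x : ℝ, x ^ (2 * w - 2) = x ^ (k + l - 1) * x ^ (2 * w - k - l - 1) := by
      intro x
      rw [← pow_add]; congr 1; omega
    rw [e1, e3, e4, e5, e6, mul_pow _ ((p.2 : ℝ)⁻¹), mul_pow _ (((p.1 : ℝ) + p.2)⁻¹), mul_pow (2 * Real.pi) Y⁻¹,
      mul_pow (2 * Real.pi) Y⁻¹, e7 Y⁻¹, e7 (2 * Real.pi), inv_pow, inv_pow, inv_pow, inv_pow]
    field_simp
  simp only [h1]
  refine HasSum.mul_right _ (hasSum_sum fun k hk => hasSum_sum fun l hl => HasSum.mul_left _ ?_)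
  simp only [mem_Icc] at hk hl
  exact hasSum_doubleZeta (by omega) (by omega)

/-- The two halves of the triple integral are exchanged by swapping the roles of the first two
momenta, whence Z a b c + Z b a c. -/
theorem hasSum_triple {a b c : ℕ} (ha : 1 ≤ a) (hb : 1 ≤ b) (hc : 1 ≤ c) {y : ℝ} (hy : 0 < y) :
    HasSum (fun p : ℕ+ × ℕ+ => (y / Real.pi) ^ (a + b + c)
      * (2 * ∫ t in Set.Ioi 0, besselKernel a (p.1 * y) t
        * (besselKernel b (p.2 * y) t * besselKernel c (((p.1 : ℝ) + p.2) * y) t)))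
      ((Z a b c + Z b a c) * (4 * Real.pi * y) ^ (2 - ((a + b + c : ℕ) : ℤ))) := by
  have h1 : ∀ p : ℕ+ × ℕ+, (y / Real.pi) ^ (a + b + c)
      * (2 * ∫ t in Set.Ioi 0, besselKernel a (p.1 * y) t
        * (besselKernel b (p.2 * y) t * besselKernel c (((p.1 : ℝ) + p.2) * y) t))
      = (y / Real.pi) ^ (a + b + c) * tripleHalf a b c (p.1 * y) (((p.1 : ℝ) + p.2) * y)
        + (y / Real.pi) ^ (a + b + c) * tripleHalf b a c (p.2 * y) (((p.1 : ℝ) + p.2) * y) := by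
    intro p
    have h1 : (0 : ℝ) < p.1 := by exact_mod_cast p.1.pos
    have h2 : (0 : ℝ) < p.2 := by exact_mod_cast p.2.pos
    rw [← mul_add, add_mul (p.1 : ℝ), integral_besselKernel_triple ha hb hc (by positivity) (by positivity)]
  simp only [h1, add_mul (Z a b c)]
  refine HasSum.add ?_ ?_
  · have := (Equiv.prodComm ℕ+ ℕ+).hasSum_iff.2 (hasSum_tripleHalf ha hb hc hy)
    convert this using 2 with p
    simp only [Function.comp, Equiv.prodComm_apply, Prod.fst_swap, Prod.snd_swap]
    rw [add_comm (p.1 : ℝ)]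
  · have := hasSum_tripleHalf hb ha hc hy
    rwa [add_comm b a] at this

/-! ### The row n = 0: sums over the integers and the leading coefficient -/

theorem hasSum_of_hasSum_of_eq {ι M : Type*} [AddCommMonoid M] [TopologicalSpace M] {f : ι → M} {s t : M}
    (h : HasSum f s) (e : s = t) : HasSum f t := e ▸ h

/-- With 0⁻¹ = 0 the telescoping sum over ℤ remains valid: each half-line sums to 0. -/
theorem hasSum_int_inv_succ_sub_inv : HasSum (fun n : ℤ => ((n : ℝ) + 1)⁻¹ - (n : ℝ)⁻¹) 0 := by
  have h1 : HasSum (fun n : ℕ => ((n : ℝ) + 1)⁻¹ - ((n : ℝ) + 1 + 1)⁻¹) 1 := by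
    refine (hasSum_iff_tendsto_nat_of_nonneg (fun n => ?_) 1).2 ?_
    · rw [sub_nonneg]
      exact inv_anti₀ (by positivity) (by linarith)
    · have e : ∀ N : ℕ, ∑ n ∈ range N, (((n : ℝ) + 1)⁻¹ - ((n : ℝ) + 1 + 1)⁻¹) = 1 - ((N : ℝ) + 1)⁻¹ := by
        intro N
        have := Finset.sum_range_sub' (fun n : ℕ => ((n : ℝ) + 1)⁻¹) N
        push_cast at this
        simpa using this
      simp only [e]
      have := (tendsto_one_div_add_atTop_nhds_zero_nat (𝕜 := ℝ)).const_sub 1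
      simpa using this
  have h2 : HasSum (fun n : ℕ => ((n : ℝ) + 1)⁻¹ - (n : ℝ)⁻¹) 0 := by
    refine (hasSum_nat_add_iff' 1).1 ?_
    have := h1.neg
    convert this using 2 with n
    · push_cast; ring
    · simp
  have h3 : HasSum (fun n : ℕ => (((-((n : ℤ) + 1) : ℤ) : ℝ) + 1)⁻¹ - ((-((n : ℤ) + 1) : ℤ) : ℝ)⁻¹) 0 := by
    convert h2 using 2 with n
    push_cast
    rw [show -((n : ℝ) + 1) + 1 = -(n : ℝ) by ring, inv_neg, inv_neg]
    ring
  have := HasSum.of_nat_of_neg_add_one (f := fun n : ℤ => ((n : ℝ) + 1)⁻¹ - (n : ℝ)⁻¹) (by simpa using h2) h3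
  simpa using this

/-- The simple-pole terms of the partial fractions converge only in this combination. For m = 0 they
cancel termwise, and a change of m by one adds a telescoping series of sum 0. -/
theorem hasSum_int_inv_add_inv_sub (m : ℤ) : HasSum (fun n : ℤ => (n : ℝ)⁻¹ + ((m : ℝ) - n)⁻¹) 0 := by
  have hd : ∀ k : ℤ, HasSum (fun n : ℤ => ((k : ℝ) - n + 1)⁻¹ - ((k : ℝ) - n)⁻¹) 0 := by
    intro k
    have := (Equiv.subLeft k).hasSum_iff.2 hasSum_int_inv_succ_sub_inv
    convert this using 2 with n
    simp
  induction m using Int.induction_on with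
  | zero =>
    simp [inv_neg, hasSum_zero]
  | succ m ih =>
    have := ih.add (hd m)
    rw [add_zero] at this
    refine this.congr_fun fun n => ?_
    push_cast
    rw [show (m : ℝ) + 1 - n = m - n + 1 by ring]
    ring
  | pred m ih =>
    have := ih.sub (hd (-m - 1))
    rw [sub_zero] at this
    refine this.congr_fun fun n => ?_
    push_cast
    rw [show (-m : ℝ) - 1 - n + 1 = -m - n by ring]
    ring

/-- The sum `∑_{n ≠ 0} n⁻ʲ`, regularized by `0` for `j = 1` and by `-1` for `j = 0`. -/
noncomputable def evenPowSum (j : ℕ) : ℝ :=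
  if Even j then (-1) ^ (j / 2 + 1) * (2 * Real.pi) ^ j * (bernoulli j : ℝ) / j.factorial else 0

theorem hasSum_int_inv_pow {j : ℕ} (hj : 2 ≤ j) : HasSum (fun n : ℤ => ((n : ℝ)⁻¹) ^ j) (evenPowSum j) := by
  unfold evenPowSum
  split_ifs with h
  · obtain ⟨k, rfl⟩ := h
    rw [← two_mul] at hj ⊢
    have h1 := hasSum_zeta_nat (k := k) (by omega)
    have h2 := HasSum.of_nat_of_neg (f := fun n : ℤ => ((n : ℝ)⁻¹) ^ (2 * k)) (by simpa using h1)
      (by simpa [(even_two_mul k).neg_pow, inv_neg] using h1)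
    refine hasSum_of_hasSum_of_eq h2 ?_
    rw [show 2 * k / 2 = k by omega]
    have : (2 : ℝ) ^ (2 * k) = 2 ^ (2 * k - 1) * 2 := by rw [← pow_succ]; congr 1; omega
    rw [mul_pow, this]
    simp
    rw [zero_pow (by omega)]
    ring
  · have ho : Odd j := Nat.not_even_iff_odd.1 h
    have h1 : Summable fun n : ℕ => ((n : ℝ)⁻¹) ^ j := by
      simpa using Real.summable_nat_pow_inv.2 (by omega : 1 < j)
    have h2 := HasSum.of_nat_of_neg (f := fun n : ℤ => ((n : ℝ)⁻¹) ^ j) (by simpa using h1.hasSum)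
      (by simpa [ho.neg_pow, inv_neg] using h1.hasSum.neg)
    refine hasSum_of_hasSum_of_eq h2 ?_
    simp
    omega

/-- The inner sum, over pairs of integers with given nonzero sum. -/
theorem hasSum_int_inv_pow_mul_inv_pow {b c : ℕ} {m : ℤ} (hm : m ≠ 0) :
    HasSum (fun n : ℤ => ((n : ℝ)⁻¹) ^ (b + 1) * (((m : ℝ) - n)⁻¹) ^ (c + 1))
      ((∑ j ∈ range (b + 2), if j = 1 then 0 else (b + c + 1 - j).choose c * (evenPowSum j * ((m : ℝ)⁻¹) ^ (b + c + 2 - j)))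
      + ∑ j ∈ range (c + 2), if j = 1 then 0 else (b + c + 1 - j).choose b * (evenPowSum j * ((m : ℝ)⁻¹) ^ (b + c + 2 - j))) := by
  set v := (m : ℝ)⁻¹ with hv
  have m0 : (m : ℝ) ≠ 0 := by exact_mod_cast hm
  -- the partial fractions
  set P : ℝ → ℝ → ℝ := fun u w => ∑ i ∈ range (b + 1), (b + c - i).choose c * (u ^ (i + 1) * v ^ (b + c + 1 - i))
    + ∑ i ∈ range (c + 1), (b + c - i).choose b * (w ^ (i + 1) * v ^ (b + c + 1 - i)) with hP
  have hsum : ∀ N k : ℕ, ∑ i ∈ range (N + 1), ((N + k - i).choose k : ℝ) = (N + k + 1).choose (k + 1) := by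
    intro N k
    have h1 := Finset.sum_range_reflect (fun i => ((k + i).choose k : ℝ)) (N + 1)
    have h2 : ∑ i ∈ range (N + 1), (k + i).choose k = (N + k + 1).choose (k + 1) := by
      rw [← Nat.sum_range_add_choose N k]
      exact sum_congr rfl fun i _ => by rw [add_comm]
    rw [← h2]
    push_cast
    rw [← h1]
    refine sum_congr rfl fun i hi => ?_
    simp only [mem_range] at hi
    rw [show k + (N + 1 - 1 - i) = N + k - i by omega]
  -- At n = 0 and n = m the left side is 0 by the convention 0⁻¹ = 0, while the partial fraction
  -- expression is not; the two point masses correct for this.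
  have hf : ∀ n : ℤ, ((n : ℝ)⁻¹) ^ (b + 1) * (((m : ℝ) - n)⁻¹) ^ (c + 1)
      = P (n : ℝ)⁻¹ ((m : ℝ) - n)⁻¹ - ((if n = 0 then ((b + c + 1).choose (b + 1) : ℝ) * v ^ (b + c + 2) else 0)
        + if n = m then ((b + c + 1).choose (c + 1) : ℝ) * v ^ (b + c + 2) else 0) := by
    intro n
    by_cases h0 : n = 0
    · subst h0
      rw [if_pos rfl, if_neg (Ne.symm hm), hP]
      simp only [Int.cast_zero, inv_zero, sub_zero, add_zero, zero_pow (Nat.succ_ne_zero _), zero_mul, mul_zero,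
        sum_const_zero, zero_add, ← hv]
      rw [add_comm b c, ← hsum, sum_mul, eq_comm, sub_eq_zero]
      refine sum_congr rfl fun i hi => ?_
      simp only [mem_range] at hi
      rw [← pow_add]
      congr 2; omega
    by_cases h1 : n = m
    · subst h1
      rw [if_neg h0, if_pos rfl, hP]
      simp only [sub_self, inv_zero, zero_add, zero_pow (Nat.succ_ne_zero _), zero_mul, mul_zero,
        sum_const_zero, add_zero, ← hv]
      rw [← hsum, sum_mul, eq_comm, sub_eq_zero]
      refine sum_congr rfl fun i hi => ?_
      simp only [mem_range] at hi
      rw [← pow_add]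
      congr 2; omega
    · rw [if_neg h0, if_neg h1, add_zero, sub_zero]
      have n0 : (n : ℝ) ≠ 0 := by exact_mod_cast h0
      have n1 : (m : ℝ) - n ≠ 0 := sub_ne_zero.2 (by exact_mod_cast Ne.symm h1)
      refine pow_mul_pow_eq_partialFractions ?_ b c
      rw [hv]; field_simp; ring
  have hu : ∀ j, 2 ≤ j → HasSum (fun n : ℤ => ((n : ℝ)⁻¹) ^ j) (evenPowSum j) := fun j hj => hasSum_int_inv_pow hj
  have hw : ∀ j, 2 ≤ j → HasSum (fun n : ℤ => (((m : ℝ) - n)⁻¹) ^ j) (evenPowSum j) := fun j hj => by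
    have := (Equiv.subLeft m).hasSum_iff.2 (hu j hj)
    simpa [Function.comp_def] using this
  have hPsum : HasSum (fun n : ℤ => P (n : ℝ)⁻¹ ((m : ℝ) - n)⁻¹)
      (∑ i ∈ range b, (b + c - (i + 1)).choose c * (evenPowSum (i + 2) * v ^ (b + c - i))
      + ∑ i ∈ range c, (b + c - (i + 1)).choose b * (evenPowSum (i + 2) * v ^ (b + c - i))) := by
    have e : ∀ n : ℤ, P (n : ℝ)⁻¹ ((m : ℝ) - n)⁻¹
        = (b + c).choose b * v ^ (b + c + 1) * ((n : ℝ)⁻¹ + ((m : ℝ) - n)⁻¹)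
        + (∑ i ∈ range b, (b + c - (i + 1)).choose c * (((n : ℝ)⁻¹) ^ (i + 2) * v ^ (b + c - i))
        + ∑ i ∈ range c, (b + c - (i + 1)).choose b * ((((m : ℝ) - n)⁻¹) ^ (i + 2) * v ^ (b + c - i))) := by
      intro n
      simp only [hP]
      rw [sum_range_succ', sum_range_succ']
      simp only [Nat.sub_zero, zero_add, pow_one, add_assoc, Nat.reduceAdd]
      rw [show (b + c).choose c = (b + c).choose b from Nat.choose_symm_add.symm]
      have : ∀ i, b + (c + 1) - (i + 1) = b + c - i := fun i => by omega
      simp only [this]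
      ring
    simp only [e]
    have := ((hasSum_int_inv_add_inv_sub m).mul_left ((b + c).choose b * v ^ (b + c + 1))).add
      ((hasSum_sum fun i (_ : i ∈ range b) => ((hu (i + 2) (by omega)).mul_right (v ^ (b + c - i))).mul_left
        ((b + c - (i + 1)).choose c : ℝ)).add
      (hasSum_sum fun i (_ : i ∈ range c) => ((hw (i + 2) (by omega)).mul_right (v ^ (b + c - i))).mul_left
        ((b + c - (i + 1)).choose b : ℝ)))
    rwa [mul_zero, zero_add] at this
  have hδ : ∀ (k : ℤ) (A : ℝ), HasSum (fun n : ℤ => if n = k then A else 0) A := fun k A => hasSum_ite_eq k A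
  simp only [hf]
  have := hPsum.sub ((hδ 0 (((b + c + 1).choose (b + 1) : ℝ) * v ^ (b + c + 2))).add
    (hδ m (((b + c + 1).choose (c + 1) : ℝ) * v ^ (b + c + 2))))
  refine hasSum_of_hasSum_of_eq this ?_
  -- With this value the j = 0 terms of the two sums are exactly the point masses, so no correction
  -- appears in the final formula.
  have e0 : evenPowSum 0 = -1 := by simp [evenPowSum]
  have hs : ∀ N k : ℕ, ∑ j ∈ range (N + 2), (if j = 1 then 0 else ((b + c + 1 - j).choose k : ℝ)
        * (evenPowSum j * v ^ (b + c + 2 - j)))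
      = (∑ i ∈ range N, ((b + c - (i + 1)).choose k : ℝ) * (evenPowSum (i + 2) * v ^ (b + c - i)))
        - (b + c + 1).choose k * v ^ (b + c + 2) := by
    intro N k
    rw [sum_range_succ', sum_range_succ']
    simp only [zero_add, if_true, add_zero, Nat.sub_zero, e0, zero_ne_one, if_false]
    rw [show ∀ A B : ℝ, A * (-1 * B) = -(A * B) by intros; ring, ← sub_eq_add_neg]
    congr 1
    refine sum_congr rfl fun i _ => ?_
    rw [if_neg (by omega), show b + c + 1 - (i + 1 + 1) = b + c - (i + 1) by omega,
      show b + c + 2 - (i + 1 + 1) = b + c - i by omega]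
  rw [hs, hs]
  have c1 : (b + c + 1).choose (b + 1) = (b + c + 1).choose c := by
    rw [← Nat.choose_symm_of_eq_add (show b + c + 1 = (b + 1) + c by ring)]
  have c2 : (b + c + 1).choose (c + 1) = (b + c + 1).choose b := by
    rw [← Nat.choose_symm_of_eq_add (show b + c + 1 = (c + 1) + b by ring)]
  rw [c1, c2]
  ring

theorem lorentz_zero (a : ℕ) (ξ : ℝ) : lorentz a 0 ξ = (ξ⁻¹) ^ (2 * a) := by
  unfold lorentz
  rw [pow_mul, inv_pow]; simp

theorem sum_range_two_mul_add_one {M : Type*} [AddCommMonoid M] (G : ℕ → M) (m : ℕ)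
    (h : ∀ j, G (2 * j + 1) = 0) : ∑ p ∈ range (2 * m + 1), G p = ∑ j ∈ range (m + 1), G (2 * j) := by
  induction m with
  | zero => simp
  | succ m ih =>
    rw [show 2 * (m + 1) + 1 = 2 * m + 1 + 1 + 1 by ring, sum_range_succ, sum_range_succ, ih, h,
      sum_range_succ (n := m + 1), add_zero]
    rfl

theorem abs_inv_intCast_le_one (n : ℤ) : |((n : ℝ))⁻¹| ≤ 1 := by
  rw [abs_inv]
  by_cases h : n = 0
  · simp [h]
  · refine inv_le_one_of_one_le₀ ?_
    exact_mod_cast Int.one_le_abs h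

theorem lorentz_zero_intCast_le_one (c : ℕ) (n : ℤ) : lorentz c 0 n ≤ 1 := by
  rw [lorentz_zero, pow_mul]
  refine pow_le_one₀ (by positivity) ?_
  rw [← sq_abs]
  exact pow_le_one₀ (abs_nonneg _) (abs_inv_intCast_le_one n)

theorem summable_lorentz_zero_triple {a b : ℕ} (ha : 1 ≤ a) (hb : 1 ≤ b) (c : ℕ) :
    Summable fun p : ℤ × ℤ => lorentz a 0 p.1 * lorentz b 0 p.2 * lorentz c 0 (-p.1 - p.2) := by
  have h1 : ∀ {a : ℕ}, 1 ≤ a → Summable fun n : ℤ => lorentz a 0 n := fun {a} ha => by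
    simp only [lorentz_zero]
    exact (hasSum_int_inv_pow (by omega)).summable
  refine Summable.of_nonneg_of_le (fun p => ?_) (fun p => ?_)
    ((h1 ha).mul_of_nonneg (h1 hb) (fun _ => lorentz_nonneg _ _ _) (fun _ => lorentz_nonneg _ _ _))
  · have := lorentz_nonneg
    exact mul_nonneg (mul_nonneg (this _ _ _) (this _ _ _)) (this _ _ _)
  · have h2 := lorentz_zero_intCast_le_one c (-p.1 - p.2)
    push_cast at h2
    exact mul_le_of_le_one_right (mul_nonneg (lorentz_nonneg _ _ _) (lorentz_nonneg _ _ _)) h2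

/-- For fixed m ≠ 0 the inner sum is a combination of negative powers of m with even-zeta
coefficients; summing over m supplies the second Bernoulli factor. Odd j contribute nothing, which
leaves the index 2k of `topTerm`. -/
theorem hasSum_lorentz_zero_triple {a b c : ℕ} (ha : 1 ≤ a) (hb : 1 ≤ b) (hc : 1 ≤ c) :
    HasSum (fun p : ℤ × ℤ => lorentz a 0 p.1 * lorentz b 0 p.2 * lorentz c 0 (-p.1 - p.2))
      ((-1) ^ (a + b + c) * (2 * Real.pi) ^ (2 * (a + b + c))
        * ((topTerm (a + b + c) b c + topTerm (a + b + c) c b : ℚ) : ℝ)) := by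
  have hfib : ∀ m : ℤ, HasSum (fun n : ℤ => lorentz a 0 m * lorentz b 0 n * lorentz c 0 (-(m : ℝ) - n))
      (((m : ℝ)⁻¹) ^ (2 * a) *
      ((∑ j ∈ range (2 * b + 1), if j = 1 then 0 else (2 * b + 2 * c - 1 - j).choose (2 * c - 1)
        * (evenPowSum j * ((m : ℝ)⁻¹) ^ (2 * b + 2 * c - j)))
      + ∑ j ∈ range (2 * c + 1), if j = 1 then 0 else (2 * b + 2 * c - 1 - j).choose (2 * b - 1)
        * (evenPowSum j * ((m : ℝ)⁻¹) ^ (2 * b + 2 * c - j)))) := by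
    intro m
    by_cases hm : m = 0
    · subst hm
      simp [lorentz_zero, zero_pow (show 2 * a ≠ 0 by omega), hasSum_zero]
    have h1 := (hasSum_int_inv_pow_mul_inv_pow (b := 2 * b - 1) (c := 2 * c - 1) hm).mul_left
      (((m : ℝ)⁻¹) ^ (2 * a))
    rw [show 2 * b - 1 + 2 = 2 * b + 1 by omega, show 2 * c - 1 + 2 = 2 * c + 1 by omega,
      show 2 * b - 1 + (2 * c - 1) + 1 = 2 * b + 2 * c - 1 by omega,
      show 2 * b - 1 + (2 * c - 1) + 2 = 2 * b + 2 * c by omega,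
      show 2 * b - 1 + 1 = 2 * b by omega, show 2 * c - 1 + 1 = 2 * c by omega] at h1
    refine ((Equiv.neg ℤ).hasSum_iff.2 h1).congr_fun fun n => ?_
    simp only [lorentz_zero, Function.comp, Equiv.neg_apply, Int.cast_neg, inv_neg,
      (even_two_mul b).neg_pow, sub_neg_eq_add]
    rw [show -(m : ℝ) - n = -(m + n) by ring, inv_neg, (even_two_mul c).neg_pow, mul_assoc]
  have houter : HasSum (fun m : ℤ => ((m : ℝ)⁻¹) ^ (2 * a) *
      ((∑ j ∈ range (2 * b + 1), if j = 1 then 0 else (2 * b + 2 * c - 1 - j).choose (2 * c - 1)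
        * (evenPowSum j * ((m : ℝ)⁻¹) ^ (2 * b + 2 * c - j)))
      + ∑ j ∈ range (2 * c + 1), if j = 1 then 0 else (2 * b + 2 * c - 1 - j).choose (2 * b - 1)
        * (evenPowSum j * ((m : ℝ)⁻¹) ^ (2 * b + 2 * c - j))))
      ((∑ j ∈ range (2 * b + 1), if j = 1 then 0 else (2 * b + 2 * c - 1 - j).choose (2 * c - 1)
        * (evenPowSum j * evenPowSum (2 * (a + b + c) - j)))
      + ∑ j ∈ range (2 * c + 1), if j = 1 then 0 else (2 * b + 2 * c - 1 - j).choose (2 * b - 1)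
        * (evenPowSum j * evenPowSum (2 * (a + b + c) - j))) := by
    simp only [mul_add (_ ^ (2 * a))]
    have key : ∀ (N : ℕ) (C : ℕ → ℝ), N ≤ 2 * b + 2 * c - 2 →
        HasSum (fun m : ℤ => ((m : ℝ)⁻¹) ^ (2 * a) * ∑ j ∈ range (N + 1),
          if j = 1 then 0 else C j * (evenPowSum j * ((m : ℝ)⁻¹) ^ (2 * b + 2 * c - j)))
        (∑ j ∈ range (N + 1), if j = 1 then 0 else C j * (evenPowSum j * evenPowSum (2 * (a + b + c) - j))) := by
      intro N C hN
      simp only [mul_sum]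
      refine hasSum_sum fun j hj => ?_
      simp only [mem_range] at hj
      split_ifs
      · simp [hasSum_zero]
      · refine (((hasSum_int_inv_pow (j := 2 * (a + b + c) - j) (by omega)).mul_left
          (evenPowSum j)).mul_left (C j)).congr_fun fun m => ?_
        rw [show 2 * (a + b + c) - j = 2 * a + (2 * b + 2 * c - j) by omega, pow_add]
        ring
    exact (key (2 * b) _ (by omega)).add (key (2 * c) _ (by omega))
  have hsum := (summable_lorentz_zero_triple ha hb c).hasSum
  have htot := (hsum.prod_fiberwise hfib).unique houter
  rw [htot] at hsum
  refine hasSum_of_hasSum_of_eq hsum ?_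
  have half : ∀ b c : ℕ, 1 ≤ b → 1 ≤ c → ∑ j ∈ range (2 * b + 1), (if j = 1 then 0 else
        ((2 * b + 2 * c - 1 - j).choose (2 * c - 1) : ℝ) * (evenPowSum j * evenPowSum (2 * (a + b + c) - j)))
      = (-1) ^ (a + b + c) * (2 * Real.pi) ^ (2 * (a + b + c)) * ((topTerm (a + b + c) b c : ℚ) : ℝ) := by
    intro b c hb hc
    rw [sum_range_two_mul_add_one]
    · unfold topTerm
      push_cast
      rw [mul_sum]
      refine sum_congr rfl fun k hk => ?_
      have hk : k ≤ b := by simpa [Nat.lt_succ_iff] using hk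
      rw [if_neg (by omega), Nat.cast_choose ℝ (by omega : 2 * c - 1 ≤ 2 * b + 2 * c - 1 - 2 * k)]
      unfold evenPowSum
      rw [show 2 * (a + b + c) - 2 * k = 2 * (a + b + c - k) by omega, if_pos (even_two_mul _),
        if_pos (even_two_mul _), Nat.mul_div_cancel_left _ two_pos, Nat.mul_div_cancel_left _ two_pos,
        show 2 * b + 2 * c - 1 - 2 * k - (2 * c - 1) = 2 * b - 2 * k by omega,
        show 2 * b + 2 * c - 2 * k - 1 = 2 * b + 2 * c - 1 - 2 * k by omega,
        show (2 * Real.pi) ^ (2 * (a + b + c)) = (2 * Real.pi) ^ (2 * k) * (2 * Real.pi) ^ (2 * (a + b + c - k)) by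
          rw [← pow_add]; congr 1; omega,
        show (-1 : ℝ) ^ (a + b + c) = (-1) ^ (k + 1) * (-1) ^ (a + b + c - k + 1) by
          rw [← pow_add, show k + 1 + (a + b + c - k + 1) = a + b + c + 2 by omega, pow_add _ _ 2, neg_one_sq, mul_one]]
      field_simp
    · intro j
      have : ¬ Even (2 * j + 1) := by simp
      split_ifs
      · rfl
      · rw [evenPowSum, if_neg this]; simp
  have h2 := half c b hc hb
  rw [show a + c + b = a + b + c by ring] at h2
  rw [Rat.cast_add, mul_add (_ * _ : ℝ), ← half b c hb hc, ← h2]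
  congr 1
  exact sum_congr rfl fun j _ => by rw [add_comm (2 * c) (2 * b)]

/-- Positivity: up to sign and a power of 2π the coefficient is a sum of nonnegative terms, and the
term at (1, 1) is positive. -/
theorem topTerm_add_topTerm_ne_zero {a b c : ℕ} (ha : 1 ≤ a) (hb : 1 ≤ b) (hc : 1 ≤ c) :
    topTerm (a + b + c) b c + topTerm (a + b + c) c b ≠ 0 := by
  intro h
  have h1 := hasSum_lorentz_zero_triple ha hb hc
  rw [h, Rat.cast_zero, mul_zero] at h1
  have h2 := (hasSum_zero_iff_of_nonneg fun p => mul_nonneg (mul_nonneg (lorentz_nonneg _ _ _)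
    (lorentz_nonneg _ _ _)) (lorentz_nonneg _ _ _)).1 h1
  have := congrFun h2 (1, 1)
  simp [lorentz_zero] at this
  norm_num at this

/-! ### Absolute convergence of the lattice sum and continuity in x -/

/-- The cyclic permutation of triples with vanishing sum, in terms of the first two entries. -/
def cyclicShift (G : Type*) [AddCommGroup G] : G × G ≃ G × G where
  toFun p := (p.2, -p.1 - p.2)
  invFun p := (-p.1 - p.2, p.1)
  left_inv p := Prod.ext (by simp; abel) (by simp)
  right_inv p := Prod.ext (by simp) (by simp)

/-- With A, B, C the pairwise products of the three values, the summand is ABC, which is at most A³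
+ B³ + C³ by the arithmetic-geometric inequality. Each cube is a product series up to cyclic
relabelling, so cubic decay on ℤ² suffices. -/
theorem summable_sq_mul_sq_mul_sq {G : Type*} [AddCommGroup G] {h : G → ℝ} (h0 : ∀ p, 0 ≤ h p)
    (hs : Summable fun p => h p ^ 3) :
    Summable fun p : G × G => h p.1 ^ 2 * h p.2 ^ 2 * h (-p.1 - p.2) ^ 2 := by
  have h1 : Summable fun p : G × G => h p.1 ^ 3 * h p.2 ^ 3 :=
    hs.mul_of_nonneg hs (fun p => pow_nonneg (h0 p) 3) (fun p => pow_nonneg (h0 p) 3)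
  have h2 := (cyclicShift G).summable_iff.2 h1
  have h3 := (cyclicShift G).summable_iff.2 h2
  refine Summable.of_nonneg_of_le (fun p => by positivity) (fun p => ?_) ((h1.add h2).add h3)
  simp only [Function.comp, cyclicShift, Equiv.coe_fn_mk]
  rw [show -p.2 - (-p.1 - p.2) = p.1 by abel]
  have hA := mul_nonneg (h0 p.1) (h0 p.2)
  have hB := mul_nonneg (h0 p.2) (h0 (-p.1 - p.2))
  have hC := mul_nonneg (h0 (-p.1 - p.2)) (h0 p.1)
  simp only [← mul_pow]
  set A := h p.1 * h p.2 with hAd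
  set B := h p.2 * h (-p.1 - p.2) with hBd
  set C := h (-p.1 - p.2) * h p.1 with hCd
  have e1 : (A * h (-p.1 - p.2)) ^ 2 = A * B * C := by simp only [hAd, hBd, hCd]; ring
  rw [e1]
  nlinarith [mul_nonneg (add_nonneg (add_nonneg hA hB) hC) (add_nonneg (add_nonneg (sq_nonneg (A - B)) (sq_nonneg (B - C))) (sq_nonneg (C - A))),
    pow_nonneg hA 3, pow_nonneg hB 3, pow_nonneg hC 3]

theorem summable_inv_norm_pow_three : Summable fun p : ℤ × ℤ => (‖p‖⁻¹) ^ 3 := by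
  have h := EisensteinSeries.summable_one_div_norm_rpow (k := 3) (by norm_num)
  rw [← (finTwoArrowEquiv ℤ).symm.summable_iff] at h
  refine h.congr fun p => ?_
  have : ‖(finTwoArrowEquiv ℤ).symm p‖ = ‖p‖ := by
    rw [Prod.norm_def]
    refine le_antisymm ((pi_norm_le_iff_of_nonneg (by positivity)).2 fun i => ?_) (max_le ?_ ?_)
    · fin_cases i
      · exact le_max_left _ _
      · exact le_max_right _ _
    · exact norm_le_pi_norm ((finTwoArrowEquiv ℤ).symm p) 0
    · exact norm_le_pi_norm ((finTwoArrowEquiv ℤ).symm p) 1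
  simp only [Function.comp, this]
  rw [Real.rpow_neg (norm_nonneg _), inv_pow]
  norm_cast

/-- The factor `|m + n τ|^{-2a}`, equal to `0` at the origin when `1 ≤ a`. -/
noncomputable def latticeFactor (a : ℕ) (x y : ℝ) (p : ℤ × ℤ) : ℝ := lorentz a (p.2 * y) (p.1 + p.2 * x)

theorem latticeFactor_nonneg (a : ℕ) (x y : ℝ) (p : ℤ × ℤ) : 0 ≤ latticeFactor a x y p :=
  lorentz_nonneg _ _ _

theorem latticeFactor_neg (a : ℕ) (x y : ℝ) (p : ℤ × ℤ) : latticeFactor a x y (-p) = latticeFactor a x y p := by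
  unfold latticeFactor lorentz
  congr 2
  simp only [Prod.fst_neg, Prod.snd_neg, Int.cast_neg]
  ring

theorem latticeFactor_zero {a : ℕ} (ha : 1 ≤ a) (x y : ℝ) : latticeFactor a x y 0 = 0 := by
  simp [latticeFactor, lorentz, Nat.one_le_iff_ne_zero.1 ha]

theorem one_le_norm_of_ne_zero {p : ℤ × ℤ} (hp : p ≠ 0) : 1 ≤ ‖p‖ := by
  rw [Prod.norm_def]
  by_cases h : p.1 = 0
  · have h2 : p.2 ≠ 0 := fun h2 => hp (Prod.ext h h2)
    refine le_trans ?_ (le_max_right _ _)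
    rw [Int.norm_eq_abs]
    exact_mod_cast Int.one_le_abs h2
  · refine le_trans ?_ (le_max_left _ _)
    rw [Int.norm_eq_abs]
    exact_mod_cast Int.one_le_abs h

theorem exists_sq_norm_le {y : ℝ} (hy : 0 < y) (X : ℝ) : ∃ K : ℝ, 1 ≤ K ∧ ∀ x : ℝ, |x| ≤ X → ∀ p : ℤ × ℤ,
    ‖p‖ ^ 2 ≤ K * (((p.1 : ℝ) + p.2 * x) ^ 2 + ((p.2 : ℝ) * y) ^ 2) := by
  refine ⟨2 + (2 * X ^ 2 + 1) / y ^ 2, ?_, fun x hx p => ?_⟩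
  · have : 0 ≤ (2 * X ^ 2 + 1) / y ^ 2 := by positivity
    linarith
  set D := ((p.1 : ℝ) + p.2 * x) ^ 2 + ((p.2 : ℝ) * y) ^ 2 with hD
  have h1 : (p.2 : ℝ) ^ 2 ≤ D / y ^ 2 := by
    rw [le_div_iff₀ (by positivity), ← mul_pow, hD]
    nlinarith [sq_nonneg ((p.1 : ℝ) + p.2 * x)]
  have h2 : (p.1 : ℝ) ^ 2 ≤ 2 * D + 2 * X ^ 2 * (p.2 : ℝ) ^ 2 := by
    have hx2 : x ^ 2 ≤ X ^ 2 := by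
      rw [← sq_abs x]; exact pow_le_pow_left₀ (abs_nonneg x) hx 2
    have := mul_le_mul_of_nonneg_left hx2 (sq_nonneg (p.2 : ℝ))
    nlinarith [sq_nonneg ((p.1 : ℝ) + 2 * (p.2 * x)), sq_nonneg ((p.2 : ℝ) * y)]
  have h3 : ‖p‖ ^ 2 ≤ (p.1 : ℝ) ^ 2 + (p.2 : ℝ) ^ 2 := by
    rw [Prod.norm_def, Int.norm_eq_abs, Int.norm_eq_abs]
    rcases max_choice |(p.1 : ℝ)| |(p.2 : ℝ)| with h | h <;> rw [h, sq_abs] <;> nlinarith [sq_nonneg (p.1 : ℝ), sq_nonneg (p.2 : ℝ)]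
  calc ‖p‖ ^ 2 ≤ 2 * D + (2 * X ^ 2 + 1) * (p.2 : ℝ) ^ 2 := by linarith
    _ ≤ 2 * D + (2 * X ^ 2 + 1) * (D / y ^ 2) := by gcongr
    _ = _ := by ring

theorem latticeFactor_le {a : ℕ} (ha : 1 ≤ a) {y : ℝ} (hy : 0 < y) (X : ℝ) : ∃ B : ℝ, 0 ≤ B ∧
    ∀ x : ℝ, |x| ≤ X → ∀ p, latticeFactor a x y p ≤ B * (‖p‖⁻¹) ^ 2 := by
  obtain ⟨K, hK, h⟩ := exists_sq_norm_le hy X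
  refine ⟨K ^ a, by positivity, fun x hx p => ?_⟩
  by_cases hp : p = 0
  · subst hp
    rw [latticeFactor_zero ha]; positivity
  have h1 := h x hx p
  have h2 := one_le_norm_of_ne_zero hp
  unfold latticeFactor lorentz
  set D := ((p.1 : ℝ) + p.2 * x) ^ 2 + ((p.2 : ℝ) * y) ^ 2 with hD
  have D0 : 0 < D := by
    by_contra hcon
    have : K * D ≤ 0 := mul_nonpos_of_nonneg_of_nonpos (by linarith) (not_lt.1 hcon)
    nlinarith
  have h3 : D⁻¹ ≤ K * (‖p‖⁻¹) ^ 2 := by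
    rw [inv_pow, inv_le_iff_one_le_mul₀ D0, ← div_eq_mul_inv, div_mul_eq_mul_div, one_le_div (by positivity)]
    linarith
  have h4 : (‖p‖⁻¹) ^ 2 ≤ 1 := pow_le_one₀ (by positivity) (inv_le_one_of_one_le₀ h2)
  calc D⁻¹ ^ a ≤ (K * (‖p‖⁻¹) ^ 2) ^ a := by gcongr
    _ = K ^ a * ((‖p‖⁻¹) ^ 2) ^ a := mul_pow _ _ _
    _ ≤ K ^ a * ((‖p‖⁻¹) ^ 2) ^ 1 := by
        refine mul_le_mul_of_nonneg_left (pow_le_pow_of_le_one (by positivity) h4 ha) (by positivity)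
    _ = _ := by rw [pow_one]

/-- The summand of `C_{a,b,c}`, up to a power of `τ₂ / π`, as a function of two momenta. -/
noncomputable def latticeTerm (a b c : ℕ) (x y : ℝ) (p : (ℤ × ℤ) × (ℤ × ℤ)) : ℝ :=
  latticeFactor a x y p.1 * latticeFactor b x y p.2 * latticeFactor c x y (-p.1 - p.2)

theorem latticeTerm_nonneg (a b c : ℕ) (x y : ℝ) (p : (ℤ × ℤ) × (ℤ × ℤ)) : 0 ≤ latticeTerm a b c x y p :=
  mul_nonneg (mul_nonneg (latticeFactor_nonneg _ _ _ _) (latticeFactor_nonneg _ _ _ _))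
    (latticeFactor_nonneg _ _ _ _)

/-- The majorant is uniform for |x| ≤ X, which yields continuity in x and so integrability over a
period, besides convergence at each point. -/
theorem exists_summable_latticeTerm_le {a b c : ℕ} (ha : 1 ≤ a) (hb : 1 ≤ b) (hc : 1 ≤ c) {y : ℝ} (hy : 0 < y)
    (X : ℝ) : ∃ u : (ℤ × ℤ) × (ℤ × ℤ) → ℝ, Summable u ∧
      ∀ x : ℝ, |x| ≤ X → ∀ p, latticeTerm a b c x y p ≤ u p := by
  obtain ⟨A, hA, h1⟩ := latticeFactor_le ha hy X
  obtain ⟨B, hB, h2⟩ := latticeFactor_le hb hy X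
  obtain ⟨C, hC, h3⟩ := latticeFactor_le hc hy X
  refine ⟨_, (summable_sq_mul_sq_mul_sq (h := fun p : ℤ × ℤ => ‖p‖⁻¹) (fun p => by positivity)
    summable_inv_norm_pow_three).mul_left (A * B * C), fun x hx p => ?_⟩
  unfold latticeTerm
  calc _ ≤ (A * (‖p.1‖⁻¹) ^ 2) * (B * (‖p.2‖⁻¹) ^ 2) * (C * (‖-p.1 - p.2‖⁻¹) ^ 2) := by
        have h0 := latticeFactor_nonneg
        exact mul_le_mul (mul_le_mul (h1 x hx _) (h2 x hx _) (h0 _ _ _ _) (by positivity)) (h3 x hx _)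
          (h0 _ _ _ _) (by positivity)
    _ = _ := by ring

theorem summable_latticeTerm {a b c : ℕ} (ha : 1 ≤ a) (hb : 1 ≤ b) (hc : 1 ≤ c) (x : ℝ) {y : ℝ} (hy : 0 < y) :
    Summable (latticeTerm a b c x y) := by
  obtain ⟨u, hu, h⟩ := exists_summable_latticeTerm_le ha hb hc hy |x|
  exact Summable.of_nonneg_of_le (latticeTerm_nonneg _ _ _ _ _) (h x le_rfl) hu

theorem continuous_latticeFactor (a : ℕ) {y : ℝ} (hy : 0 < y) (p : ℤ × ℤ) :
    Continuous fun x => latticeFactor a x y p := by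
  unfold latticeFactor lorentz
  by_cases h : p.2 = 0
  · simp only [h, Int.cast_zero, zero_mul, add_zero]
    exact continuous_const
  · have : (p.2 : ℝ) ≠ 0 := by exact_mod_cast h
    exact (Continuous.inv₀ (by fun_prop) fun x => by positivity).pow a

theorem continuous_tsum_latticeTerm {a b c : ℕ} (ha : 1 ≤ a) (hb : 1 ≤ b) (hc : 1 ≤ c) {y : ℝ} (hy : 0 < y) :
    ContinuousOn (fun x => ∑' p, latticeTerm a b c x y p) (Set.uIcc 0 1) := by
  obtain ⟨u, hu, h⟩ := exists_summable_latticeTerm_le ha hb hc hy 1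
  refine continuousOn_tsum (fun p => ?_) hu fun p x hx => ?_
  · unfold latticeTerm
    exact (((continuous_latticeFactor a hy _).mul (continuous_latticeFactor b hy _)).mul
      (continuous_latticeFactor c hy _)).continuousOn
  · rw [Real.norm_of_nonneg (latticeTerm_nonneg a b c x y p)]
    rw [Set.uIcc_of_le zero_le_one] at hx
    exact h x (abs_le.2 ⟨by linarith [hx.1], hx.2⟩) p

theorem Momenta.eq_two (p : Momenta 3) : p.1 2 = -p.1 0 - p.1 1 := by
  have := p.2.2
  rw [Fin.sum_univ_three] at this
  refine sub_eq_zero.1 (Eq.trans ?_ this)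
  abel

/-- A triple of momenta is determined by the first two. -/
def Momenta.firstTwo (p : Momenta 3) : (ℤ × ℤ) × (ℤ × ℤ) := (p.1 0, p.1 1)

theorem Momenta.firstTwo_injective : Function.Injective Momenta.firstTwo := by
  intro p q h
  have h0 : p.1 0 = q.1 0 := congrArg Prod.fst h
  have h1 : p.1 1 = q.1 1 := congrArg Prod.snd h
  apply Subtype.ext
  funext r
  fin_cases r
  · exact h0
  · exact h1
  · exact (p.eq_two.trans (by rw [h0, h1])).trans q.eq_two.symm

/-- A zero momentum contributes nothing when the exponents are at least 1, so sums over `Momenta 3`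
may be taken over all pairs in ℤ². -/
theorem latticeTerm_eq_zero {a b c : ℕ} (ha : 1 ≤ a) (hb : 1 ≤ b) (hc : 1 ≤ c) (x y : ℝ)
    (p : (ℤ × ℤ) × (ℤ × ℤ)) (hp : p ∉ Set.range Momenta.firstTwo) : latticeTerm a b c x y p = 0 := by
  unfold latticeTerm
  by_contra hcon
  apply hp
  have h3 := right_ne_zero_of_mul hcon
  have h12 := left_ne_zero_of_mul hcon
  have h1 := left_ne_zero_of_mul h12
  have h2 := right_ne_zero_of_mul h12
  refine ⟨⟨![p.1, p.2, -p.1 - p.2], fun r => ?_, ?_⟩, rfl⟩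
  · fin_cases r
    · intro h; exact h1 (by rw [show p.1 = 0 from h, latticeFactor_zero ha])
    · intro h; exact h2 (by rw [show p.2 = 0 from h, latticeFactor_zero hb])
    · intro h; exact h3 (by rw [show -p.1 - p.2 = 0 from h, latticeFactor_zero hc])
  · rw [Fin.sum_univ_three]
    simp

theorem summand_eq_latticeTerm (a : Fin 3 → ℕ) (τ : ℂ) (p : Momenta 3) :
    summand a τ p = (τ.im / Real.pi) ^ weight a * latticeTerm (a 0) (a 1) (a 2) τ.re τ.im p.firstTwo := by
  have hp := Real.pi_pos
  have key : ∀ (q : ℤ × ℤ) (k : ℕ), (τ.im / (Real.pi * ‖((q.1 : ℂ) + (q.2 : ℂ) * τ)‖ ^ 2)) ^ k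
      = (τ.im / Real.pi) ^ k * latticeFactor k τ.re τ.im q := by
    intro q k
    unfold latticeFactor lorentz
    rw [← mul_pow, Complex.sq_norm, Complex.normSq_apply, div_mul_eq_div_div, div_eq_mul_inv]
    congr 3
    simp
    ring
  unfold summand weight latticeTerm Momenta.firstTwo
  rw [Fin.prod_univ_three, Fin.sum_univ_three, key, key, key, p.eq_two, pow_add, pow_add]
  ring

theorem summable_summand {a : Fin 3 → ℕ} (ha : ∀ r, 1 ≤ a r) {τ : ℂ} (hτ : 0 < τ.im) : Summable (summand a τ) := by
  have h := (Momenta.firstTwo_injective.summable_iff (latticeTerm_eq_zero (ha 0) (ha 1) (ha 2) τ.re τ.im)).2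
    (summable_latticeTerm (ha 0) (ha 1) (ha 2) τ.re hτ)
  exact (h.mul_left ((τ.im / Real.pi) ^ weight a)).congr fun p => (summand_eq_latticeTerm a τ p).symm

theorem modularGraphFunction_eq {a : Fin 3 → ℕ} (ha : ∀ r, 1 ≤ a r) (x y : ℝ) :
    modularGraphFunction a ((x : ℂ) + (y : ℂ) * Complex.I)
      = (y / Real.pi) ^ weight a * ∑' p, latticeTerm (a 0) (a 1) (a 2) x y p := by
  set τ := (x : ℂ) + (y : ℂ) * Complex.I with hτ
  have hre : τ.re = x := by simp [hτ]
  have him : τ.im = y := by simp [hτ]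
  unfold modularGraphFunction
  simp only [summand_eq_latticeTerm a τ, hre, him]
  rw [tsum_mul_left]
  congr 1
  refine Momenta.firstTwo_injective.tsum_eq (f := latticeTerm (a 0) (a 1) (a 2) x y) fun p hp => ?_
  by_contra hcon
  exact hp (latticeTerm_eq_zero (ha 0) (ha 1) (ha 2) x y p hcon)

theorem intervalIntegrable_modularGraphFunction {a : Fin 3 → ℕ} (ha : ∀ r, 1 ≤ a r) {y : ℝ} (hy : 0 < y) :
    IntervalIntegrable (fun x : ℝ => modularGraphFunction a ((x : ℂ) + (y : ℂ) * Complex.I)) volume 0 1 := by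
  simp only [modularGraphFunction_eq ha]
  exact ((continuous_tsum_latticeTerm (ha 0) (ha 1) (ha 2) hy).intervalIntegrable).const_mul _

/-! ### Rows of the lattice sum, their symmetries and their asymptotics -/

/-- The partial sum of the lattice sum with prescribed coefficients of `τ`. -/
noncomputable def latticeRow (a b c : ℕ) (x y : ℝ) (n : ℤ × ℤ) : ℝ :=
  ∑' m : ℤ × ℤ, latticeTerm a b c x y ((m.1, n.1), (m.2, n.2))

theorem summable_latticeRow {a b c : ℕ} (ha : 1 ≤ a) (hb : 1 ≤ b) (hc : 1 ≤ c) (x : ℝ) {y : ℝ} (hy : 0 < y) :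
    Summable (latticeRow a b c x y) ∧
    ∑' p, latticeTerm a b c x y p = ∑' n, latticeRow a b c x y n := by
  let e : (ℤ × ℤ) × (ℤ × ℤ) ≃ (ℤ × ℤ) × (ℤ × ℤ) :=
    (Equiv.prodComm _ _).trans (Equiv.prodProdProdComm ℤ ℤ ℤ ℤ)
  have h := e.summable_iff.2 (summable_latticeTerm ha hb hc x hy)
  refine ⟨h.prod, ?_⟩
  rw [← e.tsum_eq]
  exact h.tsum_prod

/-- Together with `latticeRow_swap` and `latticeRow_cyclic`, this moves every row to one with n₁ = 0
< n₂ or with n₁, n₂ > 0, at the price of permuting the exponents. -/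
theorem latticeRow_neg (a b c : ℕ) (x y : ℝ) (n : ℤ × ℤ) :
    latticeRow a b c x y (-n) = latticeRow a b c x y n := by
  unfold latticeRow
  rw [← (Equiv.neg (ℤ × ℤ)).tsum_eq]
  refine tsum_congr fun m => ?_
  unfold latticeTerm
  rw [← latticeFactor_neg a, ← latticeFactor_neg b, ← latticeFactor_neg c]
  congr 3
  · ext <;> simp
  · ext <;> simp
  · ext <;> simp <;> ring

theorem latticeRow_swap (a b c : ℕ) (x y : ℝ) (n : ℤ × ℤ) :
    latticeRow a b c x y n = latticeRow b a c x y (n.2, n.1) := by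
  unfold latticeRow
  rw [← (Equiv.prodComm ℤ ℤ).tsum_eq]
  refine tsum_congr fun m => ?_
  unfold latticeTerm
  simp only [Equiv.prodComm_apply, Prod.fst_swap, Prod.snd_swap]
  rw [mul_comm (latticeFactor a x y _)]
  congr 2
  abel

theorem latticeRow_cyclic (a b c : ℕ) (x y : ℝ) (n : ℤ × ℤ) :
    latticeRow a b c x y n = latticeRow b c a x y (n.2, -n.1 - n.2) := by
  unfold latticeRow
  rw [← (cyclicShift ℤ).tsum_eq (fun m => latticeTerm b c a x y ((m.1, n.2), (m.2, -n.1 - n.2)))]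
  refine tsum_congr fun m => ?_
  unfold latticeTerm cyclicShift
  simp only [Equiv.coe_fn_mk]
  rw [mul_assoc, mul_comm]
  congr 2
  ext <;> simp <;> ring

theorem lorentz_neg_left (a : ℕ) (c ξ : ℝ) : lorentz a (-c) ξ = lorentz a c ξ := by
  simp [lorentz]

/-- The third width is written (n₁ + n₂)y instead of its negative, since a Lorentzian depends on the
square of its width; on the positive cone all three widths are then positive. -/
theorem ofReal_latticeRow_eq_integral {a b c : ℕ} (ha : 1 ≤ a) (hb : 1 ≤ b) (hc : 1 ≤ c) (x y : ℝ) (n : ℤ × ℤ) :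
    (latticeRow a b c x y n : ℂ)
      = ∫ s in (0 : ℝ)..1, trigSeries (fun m => (lorentz a (n.1 * y) (m + n.1 * x) : ℂ)) s
          * trigSeries (fun m => (lorentz b (n.2 * y) (m + n.2 * x) : ℂ)) s
          * trigSeries (fun m => (lorentz c ((n.1 + n.2) * y) (m + (-(n.1 * x) - n.2 * x)) : ℂ)) s := by
  rw [integral_trigSeries_mul (summable_norm_lorentz ha _ _) (summable_norm_lorentz hb _ _)
    (summable_norm_lorentz hc _ _)]
  unfold latticeRow
  rw [Complex.ofReal_tsum]
  refine tsum_congr fun m => ?_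
  unfold latticeTerm latticeFactor
  push_cast
  congr 2
  rw [← lorentz_neg_left]
  simp only [Prod.fst_sub, Prod.snd_sub, Prod.fst_neg, Prod.snd_neg]
  push_cast
  congr 1 <;> ring

theorem exists_abs_latticeRow_cone_sub_le {a b c : ℕ} (ha : 1 ≤ a) (hb : 1 ≤ b) (hc : 1 ≤ c) :
    ∃ K : ℝ, 0 ≤ K ∧ ∀ y : ℝ, 1 ≤ y → ∀ (x : ℝ) (p : ℕ+ × ℕ+),
      |latticeRow a b c x y ((p.1 : ℤ), (p.2 : ℤ)) - 2 * ∫ t in Set.Ioi 0, besselKernel a (p.1 * y) t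
        * (besselKernel b (p.2 * y) t * besselKernel c (((p.1 : ℝ) + p.2) * y) t)|
      ≤ K * Real.exp (-(Real.pi / 2 * y)) * (1 / ((p.1 : ℝ) * p.2 * (p.1 + p.2))) := by
  obtain ⟨K, hK, h⟩ := exists_norm_integral_triple_sub_le ha hb hc
  refine ⟨K, hK, fun y hy x p => ?_⟩
  have h1 : (1 : ℝ) ≤ p.1 := by exact_mod_cast p.1.pos
  have h2 : (1 : ℝ) ≤ p.2 := by exact_mod_cast p.2.pos
  have y0 : 0 < y := by linarith
  have h3 := h y (p.1 * y) (p.2 * y) (((p.1 : ℝ) + p.2) * y) hy (le_mul_of_one_le_left y0.le h1)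
    (le_mul_of_one_le_left y0.le h2) (le_mul_of_one_le_left y0.le (by linarith)) (p.1 * x) (p.2 * x)
  have h4 := ofReal_latticeRow_eq_integral ha hb hc x y ((p.1 : ℤ), (p.2 : ℤ))
  simp only [Int.cast_natCast] at h4
  rw [← h4, ← Complex.ofReal_sub, Complex.norm_real, Real.norm_eq_abs] at h3
  simp only [mul_assoc (besselKernel a _ _)] at h3
  refine h3.trans ?_
  have y3 : 1 ≤ y ^ 3 := one_le_pow₀ hy
  rw [show K * Real.exp (-(Real.pi / 2 * y)) * (1 / ((p.1 : ℝ) * p.2 * (p.1 + p.2)))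
    = K / ((p.1 : ℝ) * p.2 * (p.1 + p.2)) * Real.exp (-(Real.pi / 2 * y)) by ring]
  refine mul_le_mul_of_nonneg_right (div_le_div_of_nonneg_left hK (by positivity) ?_) (Real.exp_pos _).le
  calc (p.1 : ℝ) * p.2 * (p.1 + p.2) ≤ (p.1 : ℝ) * p.2 * (p.1 + p.2) * y ^ 3 :=
        le_mul_of_one_le_right (by positivity) y3
    _ = _ := by ring

theorem exists_abs_latticeRow_line_sub_le {a b c : ℕ} (ha : 1 ≤ a) (hb : 1 ≤ b) (hc : 1 ≤ c) :
    ∃ K : ℝ, 0 ≤ K ∧ ∀ y : ℝ, 1 ≤ y → ∀ (x : ℝ) (n : ℕ+),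
      |latticeRow a b c x y (0, (n : ℤ)) - 2 * ∫ t in Set.Ioi 0, bernoulliWeight a t
        * (besselKernel b (n * y) t * besselKernel c (n * y) t)|
      ≤ K * Real.exp (-(Real.pi / 4 * y)) * Real.exp (-(Real.pi / 4 * n)) := by
  obtain ⟨K, hK, h⟩ := exists_norm_integral_pair_sub_le ha hb hc
  refine ⟨K, hK, fun y hy x n => ?_⟩
  have h1 : (1 : ℝ) ≤ n := by exact_mod_cast n.pos
  have y0 : 0 < y := by linarith
  have h2 := h (n * y) (by nlinarith) (n * x)
  have h4 := ofReal_latticeRow_eq_integral ha hb hc x y (0, (n : ℤ))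
  simp only [Int.cast_natCast, Int.cast_zero, zero_mul, zero_add, neg_zero, zero_sub] at h4
  rw [← h4, ← Complex.ofReal_sub, Complex.norm_real, Real.norm_eq_abs] at h2
  refine h2.trans ?_
  rw [mul_assoc, ← Real.exp_add]
  gcongr
  -- From ny ≥ n and ny ≥ y: the exponent (π/2)ny is at least (π/4)y + (π/4)n, one part for the
  -- decay in y and one for summation over n.
  nlinarith [Real.pi_pos, mul_nonneg (sub_nonneg.2 h1) (sub_nonneg.2 hy)]

/-- The prefactor (y/π)^w costs at most a multiple of e^(y/4); since π/4 > 3/4, the rate 1/2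
remains. This is the origin of δ = 1/2. -/
theorem exists_pow_mul_exp_le (w : ℕ) : ∃ B : ℝ, 0 ≤ B ∧ ∀ y : ℝ, 1 ≤ y →
    (y / Real.pi) ^ w * Real.exp (-(Real.pi / 4 * y)) ≤ B * Real.exp (-(1 / 2) * y) := by
  refine ⟨4 ^ w * w.factorial, by positivity, fun y hy => ?_⟩
  have hp := Real.pi_gt_three
  have h1 := Real.pow_div_factorial_le_exp (y / 4) (by linarith) w
  rw [div_le_iff₀ (by positivity)] at h1
  have h2 : (y / Real.pi) ^ w ≤ 4 ^ w * w.factorial * Real.exp (y / 4) := by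
    calc (y / Real.pi) ^ w ≤ y ^ w := by
          refine pow_le_pow_left₀ (by positivity) (div_le_self (by linarith) (by linarith)) w
      _ = 4 ^ w * (y / 4) ^ w := by rw [← mul_pow]; congr 1; ring
      _ ≤ 4 ^ w * (Real.exp (y / 4) * w.factorial) := by gcongr
      _ = _ := by ring
  calc _ ≤ 4 ^ w * w.factorial * Real.exp (y / 4) * Real.exp (-(Real.pi / 4 * y)) := by gcongr
    _ = 4 ^ w * w.factorial * Real.exp (y / 4 + -(Real.pi / 4 * y)) := by rw [Real.exp_add]; ring
    _ ≤ _ := by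
      gcongr
      nlinarith

theorem abs_mul_tsum_sub_le {ι : Type*} {r m e : ι → ℝ} {A E M : ℝ} (hA : 0 ≤ A) (hr : Summable r)
    (he : Summable e) (hm : HasSum (fun i => A * (2 * m i)) M) (h : ∀ i, |r i - m i| ≤ E * e i) :
    |A * (2 * ∑' i, r i) - M| ≤ A * E * (2 * ∑' i, e i) := by
  have h1 := ((hr.hasSum.mul_left 2).mul_left A).sub hm
  have h2 := ((he.hasSum.mul_left 2).mul_left (A * E))
  rw [← h1.tsum_eq, ← Real.norm_eq_abs]
  refine tsum_of_norm_bounded h2 fun i => ?_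
  rw [Real.norm_eq_abs, show A * (2 * r i) - A * (2 * m i) = A * 2 * (r i - m i) by ring, abs_mul,
    abs_of_nonneg (by positivity)]
  calc A * 2 * |r i - m i| ≤ A * 2 * (E * e i) := by gcongr; exact h i
    _ = _ := by ring

/-- Since √m √n ≤ m + n, the summand is at most m^(-3/2) n^(-3/2). -/
theorem summable_one_div_mul_mul_add : Summable fun p : ℕ+ × ℕ+ => 1 / ((p.1 : ℝ) * p.2 * (p.1 + p.2)) := by
  have h0 : Summable fun n : ℕ+ => 1 / ((n : ℝ)) ^ (3 / 2 : ℝ) :=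
    (Real.summable_one_div_nat_rpow.2 (by norm_num : (1 : ℝ) < 3 / 2)).comp_injective PNat.coe_injective
  have h1 : ∀ x : ℝ, 0 < x → x ^ (3 / 2 : ℝ) = x * √x := by
    intro x hx
    rw [show (3 / 2 : ℝ) = 1 + 1 / 2 by norm_num, Real.rpow_add hx, Real.rpow_one, Real.sqrt_eq_rpow]
  refine Summable.of_nonneg_of_le (fun _ => by positivity) (fun p => ?_)
    (h0.mul_of_nonneg h0 (fun _ => by positivity) (fun _ => by positivity))
  have h2 : (0 : ℝ) < p.1 := by exact_mod_cast p.1.pos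
  have h3 : (0 : ℝ) < p.2 := by exact_mod_cast p.2.pos
  rw [h1 _ h2, h1 _ h3, one_div_mul_one_div]
  refine one_div_le_one_div_of_le (by positivity) ?_
  have h4 : √(p.1 : ℝ) * √(p.2 : ℝ) ≤ p.1 + p.2 := by
    nlinarith [Real.sq_sqrt h2.le, Real.sq_sqrt h3.le, sq_nonneg (√(p.1 : ℝ) - √(p.2 : ℝ))]
  calc (p.1 : ℝ) * √(p.1 : ℝ) * (p.2 * √(p.2 : ℝ)) = p.1 * p.2 * (√(p.1 : ℝ) * √(p.2 : ℝ)) := by ring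
    _ ≤ _ := by gcongr

theorem summable_exp_neg_pi_div_four_mul : Summable fun n : ℕ+ => Real.exp (-(Real.pi / 4 * n)) := by
  have h := (Real.summable_exp_nat_mul_iff (a := -(Real.pi / 4))).2 (by linarith [Real.pi_pos])
  refine (h.comp_injective PNat.coe_injective).congr fun n => ?_
  simp only [Function.comp]
  congr 1; ring

theorem exists_abs_tsum_latticeRow_line_sub_le {a b c : ℕ} (ha : 1 ≤ a) (hb : 1 ≤ b) (hc : 1 ≤ c) :
    ∃ K : ℝ, 0 ≤ K ∧ ∀ y : ℝ, 1 ≤ y → ∀ x : ℝ,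
      |(y / Real.pi) ^ (a + b + c) * (2 * ∑' n : ℕ+, latticeRow a b c x y (0, (n : ℤ)))
        - pairMain a b c (4 * Real.pi * y)| ≤ K * Real.exp (-(1 / 2) * y) := by
  obtain ⟨K, hK, h⟩ := exists_abs_latticeRow_line_sub_le ha hb hc
  obtain ⟨B, hB, hB'⟩ := exists_pow_mul_exp_le (a + b + c)
  have s0 : 0 ≤ ∑' n : ℕ+, Real.exp (-(Real.pi / 4 * n)) := tsum_nonneg fun _ => (Real.exp_pos _).le
  refine ⟨B * K * (2 * ∑' n : ℕ+, Real.exp (-(Real.pi / 4 * n))), by positivity, fun y hy x => ?_⟩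
  have y0 : 0 < y := by linarith
  have hs : Summable fun n : ℕ+ => latticeRow a b c x y (0, (n : ℤ)) :=
    (summable_latticeRow ha hb hc x y0).1.comp_injective (i := fun n : ℕ+ => ((0 : ℤ), (n : ℤ)))
      fun m n hmn => by simpa using hmn
  refine (abs_mul_tsum_sub_le (by positivity) hs summable_exp_neg_pi_div_four_mul
    (hasSum_pair ha hb hc y0) (h y hy x)).trans ?_
  calc _ = (y / Real.pi) ^ (a + b + c) * Real.exp (-(Real.pi / 4 * y))
        * (K * (2 * ∑' n : ℕ+, Real.exp (-(Real.pi / 4 * n)))) := by ring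
    _ ≤ B * Real.exp (-(1 / 2) * y) * (K * (2 * ∑' n : ℕ+, Real.exp (-(Real.pi / 4 * n)))) :=
        mul_le_mul_of_nonneg_right (hB' y hy) (by positivity)
    _ = _ := by ring

theorem exists_abs_tsum_latticeRow_cone_sub_le {a b c : ℕ} (ha : 1 ≤ a) (hb : 1 ≤ b) (hc : 1 ≤ c) :
    ∃ K : ℝ, 0 ≤ K ∧ ∀ y : ℝ, 1 ≤ y → ∀ x : ℝ,
      |(y / Real.pi) ^ (a + b + c) * (2 * ∑' p : ℕ+ × ℕ+, latticeRow a b c x y ((p.1 : ℤ), (p.2 : ℤ)))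
        - 2 * ((Z a b c + Z b a c) * (4 * Real.pi * y) ^ (2 - ((a + b + c : ℕ) : ℤ)))|
        ≤ K * Real.exp (-(1 / 2) * y) := by
  obtain ⟨K, hK, h⟩ := exists_abs_latticeRow_cone_sub_le ha hb hc
  obtain ⟨B, hB, hB'⟩ := exists_pow_mul_exp_le (a + b + c)
  set S := ∑' p : ℕ+ × ℕ+, 1 / ((p.1 : ℝ) * p.2 * (p.1 + p.2)) with hS
  have s0 : 0 ≤ S := tsum_nonneg fun _ => by positivity
  refine ⟨B * K * (2 * S), by positivity, fun y hy x => ?_⟩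
  have y0 : 0 < y := by linarith
  have hs : Summable fun p : ℕ+ × ℕ+ => latticeRow a b c x y ((p.1 : ℤ), (p.2 : ℤ)) :=
    (summable_latticeRow ha hb hc x y0).1.comp_injective (i := fun p : ℕ+ × ℕ+ => ((p.1 : ℤ), (p.2 : ℤ)))
      fun m n hmn => by
        simp only [Prod.mk.injEq, Nat.cast_inj, PNat.coe_inj] at hmn
        exact Prod.ext hmn.1 hmn.2
  have hm := ((hasSum_triple ha hb hc y0).mul_left 2).congr_fun (g := fun p : ℕ+ × ℕ+ =>
    (y / Real.pi) ^ (a + b + c) * (2 * (2 * ∫ t in Set.Ioi 0, besselKernel a (p.1 * y) t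
        * (besselKernel b (p.2 * y) t * besselKernel c (((p.1 : ℝ) + p.2) * y) t)))) fun p => by ring
  refine (abs_mul_tsum_sub_le (by positivity) hs summable_one_div_mul_mul_add hm (h y hy x)).trans ?_
  calc _ = (y / Real.pi) ^ (a + b + c) * Real.exp (-(Real.pi / 2 * y)) * (K * (2 * S)) := by ring
    _ ≤ (y / Real.pi) ^ (a + b + c) * Real.exp (-(Real.pi / 4 * y)) * (K * (2 * S)) := by
        gcongr
        linarith [Real.pi_pos]
    _ ≤ B * Real.exp (-(1 / 2) * y) * (K * (2 * S)) :=
        mul_le_mul_of_nonneg_right (hB' y hy) (by positivity)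
    _ = _ := by ring

theorem latticeRow_zero {a b c : ℕ} (ha : 1 ≤ a) (hb : 1 ≤ b) (hc : 1 ≤ c) (x y : ℝ) :
    (y / Real.pi) ^ (a + b + c) * latticeRow a b c x y 0
      = ((topTerm (a + b + c) b c + topTerm (a + b + c) c b : ℚ) : ℝ) * (-4 * Real.pi * y) ^ (a + b + c) := by
  have h : latticeRow a b c x y 0 = (-1) ^ (a + b + c) * (2 * Real.pi) ^ (2 * (a + b + c))
      * ((topTerm (a + b + c) b c + topTerm (a + b + c) c b : ℚ) : ℝ) := by
    refine Eq.trans ?_ (hasSum_lorentz_zero_triple ha hb hc).tsum_eq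
    unfold latticeRow latticeTerm latticeFactor
    refine tsum_congr fun m => ?_
    simp
  rw [h, pow_mul, ← mul_pow, ← mul_assoc, ← mul_pow, mul_comm]
  congr 2
  have := Real.pi_pos.ne'
  field_simp
  ring

/-! ### Decomposition of ℤ² by signs and assembly of the estimate -/

theorem hasSum_ite_of_range_add_neg {ι M : Type*} [AddCommGroup M] {G : M → ℝ} (hG : Summable G)
    (he : ∀ n, G (-n) = G n) {g : ι → M} (hg : Function.Injective g) {c : M → Prop}
    [DecidablePred c] (hc : ∀ n, c n ↔ n ∈ Set.range g) :
    HasSum (fun n => (if c n then G n else 0) + if c (-n) then G n else 0) (2 * ∑' i, G (g i)) := by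
  have h1 : HasSum (fun n => if c n then G n else 0) (∑' i, G (g i)) := by
    refine (hg.hasSum_iff fun n hn => if_neg fun h => hn ((hc n).1 h)).1 ?_
    refine (hG.comp_injective hg).hasSum.congr_fun fun i => ?_
    simp only [Function.comp]
    rw [if_pos ((hc _).2 ⟨i, rfl⟩)]
  have h2 : HasSum (fun n => if c (-n) then G n else 0) (∑' i, G (g i)) := by
    refine ((Equiv.neg M).hasSum_iff.2 h1).congr_fun fun n => ?_
    simp only [Function.comp, Equiv.neg_apply, he]
  rw [two_mul]
  exact h1.add h2

theorem exists_pnat_eq {z : ℤ} (hz : 0 < z) : ∃ n : ℕ+, (n : ℤ) = z :=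
  ⟨⟨z.toNat, by omega⟩, by simp [hz.le]⟩

/-- The equations between propositions let the simplifier evaluate every indicator of the
decomposition in a given sign pattern. -/
theorem sign_cases (z : ℤ) : (z < 0 ∧ (z < 0) = True ∧ (0 < z) = False ∧ (z = 0) = False)
    ∨ (z = 0 ∧ (z < 0) = False ∧ (0 < z) = False ∧ (z = 0) = True)
    ∨ (0 < z ∧ (z < 0) = False ∧ (0 < z) = True ∧ (z = 0) = False) := by
  rcases lt_trichotomy z 0 with h | h | h
  · exact Or.inl ⟨h, eq_true h, eq_false h.not_gt, eq_false h.ne⟩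
  · exact Or.inr (Or.inl ⟨h, eq_false h.not_lt, eq_false h.not_gt, eq_true h⟩)
  · exact Or.inr (Or.inr ⟨h, eq_false h.not_gt, eq_true h, eq_false h.ne'⟩)

/-- Decomposition of an even sum over `ℤ²` according to the signs of `n₁`, `n₂` and `n₁ + n₂`. -/
theorem tsum_int_prod_of_even {G : ℤ × ℤ → ℝ} (hG : Summable G) (he : ∀ n, G (-n) = G n) :
    ∑' n, G n = G 0 + (2 * ∑' n : ℕ+, G (0, (n : ℤ)) + 2 * ∑' n : ℕ+, G ((n : ℤ), 0)
        + 2 * ∑' n : ℕ+, G ((n : ℤ), -(n : ℤ)))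
      + (2 * ∑' p : ℕ+ × ℕ+, G ((p.1 : ℤ), (p.2 : ℤ))
        + 2 * ∑' p : ℕ+ × ℕ+, G ((p.1 : ℤ), -((p.1 : ℤ) + p.2))
        + 2 * ∑' p : ℕ+ × ℕ+, G (-((p.1 : ℤ) + p.2), (p.1 : ℤ))) := by
  have pos : ∀ n : ℕ+, (0 : ℤ) < n := fun n => by exact_mod_cast n.pos
  have inj : ∀ m n : ℕ+, (m : ℤ) = n → m = n := fun m n h => by exact_mod_cast h
  have h0 : HasSum (fun n => if n = 0 then G n else 0) (G 0) := by
    refine (hasSum_ite_eq (0 : ℤ × ℤ) (G 0)).congr_fun fun n => ?_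
    split_ifs with h
    · rw [h]
    · rfl
  have h1 := hasSum_ite_of_range_add_neg hG he (g := fun n : ℕ+ => ((0 : ℤ), (n : ℤ)))
    (fun m n h => inj _ _ (congrArg Prod.snd h)) (c := fun n => n.1 = 0 ∧ 0 < n.2) fun n => by
      constructor
      · rintro ⟨h1, h2⟩
        obtain ⟨k, hk⟩ := exists_pnat_eq h2
        exact ⟨k, Prod.ext h1.symm hk⟩
      · rintro ⟨k, rfl⟩; exact ⟨rfl, pos k⟩
  have h2 := hasSum_ite_of_range_add_neg hG he (g := fun n : ℕ+ => ((n : ℤ), (0 : ℤ)))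
    (fun m n h => inj _ _ (congrArg Prod.fst h)) (c := fun n => 0 < n.1 ∧ n.2 = 0) fun n => by
      constructor
      · rintro ⟨h1, h2⟩
        obtain ⟨k, hk⟩ := exists_pnat_eq h1
        exact ⟨k, Prod.ext hk h2.symm⟩
      · rintro ⟨k, rfl⟩; exact ⟨pos k, rfl⟩
  have h3 := hasSum_ite_of_range_add_neg hG he (g := fun n : ℕ+ => ((n : ℤ), -(n : ℤ)))
    (fun m n h => inj _ _ (congrArg Prod.fst h)) (c := fun n => 0 < n.1 ∧ n.1 + n.2 = 0) fun n => by
      constructor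
      · rintro ⟨h1, h2⟩
        obtain ⟨k, hk⟩ := exists_pnat_eq h1
        exact ⟨k, Prod.ext hk (by simp only; omega)⟩
      · rintro ⟨k, rfl⟩; exact ⟨pos k, by simp⟩
  have h4 := hasSum_ite_of_range_add_neg hG he (g := fun p : ℕ+ × ℕ+ => ((p.1 : ℤ), (p.2 : ℤ)))
    (fun m n h => Prod.ext (inj _ _ (congrArg Prod.fst h)) (inj _ _ (congrArg Prod.snd h)))
    (c := fun n => 0 < n.1 ∧ 0 < n.2) fun n => by
      constructor
      · rintro ⟨h1, h2⟩
        obtain ⟨k, hk⟩ := exists_pnat_eq h1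
        obtain ⟨l, hl⟩ := exists_pnat_eq h2
        exact ⟨(k, l), Prod.ext hk hl⟩
      · rintro ⟨k, rfl⟩; exact ⟨pos k.1, pos k.2⟩
  have h5 := hasSum_ite_of_range_add_neg hG he (g := fun p : ℕ+ × ℕ+ => ((p.1 : ℤ), -((p.1 : ℤ) + p.2)))
    (fun m n h => by
      have e1 : (m.1 : ℤ) = n.1 := congrArg Prod.fst h
      have e2 : -((m.1 : ℤ) + m.2) = -((n.1 : ℤ) + n.2) := congrArg Prod.snd h
      exact Prod.ext (inj _ _ e1) (inj _ _ (by omega)))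
    (c := fun n => 0 < n.1 ∧ n.1 + n.2 < 0) fun n => by
      constructor
      · rintro ⟨h1, h2⟩
        obtain ⟨k, hk⟩ := exists_pnat_eq h1
        obtain ⟨l, hl⟩ := exists_pnat_eq (z := -(n.1 + n.2)) (by omega)
        exact ⟨(k, l), Prod.ext hk (by simp only; omega)⟩
      · rintro ⟨k, rfl⟩
        have := pos k.1
        have := pos k.2
        simp only
        omega
  have h6 := hasSum_ite_of_range_add_neg hG he (g := fun p : ℕ+ × ℕ+ => (-((p.1 : ℤ) + p.2), (p.1 : ℤ)))
    (fun m n h => by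
      have e1 : (m.1 : ℤ) = n.1 := congrArg Prod.snd h
      have e2 : -((m.1 : ℤ) + m.2) = -((n.1 : ℤ) + n.2) := congrArg Prod.fst h
      exact Prod.ext (inj _ _ e1) (inj _ _ (by omega)))
    (c := fun n => 0 < n.2 ∧ n.1 + n.2 < 0) fun n => by
      constructor
      · rintro ⟨h1, h2⟩
        obtain ⟨k, hk⟩ := exists_pnat_eq h1
        obtain ⟨l, hl⟩ := exists_pnat_eq (z := -(n.1 + n.2)) (by omega)
        exact ⟨(k, l), Prod.ext (by simp only; omega) hk⟩
      · rintro ⟨k, rfl⟩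
        have := pos k.1
        have := pos k.2
        simp only
        omega
  refine (((h0.add ((h1.add h2).add h3)).add ((h4.add h5).add h6)).congr_fun fun n => ?_).tsum_eq
  obtain ⟨m, n⟩ := n
  simp only [Prod.mk_eq_zero, Prod.fst_neg, Prod.snd_neg, Left.neg_pos_iff, neg_eq_zero, ← neg_add, neg_neg_iff_pos]
  -- Of the 27 sign patterns of (m, n, m + n), thirteen occur: the origin, six rays and six cones.
  -- Each lies in exactly one piece up to sign; the rest are contradictory.
  rcases sign_cases m with ⟨a, a1, a2, a3⟩ | ⟨a, a1, a2, a3⟩ | ⟨a, a1, a2, a3⟩ <;>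
    rcases sign_cases n with ⟨b, b1, b2, b3⟩ | ⟨b, b1, b2, b3⟩ | ⟨b, b1, b2, b3⟩ <;>
    rcases sign_cases (m + n) with ⟨c, c1, c2, c3⟩ | ⟨c, c1, c2, c3⟩ | ⟨c, c1, c2, c3⟩ <;>
    first
    | omega
    | simp only [a1, a2, a3, b1, b2, b3, c1, c2, c3, and_true, and_false, and_self, if_true,
        if_false, add_zero, zero_add]

/-- The Laurent polynomial, as a function of `τ₂`. -/
noncomputable def laurentValue (a : Fin 3 → ℕ) (y : ℝ) : ℝ :=
  (topCoeff a : ℝ) * (-4 * Real.pi * y) ^ weight a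
    + ∑ k ∈ Finset.Icc 1 (weight a - 1),
        (oddZetaCoeff a k : ℝ) * zeta (2 * k + 1) * (4 * Real.pi * y) ^ ((weight a : ℤ) - 2 * (k : ℤ) - 1)
    + bottomCoeff a * (4 * Real.pi * y) ^ (2 - (weight a : ℤ))

theorem evenMoment_comm (a b k : ℕ) : evenMoment a b k = evenMoment b a k := by
  unfold evenMoment
  rw [momentCoeff_comm, add_comm a b, Nat.sub_right_comm]

theorem weight_eq (a : Fin 3 → ℕ) : weight a = a 0 + a 1 + a 2 := Fin.sum_univ_three a

theorem sum_oddZetaTerm {a : Fin 3 → ℕ} (ha : ∀ r, 1 ≤ a r) (k : ℕ) :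
    ∑ σ : Equiv.Perm (Fin 3), oddZetaTerm (a (σ 0)) (a (σ 1)) (a (σ 2)) k
      = 2 * ((-1) ^ (a 0 + 1) * evenMoment (a 1) (a 2) k + (-1) ^ (a 1 + 1) * evenMoment (a 0) (a 2) k
        + (-1) ^ (a 2 + 1) * evenMoment (a 0) (a 1) k) := by
  rw [sum_perm_fin_three (fun i j l => oddZetaTerm (a i) (a j) (a l) k)]
  simp only [oddZetaTerm_add_comm (ha _) (ha _)]
  ring

theorem evenZetaCoeff_eq {a : Fin 3 → ℕ} (ha : ∀ r, 1 ≤ a r) :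
    evenZetaCoeff a * (-1) ^ weight a = 2 * ((-1) ^ a 0 * momentCoeff (a 1) (a 2) (2 * a 0 - 1)
      + (-1) ^ a 1 * momentCoeff (a 0) (a 2) (2 * a 1 - 1) + (-1) ^ a 2 * momentCoeff (a 0) (a 1) (2 * a 2 - 1)) := by
  unfold evenZetaCoeff
  rw [sum_perm_fin_three (fun i j l => evenZetaTerm (a i) (a j) (a l)), weight_eq]
  simp only [evenZetaTerm_add_comm (ha _) (ha _) (ha _), pow_add]
  rcases neg_one_pow_eq_or ℤ (a 0) with h0 | h0 <;> rcases neg_one_pow_eq_or ℤ (a 1) with h1 | h1 <;>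
    rcases neg_one_pow_eq_or ℤ (a 2) with h2 | h2 <;> rw [h0, h1, h2] <;> ring

/-- Regroups the stated coefficients by type of row: the origin, three lines through it, and three
pairs of opposite cones. -/
theorem laurentValue_eq {a : Fin 3 → ℕ} (ha : ∀ r, 1 ≤ a r) (y : ℝ) :
    laurentValue a y = (topCoeff a : ℝ) * (-4 * Real.pi * y) ^ weight a
      + (pairMain (a 0) (a 1) (a 2) (4 * Real.pi * y) + pairMain (a 1) (a 0) (a 2) (4 * Real.pi * y)
        + pairMain (a 2) (a 1) (a 0) (4 * Real.pi * y))
      + (2 * ((Z (a 0) (a 1) (a 2) + Z (a 1) (a 0) (a 2)) * (4 * Real.pi * y) ^ (2 - (weight a : ℤ)))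
        + 2 * ((Z (a 0) (a 2) (a 1) + Z (a 2) (a 0) (a 1)) * (4 * Real.pi * y) ^ (2 - (weight a : ℤ)))
        + 2 * ((Z (a 1) (a 2) (a 0) + Z (a 2) (a 1) (a 0)) * (4 * Real.pi * y) ^ (2 - (weight a : ℤ)))) := by
  have hb : (evenZetaCoeff a : ℝ) * (-1) ^ weight a = 2 * ((-1) ^ a 0 * momentCoeff (a 1) (a 2) (2 * a 0 - 1)
      + (-1) ^ a 1 * momentCoeff (a 0) (a 2) (2 * a 1 - 1) + (-1) ^ a 2 * momentCoeff (a 0) (a 1) (2 * a 2 - 1)) := by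
    exact_mod_cast evenZetaCoeff_eq ha
  unfold laurentValue bottomCoeff pairMain
  rw [hb, sum_perm_fin_three (fun i j l => Z (a i) (a j) (a l)), show a 1 + a 0 + a 2 = weight a by rw [weight_eq]; ring,
    show a 2 + a 1 + a 0 = weight a by rw [weight_eq]; ring, ← weight_eq, momentCoeff_comm (a 1) (a 0)]
  have hk : ∀ k, (oddZetaCoeff a k : ℝ) * zeta (2 * k + 1) * (4 * Real.pi * y) ^ ((weight a : ℤ) - 2 * (k : ℤ) - 1)
      = 4 * (-1) ^ (a 0 + 1) * ((bernoulli (2 * weight a - 2 * k - 2) : ℝ) / (2 * weight a - 2 * k - 2).factorial)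
        * evenMoment (a 1) (a 2) k * zeta (2 * k + 1) * (4 * Real.pi * y) ^ ((weight a : ℤ) - 2 * (k : ℤ) - 1)
      + 4 * (-1) ^ (a 1 + 1) * ((bernoulli (2 * weight a - 2 * k - 2) : ℝ) / (2 * weight a - 2 * k - 2).factorial)
        * evenMoment (a 0) (a 2) k * zeta (2 * k + 1) * (4 * Real.pi * y) ^ ((weight a : ℤ) - 2 * (k : ℤ) - 1)
      + 4 * (-1) ^ (a 2 + 1) * ((bernoulli (2 * weight a - 2 * k - 2) : ℝ) / (2 * weight a - 2 * k - 2).factorial)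
        * evenMoment (a 1) (a 0) k * zeta (2 * k + 1) * (4 * Real.pi * y) ^ ((weight a : ℤ) - 2 * (k : ℤ) - 1) := by
    intro k
    unfold oddZetaCoeff
    rw [sum_oddZetaTerm ha, evenMoment_comm (a 1) (a 0)]
    push_cast
    ring
  simp only [hk, sum_add_distrib]
  ring

/-- The uniform estimate at the cusp. -/
theorem exists_abs_modularGraphFunction_sub_le {a : Fin 3 → ℕ} (ha : ∀ r, 1 ≤ a r) : ∃ K : ℝ, ∀ y : ℝ, 1 ≤ y →
    ∀ x : ℝ, |modularGraphFunction a ((x : ℂ) + (y : ℂ) * Complex.I) - laurentValue a y|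
      ≤ K * Real.exp (-(1 / 2) * y) := by
  obtain ⟨K₁, -, h₁⟩ := exists_abs_tsum_latticeRow_line_sub_le (ha 0) (ha 1) (ha 2)
  obtain ⟨K₂, -, h₂⟩ := exists_abs_tsum_latticeRow_line_sub_le (ha 1) (ha 0) (ha 2)
  obtain ⟨K₃, -, h₃⟩ := exists_abs_tsum_latticeRow_line_sub_le (ha 2) (ha 1) (ha 0)
  obtain ⟨K₄, -, h₄⟩ := exists_abs_tsum_latticeRow_cone_sub_le (ha 0) (ha 1) (ha 2)
  obtain ⟨K₅, -, h₅⟩ := exists_abs_tsum_latticeRow_cone_sub_le (ha 0) (ha 2) (ha 1)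
  obtain ⟨K₆, -, h₆⟩ := exists_abs_tsum_latticeRow_cone_sub_le (ha 1) (ha 2) (ha 0)
  refine ⟨K₁ + K₂ + K₃ + (K₄ + K₅ + K₆), fun y hy x => ?_⟩
  have y0 : 0 < y := by linarith
  obtain ⟨hs, ht⟩ := summable_latticeRow (ha 0) (ha 1) (ha 2) x y0
  have g₁ := h₁ y hy x
  have g₂ := h₂ y hy x
  have g₃ := h₃ y hy x
  have g₄ := h₄ y hy x
  have g₅ := h₅ y hy x
  have g₆ := h₆ y hy x
  have g₀ := latticeRow_zero (ha 0) (ha 1) (ha 2) x y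
  rw [show a 1 + a 0 + a 2 = weight a by rw [weight_eq]; ring] at g₂
  rw [show a 2 + a 1 + a 0 = weight a by rw [weight_eq]; ring] at g₃
  rw [show a 0 + a 2 + a 1 = weight a by rw [weight_eq]; ring] at g₅
  rw [show a 1 + a 2 + a 0 = weight a by rw [weight_eq]; ring] at g₆
  rw [← weight_eq] at g₀ g₁ g₄
  -- The remaining rays and cones are carried to standard position; the vanishing momentum, or on a
  -- cone the one of largest absolute value, determines how the exponents are permuted.
  have e₂ : ∀ n : ℕ+, latticeRow (a 0) (a 1) (a 2) x y ((n : ℤ), 0)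
      = latticeRow (a 1) (a 0) (a 2) x y (0, (n : ℤ)) := fun n => latticeRow_swap _ _ _ _ _ _
  have e₃ : ∀ n : ℕ+, latticeRow (a 0) (a 1) (a 2) x y ((n : ℤ), -(n : ℤ))
      = latticeRow (a 2) (a 1) (a 0) x y (0, (n : ℤ)) := fun n => by
    rw [latticeRow_cyclic, latticeRow_swap, ← latticeRow_neg]
    congr 1
    ext <;> simp
  have e₅ : ∀ p : ℕ+ × ℕ+, latticeRow (a 0) (a 1) (a 2) x y ((p.1 : ℤ), -((p.1 : ℤ) + p.2))
      = latticeRow (a 0) (a 2) (a 1) x y ((p.1 : ℤ), (p.2 : ℤ)) := fun p => by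
    rw [latticeRow_swap, latticeRow_cyclic]
    congr 1
    ext <;> simp
  have e₆ : ∀ p : ℕ+ × ℕ+, latticeRow (a 0) (a 1) (a 2) x y (-((p.1 : ℤ) + p.2), (p.1 : ℤ))
      = latticeRow (a 1) (a 2) (a 0) x y ((p.1 : ℤ), (p.2 : ℤ)) := fun p => by
    rw [latticeRow_cyclic]
    congr 1
    ext <;> simp
  rw [modularGraphFunction_eq ha, ht, tsum_int_prod_of_even hs (latticeRow_neg _ _ _ _ _), laurentValue_eq ha]
  simp only [e₂, e₃, e₅, e₆]
  rw [topCoeff, ← weight_eq] at *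
  rw [mul_add, mul_add, mul_add _ _ (_ * _), mul_add _ _ (_ * _), mul_add _ (_ + _), mul_add _ (_ * _), g₀]
  rw [abs_le] at *
  constructor <;> linarith [g₁.1, g₁.2, g₂.1, g₂.2, g₃.1, g₃.2, g₄.1, g₄.2, g₅.1, g₅.2, g₆.1, g₆.2]

/-! ### The Laurent polynomial and its degree -/

/-- The Laurent polynomial of the constant mode. -/
noncomputable def laurentPart (a : Fin 3 → ℕ) : ℝ[T;T⁻¹] :=
  LaurentPolynomial.C ((topCoeff a : ℝ) * (-4 * Real.pi) ^ weight a) * LaurentPolynomial.T (weight a : ℤ)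
    + ∑ k ∈ Icc 1 (weight a - 1), LaurentPolynomial.C ((oddZetaCoeff a k : ℝ) * zeta (2 * k + 1)
        * (4 * Real.pi) ^ ((weight a : ℤ) - 2 * (k : ℤ) - 1)) * LaurentPolynomial.T ((weight a : ℤ) - 2 * (k : ℤ) - 1)
    + LaurentPolynomial.C (bottomCoeff a * (4 * Real.pi) ^ (2 - (weight a : ℤ)))
        * LaurentPolynomial.T (2 - (weight a : ℤ))

theorem smeval_sum {ι : Type*} (s : Finset ι) (f : ι → ℝ[T;T⁻¹]) (u : ℝˣ) :
    (∑ i ∈ s, f i).smeval u = ∑ i ∈ s, (f i).smeval u := by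
  induction s using Finset.cons_induction with
  | empty => simp
  | cons i s hi ih => rw [sum_cons, sum_cons, LaurentPolynomial.smeval_add, ih]

theorem smeval_laurentPart (a : Fin 3 → ℕ) {y : ℝ} (hy : 0 < y) :
    (laurentPart a).smeval (Units.mk0 y hy.ne') = laurentValue a y := by
  unfold laurentPart laurentValue
  rw [LaurentPolynomial.smeval_add, LaurentPolynomial.smeval_add, smeval_sum]
  simp only [LaurentPolynomial.smeval_C_mul_T_n, Units.val_zpow_eq_zpow_val, Units.val_mk0, smul_eq_mul,
    mul_zpow _ y, mul_pow _ y, zpow_natCast, Units.val_pow_eq_pow_val, ← mul_assoc]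

theorem coeff_C_mul_T (r : ℝ) (m n : ℤ) :
    (LaurentPolynomial.C r * LaurentPolynomial.T m : ℝ[T;T⁻¹]).coeff n = if m = n then r else 0 := by
  rw [← LaurentPolynomial.single_eq_C_mul_T]
  exact Finsupp.single_apply

theorem coeff_laurentPart (a : Fin 3 → ℕ) (n : ℤ) : (laurentPart a).coeff n
    = (if (weight a : ℤ) = n then (topCoeff a : ℝ) * (-4 * Real.pi) ^ weight a else 0)
      + ∑ k ∈ Icc 1 (weight a - 1), (if (weight a : ℤ) - 2 * (k : ℤ) - 1 = n then
        (oddZetaCoeff a k : ℝ) * zeta (2 * k + 1) * (4 * Real.pi) ^ ((weight a : ℤ) - 2 * (k : ℤ) - 1) else 0)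
      + (if 2 - (weight a : ℤ) = n then bottomCoeff a * (4 * Real.pi) ^ (2 - (weight a : ℤ)) else 0) := by
  unfold laurentPart
  simp only [← coeff_C_mul_T]
  simp

theorem three_le_weight {a : Fin 3 → ℕ} (ha : ∀ r, 1 ≤ a r) : 3 ≤ weight a := by
  rw [weight_eq]
  have := ha 0
  have := ha 1
  have := ha 2
  omega

theorem zeta_pos {s : ℕ} (hs : 2 ≤ s) : 0 < zeta s := by
  have h := hasSum_zeta hs
  rw [← h.tsum_eq]
  exact h.summable.tsum_pos (fun _ => by positivity) 1 (by simp)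

/-- At k = w - 1 the Bernoulli factor is B₀ = 1, and the permutation sum is -2 times the alternating
sum of the three moments of orders 2a₀, 2a₁ and 2a₂. -/
theorem oddZetaCoeff_weight_sub_one_ne_zero {a : Fin 3 → ℕ} (ha : ∀ r, 1 ≤ a r) :
    oddZetaCoeff a (weight a - 1) ≠ 0 := by
  have hw := three_le_weight ha
  have hw' := weight_eq a
  unfold oddZetaCoeff
  rw [show 2 * weight a - 2 * (weight a - 1) - 2 = 0 by omega, sum_oddZetaTerm ha]
  have e : ∀ i j k : Fin 3, a i + a j + a k = weight a →
      evenMoment (a i) (a j) (weight a - 1) = momentCoeff (a i) (a j) (2 * a k) := by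
    intro i j k h
    unfold evenMoment
    rw [if_pos (by omega), show weight a - 1 + 1 - a i - a j = a k by omega]
  rw [e 1 2 0 (by omega), e 0 2 1 (by omega), e 0 1 2 (by omega)]
  have h := momentCoeff_even_alternating_ne_zero (ha 0) (ha 1) (ha 2)
  refine mul_ne_zero (by simp) ?_
  rw [Int.cast_ne_zero]
  refine mul_ne_zero two_ne_zero fun h0 => h ?_
  rw [← neg_eq_zero, ← h0]
  ring

theorem isGreatest_laurentPart {a : Fin 3 → ℕ} (ha : ∀ r, 1 ≤ a r) :
    IsGreatest {n : ℤ | (laurentPart a).coeff n ≠ 0} (weight a : ℤ) := by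
  have hw := three_le_weight ha
  constructor
  · rw [Set.mem_ofPred_eq, coeff_laurentPart, if_pos rfl, if_neg (by omega), sum_eq_zero, add_zero, add_zero]
    · refine mul_ne_zero ?_ (pow_ne_zero _ (mul_ne_zero (by norm_num) Real.pi_ne_zero))
      rw [Rat.cast_ne_zero, topCoeff, weight_eq]
      exact topTerm_add_topTerm_ne_zero (ha 0) (ha 1) (ha 2)
    · intro k hk
      rw [mem_Icc] at hk
      exact if_neg (by omega)
  · intro n hn
    by_contra hlt
    refine hn ?_
    rw [coeff_laurentPart, if_neg (by omega), if_neg (by omega), sum_eq_zero, add_zero, add_zero]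
    intro k hk
    rw [mem_Icc] at hk
    exact if_neg (by omega)

/-- The exponent 1 - w is reached only at k = w - 1; the even-zeta and double-zeta terms stop at 2 -
w, so nothing can cancel it. -/
theorem isLeast_laurentPart {a : Fin 3 → ℕ} (ha : ∀ r, 1 ≤ a r) :
    IsLeast {n : ℤ | (laurentPart a).coeff n ≠ 0} (1 - (weight a : ℤ)) := by
  have hw := three_le_weight ha
  constructor
  · rw [Set.mem_ofPred_eq, coeff_laurentPart, if_neg (by omega), if_neg (by omega),
      sum_eq_single (weight a - 1), if_pos (by omega), add_zero, zero_add]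
    · refine mul_ne_zero (mul_ne_zero ?_ (zeta_pos (by omega)).ne') (zpow_ne_zero _ (by positivity))
      exact Rat.cast_ne_zero.2 (oddZetaCoeff_weight_sub_one_ne_zero ha)
    · intro k hk hne
      rw [mem_Icc] at hk
      exact if_neg (by omega)
    · intro h
      exact absurd (mem_Icc.2 ⟨by omega, le_rfl⟩) h
  · intro n hn
    by_contra hlt
    refine hn ?_
    rw [coeff_laurentPart, if_neg (by omega), if_neg (by omega), sum_eq_zero, add_zero, add_zero]
    intro k hk
    rw [mem_Icc] at hk
    exact if_neg (by omega)

/-- No averaging is needed for the decay: the estimate holds uniformly in x, and a period has length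
1. -/
theorem isBigO_constantMode_sub {a : Fin 3 → ℕ} (ha : ∀ r, 1 ≤ a r) :
    (fun y => constantMode a y - laurentValue a y) =O[atTop] fun y : ℝ => Real.exp (-(1 / 2) * y) := by
  obtain ⟨K, hK⟩ := exists_abs_modularGraphFunction_sub_le ha
  refine Asymptotics.IsBigO.of_bound K ?_
  filter_upwards [eventually_ge_atTop 1] with y hy
  have h1 := intervalIntegrable_modularGraphFunction ha (show 0 < y by linarith)
  have h2 : constantMode a y - laurentValue a y
      = ∫ x in (0 : ℝ)..1, (modularGraphFunction a ((x : ℂ) + (y : ℂ) * Complex.I) - laurentValue a y) := by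
    rw [intervalIntegral.integral_sub h1 intervalIntegrable_const]
    simp [constantMode]
  rw [h2, Real.norm_of_nonneg (Real.exp_pos _).le]
  have := intervalIntegral.norm_integral_le_of_norm_le_const (a := (0 : ℝ)) (b := 1)
    (f := fun x : ℝ => modularGraphFunction a ((x : ℂ) + (y : ℂ) * Complex.I) - laurentValue a y)
    (C := K * Real.exp (-(1 / 2) * y)) fun x _ => hK y hy x
  simpa using this

end ModularGraph

theorem theorem1 (a : Fin 3 → ℕ) (ha : ∀ r, 1 ≤ a r) :
    -- the defining series converges absolutely, and the constant mode is a genuine integral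
    (∀ τ : ℂ, 0 < τ.im → Summable (ModularGraph.summand a τ)) ∧
    (∀ y : ℝ, 0 < y → IntervalIntegrable
      (fun x : ℝ => ModularGraph.modularGraphFunction a ((x : ℂ) + (y : ℂ) * Complex.I))
      volume 0 1) ∧
    ∃ (L : ℝ[T;T⁻¹]) (E : ℝ → ℝ),
      -- `L` has degree `(w, 1 - w)`
      IsGreatest {n : ℤ | L.coeff n ≠ 0} (ModularGraph.weight a : ℤ) ∧
      IsLeast {n : ℤ | L.coeff n ≠ 0} (1 - (ModularGraph.weight a : ℤ)) ∧
      -- the explicit form of `L`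
      (∀ (y : ℝ) (hy : 0 < y), L.smeval (Units.mk0 y hy.ne') =
        (ModularGraph.topCoeff a : ℝ) * (-4 * Real.pi * y) ^ ModularGraph.weight a
        + ∑ k ∈ Finset.Icc 1 (ModularGraph.weight a - 1),
            (ModularGraph.oddZetaCoeff a k : ℝ) * ModularGraph.zeta (2 * k + 1)
              * (4 * Real.pi * y) ^ ((ModularGraph.weight a : ℤ) - 2 * (k : ℤ) - 1)
        + ModularGraph.bottomCoeff a
            * (4 * Real.pi * y) ^ (2 - (ModularGraph.weight a : ℤ))) ∧
      -- the constant mode is `L + E`, with `E` exponentially small at the cusp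
      (∀ (y : ℝ) (hy : 0 < y),
        ModularGraph.constantMode a y = L.smeval (Units.mk0 y hy.ne') + E y) ∧
      ∃ δ : ℝ, 0 < δ ∧ E =O[atTop] (fun y : ℝ => Real.exp (-δ * y)) := by
  refine ⟨fun τ hτ => ModularGraph.summable_summand ha hτ,
    fun y hy => ModularGraph.intervalIntegrable_modularGraphFunction ha hy,
    ModularGraph.laurentPart a, fun y => ModularGraph.constantMode a y - ModularGraph.laurentValue a y,
    ModularGraph.isGreatest_laurentPart ha, ModularGraph.isLeast_laurentPart ha,
    fun y hy => ModularGraph.smeval_laurentPart a hy, fun y hy => ?_,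
    1 / 2, by norm_num, ModularGraph.isBigO_constantMode_sub ha⟩
  rw [ModularGraph.smeval_laurentPart a hy]
  ring
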